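/- **Setting.** Let $k$ be a field of characteristic different from $2$, let $Q$ be a finite quiver (arrows are composed from right to left), and let $S$ be a potential on $Q$, i.e. a possibly infinite $k$-linear combination of cyclic paths of positive length. Let $\bar Q$ be the graded quiver with the vertices of $Q$ and with arrows: $\alpha:i\to j$ of degree $0$ and $\bar\alpha:j\to i$ of degree $-1$ for every arrow $\alpha:i\to j$ of $Q$, and a loop $t_i$ at $i$ of degree $-2$ for every vertex $i$. The complete Ginzburg dg algebra $\widehat\Gamma=\widehat\Gamma_{Q,S}$ is the graded algebra with $\widehat\Gamma^m=\prod_{w}kw$ ($w$ running over the paths of $\bar Q$ of degree $m$), with the continuous differential given, via linearity and the Leibniz rule, by $d\alpha=0$, $d\bar\alpha=\partial_\alpha S$ and $d t_i=e_i\big(\sum_{\alpha\in Q_1}(\alpha\bar\alpha-\bar\alpha\alpha)\big)e_i$. Here $\partial_\alpha$ is the cyclic derivative, $\partial_\alpha(\alpha_1\cdots\alpha_m)=\sum_{\alpha_l=\alpha}\alpha_{l+1}\cdots\alpha_m\alpha_1\cdots\alpha_{l-1}$. Let $G=\{1,\sigma\}=\mathbb Z/2$ act on the quiver $Q$ in such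 a way that $\sigma(S)$ is cyclically equivalent to $S$ (their difference lies in the closure of the span of the elements $\alpha_1\alpha_2\cdots\alpha_m-\alpha_2\cdots\alpha_m\alpha_1$ with $\alpha_1\cdots\alpha_m$ a cyclic path). **(1)** The action of $G$ on $Q$ induces an action of $G$ on $\widehat\Gamma$ by dg automorphisms: $\sigma$ acts by the continuous map with $e_i\mapsto e_{\sigma(i)}$, $\alpha\mapsto\sigma(\alpha)$, $\bar\alpha\mapsto\overline{\sigma(\alpha)}$, $t_i\mapsto t_{\sigma(i)}$. **(2)** Assume moreover that every arrow between two $\sigma$-fixed vertices is fixed by $\sigma$. Let $\widehat\Gamma G$ be the skew group dg algebra $\widehat\Gamma\otimes_k kG$, with $(x\otimes g)(y\otimes h)=x\,g(y)\otimes gh$ and $d(x\otimes g)=d(x)\otimes g$. Let $V$ and $W$ be the sets of fixed and of non-fixed vertices. Choose any set $o(W)$ of representatives of the $G$-orbits in $W$ and any set $o(Q_1)$ of representatives of the $G$-orbits of arrows. Put $e_i^{\pm}=\frac12 e_i\otimes(1\pm\sigma)$ for $i\in V$, $e_j^+=\frac12(e_j+e_{\sigma(j)})\otimes(1+\sigma)$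 for $j\in W$, and $\bar e=\sum_{i\in V}(e_i^++e_i^-)+\sum_{j\in o(W)}e_j^+$. Let $Q_G$ be the quiver with vertices $i^+,i^-$ $(i\in V)$ and $j^+$ $(j\in o(W))$, where for $j\in W\setminus o(W)$ we write $j^{+}=\sigma(j)^{+}$, and with the following arrows for $\alpha:i\to j$ in $o(Q_1)$: * $\alpha^\pm:i^\pm\to j^\pm$ if $i,j\in V$; * $\alpha^\pm:i^\pm\to j^+$ if $i\in V$, $j\in W$; * $\alpha^\pm:i^+\to j^\pm$ if $i\in W$, $j\in V$; * $\alpha^+:i^+\to j^+$ if $i,j\in W$. The arrow $\beta=\alpha^{\pm}$ of $Q_G$, from $p$ to $q$, is identified with the element $e_q(\alpha\otimes1)e_p$ of $\bar e\,\widehat\Gamma G\,\bar e$, where $e_{i^\pm}=e_i^\pm$ and $e_{j^+}=e_j^+$. In this way infinite combinations of cyclic paths of $Q_G$ take values in $\bar e\,\widehat\Gamma G\,\bar e$. Let $\iota(x)=\bar e(x\otimes1)\bar e$, and let $\iota'$ be the continuous linear map sending a cyclic path $w$ of $Q$ to $\iota(w)$ if $w$ starts and ends in $V$, and to $2\iota(w)$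 if $w$ starts and ends in $W$. Then there is exactly one potential $S_G$ on $Q_G$ whose value in $\bar e\,\widehat\Gamma G\,\bar e$ is the cyclic part $\sum_v e_v\,\iota'(S)\,e_v$ of $\iota'(S)$ ($v$ running over the vertices of $Q_G$); this cyclic part is $\iota'(S)$ itself if $\sigma(S)=S$. The element $\bar e$ is an idempotent cocycle of degree $0$, and the dg algebra $\bar e\,\widehat\Gamma G\,\bar e$ is isomorphic, as a dg algebra, to the complete Ginzburg dg algebra $\widehat\Gamma_{Q_G,S_G}$. -/

import Mathlib

noncomputable section

namespace QP

/-! ### Formal power series in noncommuting variables -/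

/-- Formal power series over `k` in noncommuting variables `X`: a series `f` is its family of
coefficients `f w`, indexed by the words `w` in `X`. -/
structure Series (k X : Type*) where
  /-- The family of coefficients. -/
  coeff : List X → k

namespace Series

variable {k X : Type*}

instance : FunLike (Series k X) (List X) k where
  coe := coeff
  coe_injective f g h := by cases f; cases g; congr

@[ext] theorem ext {f g : Series k X} (h : ∀ w, f w = g w) : f = g := DFunLike.ext _ _ h

@[simp] theorem mk_apply (c : List X → k) (w : List X) : (mk c : Series k X) w = c w := rfl

variable [CommRing k]

instance : Zero (Series k X) := ⟨⟨fun _ => 0⟩⟩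
instance : Add (Series k X) := ⟨fun f g => ⟨fun w => f w + g w⟩⟩
instance : Neg (Series k X) := ⟨fun f => ⟨fun w => -f w⟩⟩
instance : Sub (Series k X) := ⟨fun f g => ⟨fun w => f w - g w⟩⟩
instance {R : Type*} [SMul R k] : SMul R (Series k X) := ⟨fun c f => ⟨fun w => c • f w⟩⟩

instance : AddCommGroup (Series k X) :=
  Function.Injective.addCommGroup (fun f : Series k X => (f : List X → k)) DFunLike.coe_injective
    rfl (fun _ _ => rfl) (fun _ => rfl) (fun _ _ => rfl) (fun _ _ => rfl) (fun _ _ => rfl)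

instance : Module k (Series k X) where
  one_smul f := by ext w; exact one_smul k (f w)
  mul_smul c d f := by ext w; exact mul_smul c d (f w)
  smul_zero c := by ext w; exact smul_zero c
  smul_add c f g := by ext w; exact smul_add c (f w) (g w)
  add_smul c d f := by ext w; exact add_smul c d (f w)
  zero_smul f := by ext w; exact zero_smul k (f w)

@[simp] theorem zero_apply (w : List X) : (0 : Series k X) w = 0 := rfl
@[simp] theorem add_apply (f g : Series k X) (w : List X) : (f + g) w = f w + g w := rfl
@[simp] theorem neg_apply (f : Series k X) (w : List X) : (-f) w = -f w := rfl
@[simp] theorem sub_apply (f g : Series k X) (w : List X) : (f - g) w = f w - g w := rfl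
@[simp] theorem smul_apply (c : k) (f : Series k X) (w : List X) : (c • f) w = c * f w := rfl

/-- Evaluation of a coefficient, as a linear map. -/
def coeffₗ (w : List X) : Series k X →ₗ[k] k where
  toFun f := f w
  map_add' _ _ := rfl
  map_smul' _ _ := rfl

@[simp] theorem sum_apply {ι : Type*} (s : Finset ι) (f : ι → Series k X) (w : List X) :
    (∑ i ∈ s, f i) w = ∑ i ∈ s, f i w := map_sum (coeffₗ (k := k) w) f s

open Classical in
/-- The series consisting of a single word. -/
def word (l : List X) : Series k X := ⟨fun w => if w = l then 1 else 0⟩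

open Classical in
theorem word_apply (l w : List X) : (word l : Series k X) w = if w = l then 1 else 0 := rfl

instance : One (Series k X) := ⟨word []⟩

/-- Product: the coefficient of `w` is the sum of `f u * g v` over all factorisations `w = u v`. -/
instance : Mul (Series k X) :=
  ⟨fun f g => ⟨fun w => ∑ n ∈ Finset.range (w.length + 1), f (w.take n) * g (w.drop n)⟩⟩

theorem mul_apply (f g : Series k X) (w : List X) :
    (f * g) w = ∑ n ∈ Finset.range (w.length + 1), f (w.take n) * g (w.drop n) := rfl

/-- `f = f [] + ∑ a, a * shift a f`. -/
def shift (a : X) : Series k X →ₗ[k] Series k X where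
  toFun f := ⟨fun w => f (a :: w)⟩
  map_add' _ _ := rfl
  map_smul' _ _ := rfl

@[simp] theorem shift_apply (a : X) (f : Series k X) (w : List X) : shift a f w = f (a :: w) := rfl

theorem one_def : (1 : Series k X) = word [] := rfl

@[simp] theorem one_nil : (1 : Series k X) [] = 1 := by simp [one_def, word_apply]
@[simp] theorem shift_one (a : X) : shift a (1 : Series k X) = 0 := by
  ext w; simp [one_def, word_apply]

@[simp] theorem mul_nil (f g : Series k X) : (f * g) [] = f [] * g [] := by simp [mul_apply]

theorem mul_cons (f g : Series k X) (b : X) (w : List X) :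
    (f * g) (b :: w) = f [] * g (b :: w) + (shift b f * g) w := by
  rw [mul_apply, mul_apply, List.length_cons, Finset.sum_range_succ', add_comm]
  simp

theorem add_mul' (f g h : Series k X) : (f + g) * h = f * h + g * h := by
  ext w; simp [mul_apply, add_mul, Finset.sum_add_distrib]

theorem mul_add' (f g h : Series k X) : f * (g + h) = f * g + f * h := by
  ext w; simp [mul_apply, mul_add, Finset.sum_add_distrib]

theorem smul_mul' (c : k) (f g : Series k X) : (c • f) * g = c • (f * g) := by
  ext w; simp [mul_apply, mul_assoc, Finset.mul_sum]

theorem mul_smul' (c : k) (f g : Series k X) : f * (c • g) = c • (f * g) := by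
  ext w; simp [mul_apply, mul_left_comm, Finset.mul_sum]

theorem shift_mul (a : X) (f g : Series k X) :
    shift a (f * g) = f [] • shift a g + shift a f * g := by
  ext w; simp [mul_cons]

theorem mul_assoc' (f g h : Series k X) : f * g * h = f * (g * h) := by
  ext w
  induction w generalizing f g with
  | nil => simp [mul_assoc]
  | cons b w ih =>
    rw [mul_cons, mul_cons, shift_mul, add_mul', add_apply, ih, smul_mul', mul_cons]
    simp; ring

theorem zero_mul' (f : Series k X) : 0 * f = 0 := by ext w; simp [mul_apply]
theorem mul_zero' (f : Series k X) : f * 0 = 0 := by ext w; simp [mul_apply]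

theorem one_mul' (f : Series k X) : 1 * f = f := by
  ext w
  cases w with
  | nil => simp
  | cons b w => rw [mul_cons]; simp [zero_mul']

theorem mul_one' (f : Series k X) : f * 1 = f := by
  ext w
  induction w generalizing f with
  | nil => simp
  | cons b w ih =>
    rw [mul_cons, ih, ← shift_apply b 1 w, shift_one]; simp

instance : Ring (Series k X) where
  __ := (inferInstance : AddCommGroup (Series k X))
  zsmul := fun n f => n • f
  left_distrib := mul_add'
  right_distrib := add_mul'
  zero_mul := zero_mul'
  mul_zero := mul_zero'
  mul_assoc := mul_assoc'
  one_mul := one_mul'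
  mul_one := mul_one'

instance : Algebra k (Series k X) := Algebra.ofModule smul_mul' (fun c f g => mul_smul' c f g)

theorem exists_of_mul_ne {f g : Series k X} {w : List X} (h : (f * g) w ≠ 0) :
    ∃ u v, w = u ++ v ∧ f u ≠ 0 ∧ g v ≠ 0 := by
  rw [mul_apply] at h
  obtain ⟨n, -, hn⟩ := Finset.exists_ne_zero_of_sum_ne_zero h
  exact ⟨w.take n, w.drop n, (List.take_append_drop n w).symm, left_ne_zero_of_mul hn,
    right_ne_zero_of_mul hn⟩

/-! ### The continuous skew derivation with prescribed values on the variables -/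

/-- The degree of a word. -/
def wdeg (deg : X → ℤ) (w : List X) : ℤ := (w.map deg).sum

@[simp] theorem wdeg_nil (deg : X → ℤ) : wdeg deg [] = 0 := rfl
@[simp] theorem wdeg_cons (deg : X → ℤ) (a : X) (w : List X) :
    wdeg deg (a :: w) = deg a + wdeg deg w := by simp [wdeg]
@[simp] theorem wdeg_append (deg : X → ℤ) (u v : List X) :
    wdeg deg (u ++ v) = wdeg deg u + wdeg deg v := by simp [wdeg]

/-- The sign `(-1) ^ n`. -/
def sgn (k : Type*) [CommRing k] (n : ℤ) : k := ((n.negOnePow : ℤ) : k)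

@[simp] theorem sgn_zero : sgn k 0 = 1 := by simp [sgn]
theorem sgn_add (m n : ℤ) : sgn k (m + n) = sgn k m * sgn k n := by
  simp [sgn, Int.negOnePow_add]
theorem sgn_mul_self (n : ℤ) : sgn k n * sgn k n = 1 := by
  rw [sgn, ← Int.cast_mul, ← Units.val_mul, Int.units_mul_self]; simp
theorem sgn_succ (n : ℤ) : sgn k (n + 1) = -sgn k n := by
  simp [sgn, Int.negOnePow_succ]

/-- `∑ a, δ a * shift a f`: replace the first letter `a` of every word by `δ a`. -/
def headSubst [Fintype X] (δ : X → Series k X) : Series k X →ₗ[k] Series k X where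
  toFun f := ∑ a, δ a * shift a f
  map_add' f g := by simp [mul_add, Finset.sum_add_distrib]
  map_smul' c f := by simp [Finset.smul_sum]

/-- `f ↦ ∑_q f (p q) q`. -/
def shifts (p : List X) : Series k X →ₗ[k] Series k X where
  toFun f := ⟨fun q => f (p ++ q)⟩
  map_add' _ _ := rfl
  map_smul' _ _ := rfl

@[simp] theorem shifts_apply (p : List X) (f : Series k X) (q : List X) :
    shifts p f q = f (p ++ q) := rfl

@[simp] theorem shifts_nil (f : Series k X) : shifts [] f = f := rfl

/-- The continuous linear map with `a₁ ⋯ aₘ ↦ ∑ₗ (-1)^(deg (a₁ ⋯ aₗ₋₁)) a₁ ⋯ aₗ₋₁ δ(aₗ) aₗ₊₁ ⋯ aₘ`,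
given by its coefficients: the coefficient of `w` in the image of `f` is the sum over all
factorisations `w = p r` and all variables `a` of `(-1) ^ deg p` times the coefficient of `r` in
`δ a * h`, where `h = ∑_q f (p a q) q`. -/
def der [Fintype X] (deg : X → ℤ) (δ : X → Series k X) : Series k X →ₗ[k] Series k X where
  toFun f := ⟨fun w => ∑ n ∈ Finset.range (w.length + 1), sgn k (wdeg deg (w.take n)) *
    headSubst δ (shifts (w.take n) f) (w.drop n)⟩
  map_add' f g := by
    ext w
    simp [mul_add, Finset.sum_add_distrib]
  map_smul' c f := by
    ext w
    simp [Finset.mul_sum, mul_left_comm]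

section der

variable (deg : X → ℤ)

/-- The sign automorphism `w ↦ (-1) ^ deg w • w`. -/
def signTwist (f : Series k X) : Series k X := ⟨fun w => sgn k (wdeg deg w) * f w⟩

theorem shift_signTwist (f : Series k X) (b : X) :
    shift b (signTwist deg f) = sgn k (deg b) • signTwist deg (shift b f) := by
  ext w; simp [signTwist, sgn_add, mul_assoc]

variable [Fintype X] (δ : X → Series k X)

theorem der_apply (f : Series k X) (w : List X) :
    der deg δ f w = ∑ n ∈ Finset.range (w.length + 1), sgn k (wdeg deg (w.take n)) *
      headSubst δ (shifts (w.take n) f) (w.drop n) := rfl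

@[simp] theorem der_nil (f : Series k X) : der deg δ f [] = headSubst δ f [] := by
  simp [der_apply]

theorem der_cons (f : Series k X) (b : X) (w : List X) :
    der deg δ f (b :: w) = headSubst δ f (b :: w) + sgn k (deg b) * der deg δ (shift b f) w := by
  rw [der_apply, der_apply, List.length_cons, Finset.sum_range_succ', add_comm, Finset.mul_sum]
  congr 1
  · simp
  · refine Finset.sum_congr rfl fun n _ => ?_
    simp only [List.take_succ_cons, wdeg_cons, sgn_add, List.drop_succ_cons, mul_assoc]
    rfl

theorem shift_der (f : Series k X) (b : X) :
    shift b (der deg δ f) = shift b (headSubst δ f) + sgn k (deg b) • der deg δ (shift b f) := by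
  ext w; simp [der_cons]

theorem headSubst_mul (f g : Series k X) :
    headSubst δ (f * g) = f [] • headSubst δ g + headSubst δ f * g := by
  simp [headSubst, shift_mul, mul_add, Finset.sum_add_distrib, Finset.smul_sum, Finset.sum_mul,
    mul_assoc]

theorem der_mul (f g : Series k X) :
    der deg δ (f * g) = der deg δ f * g + signTwist deg f * der deg δ g := by
  ext w
  induction w generalizing f with
  | nil => simp [headSubst_mul, signTwist]; ring
  | cons b w ih =>
    rw [der_cons, shift_mul, map_add, add_apply, ih, headSubst_mul]
    simp only [add_apply, mul_cons, map_smul, smul_apply, shift_der, shift_signTwist, der_cons,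
      add_mul, smul_mul_assoc, der_nil]
    simp only [signTwist, mk_apply, wdeg_nil, sgn_zero, one_mul]
    ring

/-- The part of `der` not touching the first letter. -/
def tailDer (f : Series k X) : Series k X := der deg δ f - headSubst δ f

theorem tailDer_nil (f : Series k X) : tailDer deg δ f [] = 0 := by
  simp [tailDer]

theorem shift_tailDer (f : Series k X) (b : X) :
    shift b (tailDer deg δ f) = sgn k (deg b) • der deg δ (shift b f) := by
  simp [tailDer, shift_der]

theorem der_eq (f : Series k X) : der deg δ f = headSubst δ f + tailDer deg δ f := by
  simp [tailDer]

theorem der_der (hdeg : ∀ a w, δ a w ≠ 0 → wdeg deg w = deg a + 1)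
    (hsq : ∀ a, der deg δ (δ a) = 0) (f : Series k X) : der deg δ (der deg δ f) = 0 := by
  have htw : ∀ a, signTwist deg (δ a) = -(sgn k (deg a) • δ a) := by
    intro a; ext w
    by_cases h : δ a w = 0
    · simp [signTwist, h]
    · simp [signTwist, hdeg a w h, sgn_succ]
  have key : ∀ f, der deg δ (der deg δ f) = tailDer deg δ (tailDer deg δ f) := by
    intro f
    conv_lhs => rw [der_eq deg δ f, map_add, der_eq deg δ (tailDer deg δ f)]
    have : der deg δ (headSubst δ f) = - headSubst δ (tailDer deg δ f) := by
      simp [headSubst, der_mul, hsq, htw, shift_tailDer]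
    rw [this]; abel
  ext w
  induction w generalizing f with
  | nil => rw [key, tailDer_nil, zero_apply]
  | cons b w ih =>
    rw [key, ← shift_apply b _ w, shift_tailDer, shift_tailDer, map_smul, smul_apply, smul_apply, ih]
    simp

theorem exists_of_der_ne {f : Series k X} {w : List X} (h : der deg δ f w ≠ 0) :
    ∃ p v q a, w = p ++ v ++ q ∧ f (p ++ a :: q) ≠ 0 ∧ δ a v ≠ 0 := by
  rw [der_apply] at h
  obtain ⟨n, -, hn⟩ := Finset.exists_ne_zero_of_sum_ne_zero h
  have h1 := right_ne_zero_of_mul hn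
  simp only [headSubst, LinearMap.coe_mk, AddHom.coe_mk, sum_apply] at h1
  obtain ⟨a, -, ha⟩ := Finset.exists_ne_zero_of_sum_ne_zero h1
  obtain ⟨v, q, hvq, hv, hq⟩ := exists_of_mul_ne ha
  refine ⟨w.take n, v, q, a, ?_, hq, hv⟩
  rw [List.append_assoc, ← hvq, List.take_append_drop]

end der

theorem word_mul_word (u v : List X) : (word u * word v : Series k X) = word (u ++ v) := by
  classical
  ext w
  induction u generalizing w with
  | nil => exact DFunLike.congr_fun (one_mul (word v : Series k X)) w
  | cons a u ih =>
    cases w with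
    | nil => simp [word]
    | cons b w =>
      rw [mul_cons]
      by_cases hb : b = a
      · subst hb
        have : shift b (word (b :: u) : Series k X) = word u := by ext w; simp [word]
        rw [this, ih]; simp [word]
      · have : shift b (word (a :: u) : Series k X) = 0 := by ext w; simp [word, hb]
        rw [this, zero_mul']; simp [word, hb]

theorem headSubst_word [Fintype X] (δ : X → Series k X) (a : X) (l : List X) :
    headSubst δ (word (a :: l)) = δ a * word l := by
  classical
  simp only [headSubst, LinearMap.coe_mk, AddHom.coe_mk]
  rw [Finset.sum_eq_single a]
  · congr 1; ext w; simp [word]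
  · intro b _ hb
    have : shift b (word (a :: l) : Series k X) = 0 := by ext w; simp [word, hb]
    rw [this, mul_zero']
  · simp

theorem der_one [Fintype X] (deg : X → ℤ) (δ : X → Series k X) :
    der deg δ 1 = 0 := by
  have h := der_mul deg δ 1 1
  have : signTwist deg (1 : Series k X) = 1 := by
    ext w; cases w with
    | nil => simp [signTwist]
    | cons b w =>  rw [← shift_apply b _ w, ← shift_apply b _ w, shift_signTwist, shift_one]; simp [signTwist]
  rw [this, mul_one, one_mul, mul_one] at h
  simpa using h

theorem der_word_singleton [Fintype X] (deg : X → ℤ) (δ : X → Series k X) (a : X) :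
    der deg δ (word [a]) = δ a := by
  classical
  have h1 : headSubst δ (word [a]) = δ a := by rw [headSubst_word]; exact mul_one' _
  ext w
  cases w with
  | nil => rw [der_nil, h1]
  | cons b w =>
    rw [der_cons, h1]
    by_cases hb : b = a
    · subst hb
      have : shift b (word [b] : Series k X) = 1 := by ext w; simp [word]; rfl
      rw [this, der_one]; simp
    · have : shift b (word [a] : Series k X) = 0 := by ext w; simp [word, hb]
      rw [this]; simp

end Series

/-! ### Quivers and complete path algebras -/

/-- A quiver with set of vertices `V` and set of arrows `E`; `s a` and `t a` are the source and the
target of the arrow `a`. -/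
structure Quiv (V E : Type*) where
  /-- The source of an arrow. -/
  s : E → V
  /-- The target of an arrow. -/
  t : E → V

namespace Quiv

variable {V E : Type*} (Q : Quiv V E)

/-- `Q.IsPath i w j`: the word `w = a₁ ⋯ aₘ` is a path from `j` to `i`. Arrows are composed from
right to left, that is, `t a₁ = i`, `s aₗ = t aₗ₊₁` and `s aₘ = j`. -/
def IsPath : V → List E → V → Prop
  | i, [], j => i = j
  | i, a :: w, j => Q.t a = i ∧ IsPath (Q.s a) w j

@[simp] theorem isPath_nil (i j : V) : Q.IsPath i [] j ↔ i = j := Iff.rfl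
@[simp] theorem isPath_cons (i j : V) (a : E) (w : List E) :
    Q.IsPath i (a :: w) j ↔ Q.t a = i ∧ Q.IsPath (Q.s a) w j := Iff.rfl

theorem isPath_append (i j : V) (u v : List E) :
    Q.IsPath i (u ++ v) j ↔ ∃ l, Q.IsPath i u l ∧ Q.IsPath l v j := by
  induction u generalizing i with
  | nil => simp
  | cons a u ih => simp [ih, and_assoc]

/-- The word `w` is a cyclic path of positive length. -/
def IsCycle (w : List E) : Prop := w ≠ [] ∧ ∃ i, Q.IsPath i w i

end Quiv

open Series

section CompletePath

variable (k : Type*) [CommRing k] {V E : Type*} [Fintype V] [DecidableEq V] (Q : Quiv V E)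
  (deg : E → ℤ)

/-- The complete path algebra of the graded quiver `(Q, deg)`. The entry `f i j` of an element `f`
collects the coefficients `f i j w` of the paths `w` from `j` to `i`, so that the matrix product is
the product induced by composition of paths. An element of the graded algebra is a finite sum of
homogeneous elements, and each homogeneous element is an arbitrary family of coefficients of the
paths of the given degree. -/
def completePath : Subalgebra k (Matrix V V (Series k E)) where
  carrier := {f | (∀ i j w, f i j w ≠ 0 → Q.IsPath i w j) ∧
    ∃ F : Finset ℤ, ∀ i j w, f i j w ≠ 0 → wdeg deg w ∈ F}
  mul_mem' := by
    rintro f g ⟨hf, F, hF⟩ ⟨hg, G, hG⟩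
    have key : ∀ i j w, (f * g) i j w ≠ 0 → ∃ l u v, w = u ++ v ∧ f i l u ≠ 0 ∧ g l j v ≠ 0 := by
      intro i j w h
      rw [Matrix.mul_apply, Series.sum_apply] at h
      obtain ⟨l, -, hl⟩ := Finset.exists_ne_zero_of_sum_ne_zero h
      obtain ⟨u, v, h⟩ := exists_of_mul_ne hl
      exact ⟨l, u, v, h⟩
    refine ⟨fun i j w h => ?_, Finset.image₂ (· + ·) F G, fun i j w h => ?_⟩
    · obtain ⟨l, u, v, rfl, hu, hv⟩ := key i j w h
      exact (Q.isPath_append _ _ _ _).2 ⟨l, hf _ _ _ hu, hg _ _ _ hv⟩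
    · obtain ⟨l, u, v, rfl, hu, hv⟩ := key i j w h
      rw [wdeg_append]
      exact Finset.mem_image₂_of_mem (hF _ _ _ hu) (hG _ _ _ hv)
  add_mem' := by
    classical
    rintro f g ⟨hf, F, hF⟩ ⟨hg, G, hG⟩
    have key : ∀ i j w, (f + g) i j w ≠ 0 → f i j w ≠ 0 ∨ g i j w ≠ 0 := by
      intro i j w h
      by_contra! h'
      exact h (by simp [h'.1, h'.2])
    refine ⟨fun i j w h => (key i j w h).elim (hf i j w) (hg i j w), F ∪ G, fun i j w h => ?_⟩
    exact Finset.mem_union.2 ((key i j w h).imp (hF i j w) (hG i j w))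
  algebraMap_mem' := by
    classical
    intro c
    have key : ∀ i j w, (algebraMap k (Matrix V V (Series k E)) c) i j w ≠ 0 → i = j ∧ w = [] := by
      intro i j w h
      rw [Matrix.algebraMap_matrix_apply] at h
      split_ifs at h with hij
      · refine ⟨hij, ?_⟩
        rw [Algebra.algebraMap_eq_smul_one, Series.smul_apply, one_def, word_apply] at h
        by_contra hw
        simp [hw] at h
      · simp at h
    refine ⟨fun i j w h => ?_, {0}, fun i j w h => ?_⟩
    · obtain ⟨rfl, rfl⟩ := key i j w h; simp
    · obtain ⟨rfl, rfl⟩ := key i j w h; simp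

/-- The elements supported on paths of degree `n`. -/
def completePathGr (n : ℤ) : Submodule k (completePath k Q deg) where
  carrier := {f | ∀ i j w, f.1 i j w ≠ 0 → wdeg deg w = n}
  add_mem' := by
    intro f g hf hg i j w h
    by_contra h'
    refine h ?_
    have h1 := not_imp_comm.1 (hf i j w) h'
    have h2 := not_imp_comm.1 (hg i j w) h'
    change f.1 i j w + g.1 i j w = 0
    rw [h1, h2, add_zero]
  zero_mem' := by intro i j w h; exact absurd rfl h
  smul_mem' := by
    intro c f hf i j w h
    refine hf i j w fun h0 => h ?_
    change c * f.1 i j w = 0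
    rw [h0, mul_zero]

variable {k deg}

/-- The projection to the component of degree `n`. -/
def completePathProj (n : ℤ) : completePath k Q deg →ₗ[k] completePath k Q deg where
  toFun f := ⟨fun i j => ⟨fun w => open Classical in if wdeg deg w = n then f.1 i j w else 0⟩, by
    obtain ⟨f, hf, F, hF⟩ := f
    have key : ∀ i j w, (open Classical in if wdeg deg w = n then f i j w else 0) ≠ 0 →
        f i j w ≠ 0 := by
      intro i j w h
      split_ifs at h
      · exact h
      · exact absurd rfl h
    exact ⟨fun i j w h => hf i j w (key i j w h), F, fun i j w h => hF i j w (key i j w h)⟩⟩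
  map_add' f g := by
    refine Subtype.ext (funext fun i => funext fun j => Series.ext fun w => ?_)
    change (open Classical in if wdeg deg w = n then f.1 i j w + g.1 i j w else 0) =
      (open Classical in if wdeg deg w = n then f.1 i j w else 0) +
        (open Classical in if wdeg deg w = n then g.1 i j w else 0)
    split_ifs <;> simp
  map_smul' c f := by
    refine Subtype.ext (funext fun i => funext fun j => Series.ext fun w => ?_)
    change (open Classical in if wdeg deg w = n then c * f.1 i j w else 0) =
      c * (open Classical in if wdeg deg w = n then f.1 i j w else 0)
    split_ifs <;> simp

open Classical in
theorem completePathProj_apply (n : ℤ) (f : completePath k Q deg) (i j : V) (w : List E) :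
    (completePathProj Q n f).1 i j w = if wdeg deg w = n then f.1 i j w else 0 := rfl

/-- The vertex idempotent `e_i`. -/
def vertexElt (i : V) : completePath k Q deg :=
  ⟨Matrix.single i i 1, by
    have key : ∀ i' j w, (Matrix.single i i (1 : Series k E)) i' j w ≠ 0 →
        (i' = i ∧ j = i) ∧ w = [] := by
      intro i' j w h
      rw [Matrix.single_apply] at h
      split_ifs at h with hij
      · refine ⟨⟨hij.1.symm, hij.2.symm⟩, ?_⟩
        rw [one_def, word_apply] at h
        by_contra hw
        simp [hw] at h
      · simp at h
    refine ⟨fun i' j w h => ?_, {0}, fun i' j w h => ?_⟩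
    · obtain ⟨⟨rfl, rfl⟩, rfl⟩ := key i' j w h; simp
    · obtain ⟨-, rfl⟩ := key i' j w h; simp⟩

/-- The arrow `a`, as an element of the complete path algebra. -/
def arrowElt (a : E) : completePath k Q deg :=
  ⟨Matrix.single (Q.t a) (Q.s a) (word [a]), by
    have key : ∀ i' j w, (Matrix.single (Q.t a) (Q.s a) (word [a] : Series k E)) i' j w ≠ 0 →
        (Q.t a = i' ∧ Q.s a = j) ∧ w = [a] := by
      intro i' j w h
      rw [Matrix.single_apply] at h
      split_ifs at h with hij
      · refine ⟨hij, ?_⟩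
        rw [word_apply] at h
        by_contra hw
        simp [hw] at h
      · simp at h
    refine ⟨fun i' j w h => ?_, {deg a}, fun i' j w h => ?_⟩
    · obtain ⟨⟨rfl, rfl⟩, rfl⟩ := key i' j w h; simp
    · obtain ⟨-, rfl⟩ := key i' j w h; simp⟩

end CompletePath

/-! ### Differential graded algebras -/

/-- A differential graded algebra over `k` (cohomological grading, differential of degree `1`). -/
structure DGAlgebra (k : Type*) [CommRing k] where
  /-- The underlying algebra. -/
  carrier : Type*
  [ring : Ring carrier]
  [algebra : Algebra k carrier]
  /-- The homogeneous components. -/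
  gr : ℤ → Submodule k carrier
  [graded : SetLike.GradedMonoid gr]
  isInternal : DirectSum.IsInternal gr
  /-- The differential. -/
  d : carrier →ₗ[k] carrier
  d_mem : ∀ n x, x ∈ gr n → d x ∈ gr (n + 1)
  leibniz : ∀ n x y, x ∈ gr n → d (x * y) = d x * y + (n.negOnePow : ℤ) • (x * d y)
  d_d : ∀ x, d (d x) = 0

namespace DGAlgebra

instance (k : Type*) [CommRing k] : CoeSort (DGAlgebra k) (Type _) := ⟨carrier⟩

attribute [instance] ring algebra graded

variable {k : Type*} [CommRing k]

theorem isInternal_of_proj {A : Type*} [AddCommGroup A] [Module k A]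
    (gr : ℤ → Submodule k A) (π : ℤ → A →ₗ[k] A) (h1 : ∀ n x, π n x ∈ gr n)
    (h2 : ∀ n x, x ∈ gr n → π n x = x) (h3 : ∀ m n x, m ≠ n → x ∈ gr n → π m x = 0)
    (h4 : ∀ x, ∃ F : Finset ℤ, x = ∑ n ∈ F, π n x) : DirectSum.IsInternal gr := by
  have key : ∀ n (y : DirectSum ℤ fun i => gr i),
      π n (DirectSum.coeAddMonoidHom gr y) = y n := by
    intro n y
    induction y using DirectSum.induction_on with
    | zero => simp
    | of i x =>
      rw [DirectSum.coeAddMonoidHom_of]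
      by_cases h : n = i
      · subst h; rw [h2 n _ x.2, DirectSum.of_eq_same]
      · rw [h3 n i _ h x.2, DirectSum.of_eq_of_ne _ _ _ h]; rfl
    | add x y hx hy => simp [hx, hy]
  constructor
  · intro x y hxy
    refine DFinsupp.ext fun n => Subtype.ext ?_
    rw [← key, ← key, hxy]
  · intro x
    obtain ⟨F, hF⟩ := h4 x
    refine ⟨∑ n ∈ F, DirectSum.of (fun i => gr i) n ⟨π n x, h1 n x⟩, ?_⟩
    rw [map_sum]
    simp only [DirectSum.coeAddMonoidHom_of]
    exact hF.symm

/-- The projection to a homogeneous component. -/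
def proj (A : DGAlgebra k) (n : ℤ) : A →ₗ[k] A :=
  (A.gr n).subtype ∘ₗ DirectSum.component k ℤ (fun i => A.gr i) n ∘ₗ
    (LinearEquiv.ofBijective (DirectSum.coeLinearMap A.gr) A.isInternal).symm.toLinearMap

theorem proj_mem (A : DGAlgebra k) (n : ℤ) (x : A) : A.proj n x ∈ A.gr n :=
  Subtype.mem _

theorem proj_same (A : DGAlgebra k) (n : ℤ) (x : A) (hx : x ∈ A.gr n) :
    A.proj n x = x := by
  have := A.isInternal.ofBijective_coeLinearMap_of_mem hx
  exact congrArg Subtype.val this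

theorem proj_of_ne (A : DGAlgebra k) (m n : ℤ) (x : A) (hmn : m ≠ n) (hx : x ∈ A.gr n) :
    A.proj m x = 0 := by
  have := A.isInternal.ofBijective_coeLinearMap_of_mem_ne hmn.symm hx
  exact congrArg Subtype.val this

theorem induction (A : DGAlgebra k) {p : A → Prop} (h0 : p 0)
    (hadd : ∀ x y, p x → p y → p (x + y)) (h : ∀ n x, x ∈ A.gr n → p x) (x : A) : p x := by
  have hx : x ∈ ⨆ n, A.gr n := by rw [A.isInternal.submodule_iSup_eq_top]; trivial
  exact Submodule.iSup_induction A.gr (motive := p) hx h h0 hadd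

theorem exists_sum_proj (A : DGAlgebra k) (x : A) :
    ∃ F : Finset ℤ, ∀ F', F ⊆ F' → x = ∑ n ∈ F', A.proj n x := by
  classical
  induction x using A.induction with
  | h0 => exact ⟨∅, fun F' _ => by simp⟩
  | hadd x y hx hy =>
    obtain ⟨F, hF⟩ := hx
    obtain ⟨G, hG⟩ := hy
    refine ⟨F ∪ G, fun F' h => ?_⟩
    simp only [map_add, Finset.sum_add_distrib]
    rw [← hF F' (Finset.union_subset_left h), ← hG F' (Finset.union_subset_right h)]
  | h n x hx =>
    refine ⟨{n}, fun F' h => ?_⟩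
    rw [Finset.sum_eq_single n, A.proj_same n x hx]
    · intro m _ hm; exact A.proj_of_ne m n x hm hx
    · intro hn; exact absurd (h (Finset.mem_singleton_self n)) hn

theorem proj_mul_left (A : DGAlgebra k) {e : A} (he : e ∈ A.gr 0) (n : ℤ) (x : A) :
    A.proj n (e * x) = e * A.proj n x := by
  induction x using A.induction with
  | h0 => simp
  | hadd x y hx hy => simp [mul_add, hx, hy]
  | h m x hx =>
    have h : e * x ∈ A.gr m := by simpa using SetLike.GradedMul.mul_mem he hx
    by_cases hnm : n = m
    · subst hnm; rw [A.proj_same _ _ hx, A.proj_same _ _ h]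
    · rw [A.proj_of_ne _ _ _ hnm hx, A.proj_of_ne _ _ _ hnm h, mul_zero]

theorem proj_mul_right (A : DGAlgebra k) {e : A} (he : e ∈ A.gr 0) (n : ℤ) (x : A) :
    A.proj n (x * e) = A.proj n x * e := by
  induction x using A.induction with
  | h0 => simp
  | hadd x y hx hy => simp [add_mul, hx, hy]
  | h m x hx =>
    have h : x * e ∈ A.gr m := by simpa using SetLike.GradedMul.mul_mem hx he
    by_cases hnm : n = m
    · subst hnm; rw [A.proj_same _ _ hx, A.proj_same _ _ h]
    · rw [A.proj_of_ne _ _ _ hnm hx, A.proj_of_ne _ _ _ hnm h, zero_mul]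

end DGAlgebra

/-- An isomorphism of dg algebras: an isomorphism of algebras preserving degrees and commuting with
the differentials. -/
structure DGIso {k : Type*} [CommRing k] (A B : DGAlgebra k) extends A ≃ₐ[k] B where
  map_gr : ∀ n x, x ∈ A.gr n → toFun x ∈ B.gr n
  map_d : ∀ x, toFun (A.d x) = B.d (toFun x)

/-- An action of the group `G` on a dg algebra by dg automorphisms. -/
structure DGAction {k : Type*} [CommRing k] (G : Type*) [Group G] (A : DGAlgebra k) where
  /-- The underlying action by algebra automorphisms. -/
  hom : G →* (A ≃ₐ[k] A)
  map_gr : ∀ g n x, x ∈ A.gr n → hom g x ∈ A.gr n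
  map_d : ∀ g x, hom g (A.d x) = A.d (hom g x)

/-! ### Skew group dg algebras and corner dg algebras -/

namespace DGAction

variable {k : Type*} [CommRing k] {A : DGAlgebra k}

section action

variable {G : Type*} [Group G]

/-- The action of `G` on the ring underlying `A`. -/
abbrev mulSemiringAction (ρ : DGAction G A) : MulSemiringAction G A where
  smul g x := ρ.hom g x
  one_smul x := by change ρ.hom 1 x = x; rw [map_one]; rfl
  mul_smul g h x := by change ρ.hom (g * h) x = ρ.hom g (ρ.hom h x); rw [map_mul]; rfl
  smul_zero g := map_zero (ρ.hom g)
  smul_add g x y := map_add (ρ.hom g) x y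
  smul_one g := map_one (ρ.hom g)
  smul_mul g x y := map_mul (ρ.hom g) x y

theorem smulCommClass (ρ : DGAction G A) : letI := ρ.mulSemiringAction; SMulCommClass G k A :=
  letI := ρ.mulSemiringAction
  ⟨fun g c x => map_smul (ρ.hom g) c x⟩

end action

variable {G : Type*}

/-- Apply a linear map to the coefficients. -/
def mapCoeff (A : DGAlgebra k) (G : Type*) (φ : A →ₗ[k] A) :
    SkewMonoidAlgebra A G →ₗ[k] SkewMonoidAlgebra A G where
  toFun x := ⟨Finsupp.mapRange.linearMap φ x.coeff⟩
  map_add' x y := by ext g; simp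
  map_smul' c x := by ext g; simp

theorem mapCoeff_coeff (φ : A →ₗ[k] A) (x : SkewMonoidAlgebra A G) (g : G) :
    (mapCoeff A G φ x).coeff g = φ (x.coeff g) := rfl

theorem mapCoeff_single (φ : A →ₗ[k] A) (x : A) (g : G) :
    mapCoeff A G φ (SkewMonoidAlgebra.single g x) = SkewMonoidAlgebra.single g (φ x) := by
  classical
  ext h
  rw [mapCoeff_coeff, SkewMonoidAlgebra.coeff_single, SkewMonoidAlgebra.coeff_single,
    Finsupp.single_apply, Finsupp.single_apply, apply_ite φ, map_zero]

/-- The elements of a skew group algebra with all coefficients of degree `n`. -/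
def skewGr (A : DGAlgebra k) (G : Type*) (n : ℤ) : Submodule k (SkewMonoidAlgebra A G) where
  carrier := {x | ∀ g, x.coeff g ∈ A.gr n}
  add_mem' {x y} hx hy g := by
    rw [SkewMonoidAlgebra.coeff_add]; exact (A.gr n).add_mem (hx g) (hy g)
  zero_mem' _ := (A.gr n).zero_mem
  smul_mem' c x hx g := by
    rw [SkewMonoidAlgebra.coeff_smul]; exact (A.gr n).smul_mem c (hx g)

theorem single_mem_skewGr {n : ℤ} {x : A} (hx : x ∈ A.gr n) (g : G) :
    SkewMonoidAlgebra.single g x ∈ skewGr A G n := by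
  classical
  intro h
  rw [SkewMonoidAlgebra.coeff_single, Finsupp.single_apply]
  split_ifs
  · exact hx
  · exact (A.gr n).zero_mem

theorem skew_induction {p : SkewMonoidAlgebra A G → Prop} {n : ℤ} (h0 : p 0)
    (hadd : ∀ x y, p x → p y → p (x + y))
    (h : ∀ g x, x ∈ A.gr n → p (SkewMonoidAlgebra.single g x))
    (x : SkewMonoidAlgebra A G) (hx : x ∈ skewGr A G n) : p x := by
  rw [← SkewMonoidAlgebra.sum_single x, SkewMonoidAlgebra.sum_def]
  exact Finset.sum_induction _ p hadd h0 fun g _ => h g _ (hx g)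

theorem skew_isInternal : DirectSum.IsInternal (skewGr A G) := by
  classical
  refine DGAlgebra.isInternal_of_proj _ (fun n => mapCoeff A G (A.proj n))
    (fun n x g => A.proj_mem n _) (fun n x hx => ?_) (fun m n x hmn hx => ?_) fun x => ?_
  · ext g; exact A.proj_same n _ (hx g)
  · ext g; exact A.proj_of_ne m n _ hmn (hx g)
  · choose F hF using fun g => A.exists_sum_proj (x.coeff g)
    refine ⟨x.support.biUnion F, ?_⟩
    have hcoe : ∀ (s : Finset ℤ) (f : ℤ → SkewMonoidAlgebra A G) (g : G),
        (∑ n ∈ s, f n).coeff g = ∑ n ∈ s, (f n).coeff g := by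
      intro s f g
      induction s using Finset.induction_on with
      | empty => simp
      | insert a s ha ih => rw [Finset.sum_insert ha, Finset.sum_insert ha,
          SkewMonoidAlgebra.coeff_add, Finsupp.add_apply, ih]
    ext g
    rw [hcoe]
    simp only [mapCoeff_coeff]
    by_cases hg : g ∈ x.support
    · exact hF g _ (Finset.subset_biUnion_of_mem F hg)
    · rw [SkewMonoidAlgebra.notMem_support_iff.1 hg]; simp

end DGAction

open DGAction in
/-- The skew group dg algebra `A G`: the algebra of finite sums of elements `x ⊗ g`
(written `SkewMonoidAlgebra.single g x`), with product `(x ⊗ g) (y ⊗ h) = x (g • y) ⊗ g h` and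
differential `d (x ⊗ g) = d x ⊗ g`. -/
def DGAlgebra.skew {k : Type*} [CommRing k] {G : Type*} [Group G] {A : DGAlgebra k}
    (ρ : DGAction G A) : DGAlgebra k :=
  letI := ρ.mulSemiringAction
  haveI := ρ.smulCommClass
  { carrier := SkewMonoidAlgebra A G
    gr := skewGr A G
    graded :=
      { one_mem := single_mem_skewGr SetLike.GradedOne.one_mem 1
        mul_mem := by
          intro m n x y hx hy
          refine skew_induction (p := fun x => x * y ∈ skewGr A G (m + n)) ?_ ?_ ?_ x hx
          · rw [zero_mul]; exact zero_mem _
          · intro x x' h h'; rw [add_mul]; exact add_mem h h'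
          intro g x hx
          refine skew_induction (p := fun y => _ * y ∈ skewGr A G (m + n)) ?_ ?_ ?_ y hy
          · rw [mul_zero]; exact zero_mem _
          · intro y y' h h'; rw [mul_add]; exact add_mem h h'
          intro g' y hy
          rw [SkewMonoidAlgebra.single_mul_single]
          exact single_mem_skewGr (SetLike.GradedMul.mul_mem hx (ρ.map_gr g n y hy)) _ }
    isInternal := skew_isInternal
    d := mapCoeff A G A.d
    d_mem := fun n x hx g => A.d_mem n _ (hx g)
    leibniz := by
      intro n x y hx
      refine skew_induction (p := fun x => mapCoeff A G A.d (x * y) = mapCoeff A G A.d x * y +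
        (n.negOnePow : ℤ) • (x * mapCoeff A G A.d y)) ?_ ?_ ?_ x hx
      · simp
      · intro x x' h h'; rw [add_mul, map_add, h, h', map_add, add_mul, add_mul, zsmul_add]; abel
      · intro g x hx
        induction y using SkewMonoidAlgebra.induction_on' with
        | add y y' h h' => rw [mul_add, map_add, h, h', map_add, mul_add, mul_add, zsmul_add]; abel
        | single g' y =>
          rw [SkewMonoidAlgebra.single_mul_single, mapCoeff_single, mapCoeff_single,
            mapCoeff_single, SkewMonoidAlgebra.single_mul_single,
            SkewMonoidAlgebra.single_mul_single, A.leibniz n x _ hx,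
            SkewMonoidAlgebra.single_add]
          congr 1
          refine (map_zsmul (SkewMonoidAlgebra.singleAddHom (k := A) (g * g')) _ _).trans ?_
          have := ρ.map_d g y
          change _ = (n.negOnePow : ℤ) • SkewMonoidAlgebra.single (g * g') (x * ρ.hom g (A.d y))
          rw [this]
          rfl
    d_d := fun x => by
      ext g; exact A.d_d (x.coeff g) }

namespace DGAlgebra

variable {k : Type*} [CommRing k]

/-- The conditions on an element `e` for `e A e` to be a dg algebra with the induced grading and
differential: `e` is an idempotent cocycle of degree `0`. -/
structure IsDGIdempotent (A : DGAlgebra k) (e : A) : Prop where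
  idem : IsIdempotentElem e
  mem : e ∈ A.gr 0
  d_eq : A.d e = 0

namespace IsDGIdempotent

variable {A : DGAlgebra k} {e : A} (he : A.IsDGIdempotent e)

/-- The algebra `e A e`, with unit `e`. -/
abbrev Corner : Type _ := he.idem.Corner

theorem corner_mem (x : he.Corner) : e * x.1 = x.1 ∧ x.1 * e = x.1 :=
  (Subsemigroup.mem_corner_iff he.idem).1 x.2

/-- An element `x` with `e x = x = x e`, as an element of the corner. -/
def toCorner (x : A) (h : e * x = x ∧ x * e = x) : he.Corner :=
  ⟨x, (Subsemigroup.mem_corner_iff he.idem).2 h⟩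

instance : Module k he.Corner where
  smul c x := he.toCorner (c • x.1) (by
    rw [mul_smul_comm, smul_mul_assoc, (he.corner_mem x).1, (he.corner_mem x).2]; simp)
  one_smul x := Subtype.ext (one_smul k x.1)
  mul_smul c d x := Subtype.ext (mul_smul c d x.1)
  smul_zero c := Subtype.ext (smul_zero c)
  smul_add c x y := Subtype.ext (smul_add c x.1 y.1)
  add_smul c d x := Subtype.ext (add_smul c d x.1)
  zero_smul x := Subtype.ext (zero_smul k x.1)

instance : Algebra k he.Corner := Algebra.ofModule
  (fun c x y => Subtype.ext (smul_mul_assoc c x.1 y.1))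
  (fun c x y => Subtype.ext (mul_smul_comm c x.1 y.1))

/-- The inclusion of the corner. -/
def incl : he.Corner →ₗ[k] A where
  toFun x := x.1
  map_add' _ _ := rfl
  map_smul' _ _ := rfl

/-- Restrict to the corner a linear map preserving it. -/
def restrict (φ : A →ₗ[k] A) (h : ∀ x : he.Corner, e * φ x.1 = φ x.1 ∧ φ x.1 * e = φ x.1) :
    he.Corner →ₗ[k] he.Corner where
  toFun x := he.toCorner (φ x.1) (h x)
  map_add' x y := Subtype.ext (map_add φ x.1 y.1)
  map_smul' c x := Subtype.ext (map_smul φ c x.1)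

theorem d_corner (x : he.Corner) : e * A.d x.1 = A.d x.1 ∧ A.d x.1 * e = A.d x.1 := by
  constructor
  · have h := A.leibniz 0 e x.1 he.mem
    rw [he.d_eq, (he.corner_mem x).1] at h
    simpa using h.symm
  · have key : ∀ y : A, A.d (y * e) = A.d y * e := by
      intro y
      induction y using A.induction with
      | h0 => simp
      | hadd x y hx hy => rw [add_mul, map_add, hx, hy, map_add, add_mul]
      | h n x hx => rw [A.leibniz n x e hx, he.d_eq]; simp
    rw [← key, (he.corner_mem x).2]

theorem proj_corner (n : ℤ) (x : he.Corner) :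
    e * A.proj n x.1 = A.proj n x.1 ∧ A.proj n x.1 * e = A.proj n x.1 := by
  rw [← A.proj_mul_left he.mem, ← A.proj_mul_right he.mem, (he.corner_mem x).1,
    (he.corner_mem x).2]
  exact ⟨rfl, rfl⟩

end IsDGIdempotent

/-- The dg algebra `e A e`. -/
def corner (A : DGAlgebra k) (e : A) (he : A.IsDGIdempotent e) : DGAlgebra k where
  carrier := he.Corner
  gr n := (A.gr n).comap he.incl
  graded :=
    { one_mem := he.mem
      mul_mem := fun _ _ _ _ hx hy => SetLike.GradedMul.mul_mem (A := A.gr) hx hy }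
  isInternal := by
    refine isInternal_of_proj _ (fun n => he.restrict (A.proj n) (he.proj_corner n))
      (fun n x => A.proj_mem n _) (fun n x hx => Subtype.ext (A.proj_same n _ hx))
      (fun m n x hmn hx => Subtype.ext (A.proj_of_ne m n _ hmn hx)) fun x => ?_
    obtain ⟨F, hF⟩ := A.exists_sum_proj x.1
    refine ⟨F, Subtype.ext ?_⟩
    change x.1 = he.incl (∑ n ∈ F, _)
    rw [map_sum]
    exact hF F le_rfl
  d := he.restrict A.d he.d_corner
  d_mem n x hx := A.d_mem n _ hx
  leibniz n x y hx := by
    refine Subtype.ext ((A.leibniz n x.1 y.1 hx).trans ?_)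
    change _ = he.incl (_ + _)
    rw [map_add, map_zsmul]
    rfl
  d_d x := Subtype.ext (A.d_d x.1)

end DGAlgebra

/-! ### Complete path dg algebras and complete Ginzburg dg algebras -/

theorem signTwist_of_homogeneous {k E : Type*} [CommRing k] {deg : E → ℤ} {f : Series k E} {n : ℤ} (h : ∀ w, f w ≠ 0 → wdeg deg w = n) :
    signTwist deg f = sgn k n • f := by
  ext w
  by_cases hw : f w = 0
  · simp [signTwist, hw]
  · simp [signTwist, h w hw]

section PathDG

variable {k : Type*} [CommRing k] {V E : Type*} [Fintype V] [DecidableEq V] [Fintype E]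

/-- The conditions on prescribed values `δ a` of a differential on the arrows: `δ a` is a
combination of paths parallel to `a`, of degree `deg a + 1`, and the induced skew derivation
vanishes on `δ a`. -/
structure IsPathDifferential (Q : Quiv V E) (deg : E → ℤ) (δ : E → Series k E) : Prop where
  path : ∀ a w, δ a w ≠ 0 → Q.IsPath (Q.t a) w (Q.s a)
  deg_eq : ∀ a w, δ a w ≠ 0 → wdeg deg w = deg a + 1
  der_eq_zero : ∀ a, der deg δ (δ a) = 0

variable {Q : Quiv V E} {deg : E → ℤ} {δ : E → Series k E}

/-- The continuous differential on the complete path algebra with prescribed values on arrows. -/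
def pathD (h : IsPathDifferential Q deg δ) : completePath k Q deg →ₗ[k] completePath k Q deg where
  toFun f := ⟨f.1.map (der deg δ), by
    obtain ⟨f, hf, F, hF⟩ := f
    refine ⟨fun i j w hw => ?_, F.image (· + 1), fun i j w hw => ?_⟩
    · obtain ⟨p, v, q, a, rfl, hfa, hv⟩ := exists_of_der_ne deg δ hw
      have h1 := hf _ _ _ hfa
      rw [Quiv.isPath_append] at h1
      obtain ⟨l, hp, rfl, hq⟩ := h1
      rw [Quiv.isPath_append]
      exact ⟨_, (Q.isPath_append _ _ _ _).2 ⟨_, hp, h.path a v hv⟩, hq⟩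
    · obtain ⟨p, v, q, a, rfl, hfa, hv⟩ := exists_of_der_ne deg δ hw
      refine Finset.mem_image.2 ⟨_, hF _ _ _ hfa, ?_⟩
      simp only [wdeg_append, wdeg_cons, h.deg_eq a v hv]
      ring⟩
  map_add' f g := Subtype.ext (funext fun i => funext fun j => map_add (der deg δ) _ _)
  map_smul' c f := Subtype.ext (funext fun i => funext fun j => map_smul (der deg δ) _ _)

theorem pathD_apply (h : IsPathDifferential Q deg δ) (f : completePath k Q deg) (i j : V) :
    (pathD h f).1 i j = der deg δ (f.1 i j) := rfl

/-- The dg algebra whose underlying graded algebra is the complete path algebra of `(Q, deg)` and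
whose differential is the continuous map with `d a = δ a` for every arrow `a`, extended by
linearity and the Leibniz rule. -/
def pathDG (h : IsPathDifferential Q deg δ) : DGAlgebra k where
  carrier := completePath k Q deg
  gr := completePathGr k Q deg
  graded :=
    { one_mem := by
        intro i j w hw
        have hw' : (1 : Matrix V V (Series k E)) i j w ≠ 0 := hw
        rw [Matrix.one_apply] at hw'
        split_ifs at hw'
        · rw [one_def, word_apply] at hw'
          by_contra hne
          refine hw' (if_neg ?_)
          rintro rfl
          exact hne rfl
        · exact absurd rfl hw'
      mul_mem := by
        intro m n f g hf hg i j w hw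
        have hw' : (f.1 * g.1) i j w ≠ 0 := hw
        rw [Matrix.mul_apply, Series.sum_apply] at hw'
        obtain ⟨l, -, hl⟩ := Finset.exists_ne_zero_of_sum_ne_zero hw'
        obtain ⟨u, v, rfl, hu, hv⟩ := exists_of_mul_ne hl
        rw [wdeg_append, hf _ _ _ hu, hg _ _ _ hv] }
  isInternal := by
    classical
    refine DGAlgebra.isInternal_of_proj _ (completePathProj Q) (fun n f i j w hw => ?_)
      (fun n f hf => ?_) (fun m n f hmn hf => ?_) fun f => ?_
    · rw [completePathProj_apply] at hw
      by_contra hne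
      exact hw (if_neg hne)
    · refine Subtype.ext (funext fun i => funext fun j => Series.ext fun w => ?_)
      rw [completePathProj_apply]
      split_ifs with hw
      · rfl
      · exact (not_imp_comm.1 (hf i j w) hw).symm
    · refine Subtype.ext (funext fun i => funext fun j => Series.ext fun w => ?_)
      rw [completePathProj_apply]
      split_ifs with hw
      · exact not_imp_comm.1 (hf i j w) (fun h => hmn (hw.symm.trans h))
      · rfl
    · obtain ⟨F, hF⟩ := f.2.2
      refine ⟨F, Subtype.ext (funext fun i => funext fun j => Series.ext fun w => ?_)⟩
      have : (∑ n ∈ F, completePathProj Q n f : completePath k Q deg).1 i j w =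
          ∑ n ∈ F, if wdeg deg w = n then f.1 i j w else 0 := by
        rw [AddSubmonoidClass.coe_finsetSum, Matrix.sum_apply, Series.sum_apply]
        rfl
      rw [this, Finset.sum_ite_eq]
      split_ifs with hw
      · rfl
      · exact not_imp_comm.1 (hF i j w) hw
  d := pathD h
  d_mem := by
    intro n f hf i j w hw
    obtain ⟨p, v, q, a, rfl, hfa, hv⟩ := exists_of_der_ne deg δ hw
    have := hf _ _ _ hfa
    simp only [wdeg_append, wdeg_cons, h.deg_eq a v hv] at this ⊢
    linarith
  leibniz := by
    intro n f g hf
    refine Subtype.ext (funext fun i => funext fun j => ?_)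
    change der deg δ ((f.1 * g.1) i j) = ((pathD h f).1 * g.1) i j +
      (n.negOnePow : ℤ) • ((f.1 * (pathD h g).1) i j)
    simp only [Matrix.mul_apply, map_sum, der_mul, Finset.sum_add_distrib, pathD_apply]
    congr 1
    rw [Finset.smul_sum]
    refine Finset.sum_congr rfl fun l _ => ?_
    rw [signTwist_of_homogeneous (hf i l), smul_mul_assoc, sgn, Int.cast_smul_eq_zsmul]
  d_d f := Subtype.ext (funext fun i => funext fun j =>
    der_der deg δ h.deg_eq h.der_eq_zero (f.1 i j))

end PathDG

/-- A potential on `Q`: a (possibly infinite) linear combination of cyclic paths. -/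
structure Potential (k : Type*) [CommRing k] {V E : Type*} (Q : Quiv V E) where
  /-- The family of coefficients. -/
  series : Series k E
  isCycle : ∀ w, series w ≠ 0 → Q.IsCycle w

namespace Potential

variable {k : Type*} [CommRing k] {V E : Type*} {Q : Quiv V E}

/-- The cyclic derivative `∂_a S`, the continuous linear extension of
`∂_a (a₁ ⋯ aₘ) = ∑_{aₗ = a} aₗ₊₁ ⋯ aₘ a₁ ⋯ aₗ₋₁`: the coefficient of `w` in `∂_a S` is the sum of
the coefficients of `v a u` in `S` over all factorisations `w = u v`. -/
def cyclicDeriv (S : Potential k Q) (a : E) : Series k E :=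
  ⟨fun w => ∑ n ∈ Finset.range (w.length + 1), S.series (w.drop n ++ a :: w.take n)⟩

/-- Cyclic equivalence: `S - T` is in the closure, for the topology defined by the powers of the
arrow ideal, of the span of the elements `a₁ a₂ ⋯ aₘ - a₂ ⋯ aₘ a₁` with `a₁ ⋯ aₘ` a cyclic path. -/
def CyclicEquiv (S T : Potential k Q) : Prop :=
  ∀ N : ℕ, ∃ c ∈ Submodule.span k {x : Series k E | ∃ w, Q.IsCycle w ∧
      x = word w - word (w.rotate 1)},
    ∀ w : List E, w.length < N → (S.series - T.series) w = c w

end Potential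

/-- The arrows of the quiver `Q̄`: the arrows `a` of `Q` (first summand), the arrows `ā` (second
summand) and the loops `t_i` (third summand). -/
abbrev GArrow (V E : Type*) := E ⊕ E ⊕ V

section Ginzburg

variable {k : Type*} [CommRing k] {V E : Type*}

/-- The quiver `Q̄`, with `ā : t a ⟶ s a` reversing `a`, and a loop `t_i` at every vertex `i`. -/
def Quiv.bar (Q : Quiv V E) : Quiv V (GArrow V E) where
  s := Sum.elim Q.s (Sum.elim Q.t id)
  t := Sum.elim Q.t (Sum.elim Q.s id)

/-- The grading of `Q̄`: `a` has degree `0`, `ā` has degree `-1` and `t_i` has degree `-2`. -/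
def gdeg : GArrow V E → ℤ := Sum.elim (fun _ => 0) (Sum.elim (fun _ => -1) (fun _ => -2))

/-- A series in the arrows of `Q`, viewed as a series in the arrows of `Q̄`. -/
def gEmb (f : Series k E) : Series k (GArrow V E) := ⟨Function.extend (List.map Sum.inl) f 0⟩

theorem map_inl_injective :
    Function.Injective (List.map (Sum.inl : E → GArrow V E)) :=
  List.map_injective_iff.2 Sum.inl_injective

theorem gEmb_map (f : Series k E) (w : List E) :
    (gEmb f : Series k (GArrow V E)) (w.map Sum.inl) = f w :=
  map_inl_injective.extend_apply _ _ _

theorem exists_of_gEmb_ne {f : Series k E} {w : List (GArrow V E)} (h : gEmb f w ≠ 0) :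
    ∃ u, w = u.map Sum.inl ∧ f u ≠ 0 := by
  by_cases hw : ∃ u : List E, u.map Sum.inl = w
  · obtain ⟨u, rfl⟩ := hw
    exact ⟨u, rfl, by rwa [gEmb_map] at h⟩
  · exact absurd (Function.extend_apply' (f := List.map Sum.inl) (f : List E → k) 0 w hw) h

theorem gEmb_mul (f g : Series k E) :
    (gEmb (f * g) : Series k (GArrow V E)) = gEmb f * gEmb g := by
  ext w
  by_cases hw : ∃ u : List E, u.map Sum.inl = w
  · obtain ⟨u, rfl⟩ := hw
    rw [gEmb_map, Series.mul_apply, Series.mul_apply, List.length_map]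
    refine Finset.sum_congr rfl fun n _ => ?_
    rw [← List.map_take, ← List.map_drop, gEmb_map, gEmb_map]
  · have h1 : (gEmb (f * g) : Series k (GArrow V E)) w = 0 := by
      by_contra h
      obtain ⟨u, rfl, -⟩ := exists_of_gEmb_ne h
      exact hw ⟨u, rfl⟩
    rw [h1]
    by_contra h
    obtain ⟨u, v, rfl, hu, hv⟩ := exists_of_mul_ne (Ne.symm h)
    obtain ⟨u, rfl, -⟩ := exists_of_gEmb_ne hu
    obtain ⟨v, rfl, -⟩ := exists_of_gEmb_ne hv
    exact hw ⟨u ++ v, List.map_append⟩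

theorem gEmb_word (u : List E) :
    (gEmb (word u : Series k E) : Series k (GArrow V E)) = word (u.map Sum.inl) := by
  classical
  ext w
  by_cases hw : ∃ v : List E, v.map Sum.inl = w
  · obtain ⟨v, rfl⟩ := hw
    rw [gEmb_map, word_apply, word_apply]
    simp only [map_inl_injective.eq_iff]
  · rw [word_apply, if_neg (fun h => hw ⟨u, h.symm⟩)]
    by_contra h
    obtain ⟨u, rfl, -⟩ := exists_of_gEmb_ne h
    exact hw ⟨u, rfl⟩

/-- `gEmb` as a linear map. -/
def gEmbₗ : Series k E →ₗ[k] Series k (GArrow V E) where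
  toFun := gEmb
  map_add' f g := by
    ext w
    by_cases hw : ∃ v : List E, v.map Sum.inl = w
    · obtain ⟨v, rfl⟩ := hw; simp [gEmb_map]
    · have h0 : ∀ f : Series k E, (gEmb f : Series k (GArrow V E)) w = 0 := fun f => by
        by_contra h
        obtain ⟨u, rfl, -⟩ := exists_of_gEmb_ne h
        exact hw ⟨u, rfl⟩
      simp [h0]
  map_smul' c f := by
    ext w
    by_cases hw : ∃ v : List E, v.map Sum.inl = w
    · obtain ⟨v, rfl⟩ := hw; simp [gEmb_map]
    · have h0 : ∀ f : Series k E, (gEmb f : Series k (GArrow V E)) w = 0 := fun f => by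
        by_contra h
        obtain ⟨u, rfl, -⟩ := exists_of_gEmb_ne h
        exact hw ⟨u, rfl⟩
      simp [h0]

theorem isPath_bar_map (Q : Quiv V E) (i j : V) (w : List E) :
    Q.bar.IsPath i (w.map Sum.inl) j ↔ Q.IsPath i w j := by
  induction w generalizing i with
  | nil => simp
  | cons a w ih =>
    rw [List.map_cons, Quiv.isPath_cons, Quiv.isPath_cons]
    exact and_congr Iff.rfl (ih _)

theorem wdeg_map (w : List E) : wdeg (gdeg : GArrow V E → ℤ) (w.map Sum.inl) = 0 := by
  induction w with
  | nil => simp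
  | cons a w ih => rw [List.map_cons, wdeg_cons, ih]; rfl

variable [DecidableEq V] [Fintype E]

/-- The values of the Ginzburg differential on arrows: `d a = 0`, `d ā = ∂_a S` and
`d t_i = e_i (∑ a, (a ā - ā a)) e_i`. -/
def gDelta (Q : Quiv V E) (S : Potential k Q) : GArrow V E → Series k (GArrow V E)
  | .inl _ => 0
  | .inr (.inl a) => gEmb (S.cyclicDeriv a)
  | .inr (.inr i) => ∑ a : E, ((if Q.t a = i then word [.inl a, .inr (.inl a)] else 0) -
      (if Q.s a = i then word [.inr (.inl a), .inl a] else 0))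

variable (Q : Quiv V E) (S : Potential k Q)

theorem gDelta_loop_ne {i : V} {w : List (GArrow V E)} (h : gDelta Q S (.inr (.inr i)) w ≠ 0) :
    ∃ a, (Q.t a = i ∧ w = [.inl a, .inr (.inl a)]) ∨ (Q.s a = i ∧ w = [.inr (.inl a), .inl a]) := by
  rw [gDelta, Series.sum_apply] at h
  obtain ⟨a, -, ha⟩ := Finset.exists_ne_zero_of_sum_ne_zero h
  refine ⟨a, ?_⟩
  by_contra! hne
  refine ha ?_
  rw [Series.sub_apply]
  have h1 : (if Q.t a = i then word [.inl a, .inr (.inl a)] else 0 : Series k (GArrow V E)) w = 0 := by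
    split_ifs with hi
    · rw [word_apply, if_neg (hne.1 hi)]
    · rfl
  have h2 : (if Q.s a = i then word [.inr (.inl a), .inl a] else 0 : Series k (GArrow V E)) w = 0 := by
    split_ifs with hi
    · rw [word_apply, if_neg (hne.2 hi)]
    · rfl
  rw [h1, h2, sub_zero]

variable [Fintype V]

theorem der_gEmb (f : Series k E) : der gdeg (gDelta Q S) (gEmb f) = 0 := by
  ext w
  by_contra h
  obtain ⟨p, v, q, a, rfl, hfa, hv⟩ := exists_of_der_ne _ _ h
  obtain ⟨u, hu, -⟩ := exists_of_gEmb_ne hfa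
  have : a ∈ u.map Sum.inl := by rw [← hu]; simp
  obtain ⟨b, -, rfl⟩ := List.mem_map.1 this
  exact hv rfl

end Ginzburg

section CyclicIdentity

variable {k : Type*} [CommRing k] {V E : Type*}

theorem word_singleton_mul_cons [DecidableEq E] (a b : E) (f : Series k E) (w : List E) :
    (word [a] * f : Series k E) (b :: w) = if b = a then f w else 0 := by
  rw [mul_cons, word_apply, if_neg (by simp), zero_mul, zero_add]
  split_ifs with h
  · subst h
    have : shift b (word [b] : Series k E) = 1 := by ext w; simp [word_apply, one_def]
    rw [this, one_mul]
  · have : shift b (word [a] : Series k E) = 0 := by ext w; simp [word_apply, h]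
    rw [this, zero_mul, Series.zero_apply]

theorem mul_word_singleton_append [DecidableEq E] (a b : E) (f : Series k E) (w : List E) :
    (f * word [a] : Series k E) (w ++ [b]) = if b = a then f w else 0 := by
  induction w generalizing f with
  | nil =>
    rw [List.nil_append, mul_cons]
    simp [word_apply]
  | cons c w ih =>
    rw [List.cons_append, mul_cons, ih]
    simp [word_apply]

variable {Q : Quiv V E} (S : Potential k Q)

theorem isCycle_rotate {w : List E} (n : ℕ) (h : Q.IsCycle (w.rotate n)) : Q.IsCycle w := by
  have h1 : ∀ v : List E, Q.IsCycle v → Q.IsCycle (v.rotate 1) := by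
    rintro v ⟨hv, i, hi⟩
    cases v with
    | nil => exact absurd rfl hv
    | cons a v =>
      refine ⟨by simp, Q.s a, ?_⟩
      rw [List.rotate_cons_succ, List.rotate_zero, Quiv.isPath_append]
      exact ⟨i, hi.2, hi.1, rfl⟩
  have h2 : ∀ (m : ℕ) (v : List E), Q.IsCycle v → Q.IsCycle (v.rotate m) := by
    intro m
    induction m with
    | zero => intro v hv; rwa [List.rotate_zero]
    | succ m ih =>
      intro v hv
      rw [← List.rotate_rotate]
      exact h1 _ (ih v hv)
  obtain ⟨m, hm⟩ : ∃ m, (w.rotate n).rotate m = w := by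
    obtain ⟨m, hm⟩ := (List.IsRotated.symm ⟨n, rfl⟩ : (w.rotate n).IsRotated w)
    exact ⟨m, hm⟩
  rw [← hm]
  exact h2 m _ h

theorem cyclicDeriv_cons (a : E) (u : List E) :
    S.cyclicDeriv a u =
      ∑ n ∈ Finset.range (a :: u).length, S.series ((a :: u).rotate (n + 1)) := by
  change ∑ n ∈ Finset.range (u.length + 1), _ = _
  refine Finset.sum_congr rfl fun n hn => ?_
  have hn' : n ≤ u.length := Nat.lt_succ_iff.1 (Finset.mem_range.1 hn)
  rw [List.rotate_eq_drop_append_take (by simpa using hn')]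
  simp

theorem cyclicDeriv_append (a : E) (u : List E) :
    S.cyclicDeriv a u =
      ∑ n ∈ Finset.range (u ++ [a]).length, S.series ((u ++ [a]).rotate n) := by
  rw [List.length_append]
  change ∑ n ∈ Finset.range (u.length + 1), S.series (u.drop n ++ a :: u.take n) =
    ∑ n ∈ Finset.range (u.length + 1), _
  refine Finset.sum_congr rfl fun n hn => ?_
  have hn' : n ≤ u.length := Nat.lt_succ_iff.1 (Finset.mem_range.1 hn)
  rw [List.rotate_eq_drop_append_take (by simp; omega), List.drop_append_of_le_length hn',
    List.take_append_of_le_length hn', List.append_assoc]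
  rfl

theorem sum_rotate (w : List E) :
    ∑ n ∈ Finset.range w.length, S.series (w.rotate (n + 1)) =
      ∑ n ∈ Finset.range w.length, S.series (w.rotate n) := by
  have h1 := Finset.sum_range_succ (fun n => S.series (w.rotate n)) w.length
  have h2 := Finset.sum_range_succ' (fun n => S.series (w.rotate n)) w.length
  rw [List.rotate_length] at h1
  rw [List.rotate_zero] at h2
  exact add_right_cancel (h2.symm.trans h1)

theorem cyclic_identity [Fintype E] [DecidableEq V] (i : V) :
    ∑ a : E, ((if Q.t a = i then word [a] * S.cyclicDeriv a else 0) -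
      (if Q.s a = i then S.cyclicDeriv a * word [a] else 0) : Series k E) = 0 := by
  classical
  have hl : ∀ (c : Prop) [Decidable c] (f : Series k E) (w : List E),
      (if c then f else 0) w = if c then f w else 0 := by intros; split_ifs <;> rfl
  ext w
  rw [Series.sum_apply]
  simp only [Series.sub_apply, Finset.sum_sub_distrib, hl]
  rcases List.eq_nil_or_concat w with rfl | ⟨v, c, hv⟩
  · simp [word_apply]
  rw [List.concat_eq_append] at hv
  have h2 : ∑ a : E, (if Q.s a = i then (S.cyclicDeriv a * word [a] : Series k E) w else 0) =
      if Q.s c = i then ∑ n ∈ Finset.range w.length, S.series (w.rotate n) else 0 := by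
    subst hv
    rw [Finset.sum_eq_single c]
    · rw [mul_word_singleton_append, if_pos rfl, cyclicDeriv_append]
    · intro a _ ha
      rw [mul_word_singleton_append, if_neg (Ne.symm ha), ite_self]
    · simp
  have h1 : ∀ b u, w = b :: u →
      ∑ a : E, (if Q.t a = i then (word [a] * S.cyclicDeriv a : Series k E) w else 0) =
      if Q.t b = i then ∑ n ∈ Finset.range w.length, S.series (w.rotate n) else 0 := by
    rintro b u rfl
    rw [Finset.sum_eq_single b]
    · rw [word_singleton_mul_cons, if_pos rfl, cyclicDeriv_cons, sum_rotate]
    · intro a _ ha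
      rw [word_singleton_mul_cons, if_neg (Ne.symm ha), ite_self]
    · simp
  obtain ⟨b, u, hu⟩ : ∃ b u, w = b :: u := List.exists_cons_of_ne_nil (by simp [hv])
  rw [h2, h1 b u hu, Series.zero_apply]
  by_cases hT : ∑ n ∈ Finset.range w.length, S.series (w.rotate n) = 0
  · simp [hT]
  · obtain ⟨n, -, hn⟩ := Finset.exists_ne_zero_of_sum_ne_zero hT
    obtain ⟨-, j, hj⟩ := isCycle_rotate n (S.isCycle _ hn)
    have hb : Q.t b = j := by rw [hu] at hj; exact hj.1
    have hc : Q.s c = j := by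
      rw [hv, Quiv.isPath_append] at hj
      obtain ⟨l, -, -, h⟩ := hj
      exact h
    rw [hb, hc, sub_self]

theorem cyclicDeriv_isPath {a : E} {w : List E} (h : S.cyclicDeriv a w ≠ 0) :
    Q.IsPath (Q.s a) w (Q.t a) := by
  have h' : ∑ n ∈ Finset.range (w.length + 1), S.series (w.drop n ++ a :: w.take n) ≠ 0 := h
  obtain ⟨n, -, hn⟩ := Finset.exists_ne_zero_of_sum_ne_zero h'
  obtain ⟨-, i, hi⟩ := S.isCycle _ hn
  rw [Quiv.isPath_append] at hi
  obtain ⟨l, h1, rfl, h2⟩ := hi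
  rw [← List.take_append_drop n w, Quiv.isPath_append]
  exact ⟨i, h2, h1⟩

end CyclicIdentity

section Ginzburg

variable {k : Type*} [CommRing k] {V E : Type*} [Fintype V] [DecidableEq V] [Fintype E]
  (Q : Quiv V E) (S : Potential k Q)

theorem der_gDelta_loop (i : V) :
    der gdeg (gDelta Q S) (gDelta Q S (.inr (.inr i))) = 0 := by
  classical
  have hs : ∀ x : GArrow V E,
      signTwist gdeg (word [x] : Series k (GArrow V E)) = sgn k (gdeg x) • word [x] := fun x =>
    signTwist_of_homogeneous fun w hw => by
      have : w = [x] := by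
        by_contra hne
        exact hw (by rw [word_apply, if_neg hne])
      rw [this]; simp
  have h1 : ∀ a : E, der gdeg (gDelta Q S) (word [.inl a, .inr (.inl a)]) =
      gEmb (word [a] * S.cyclicDeriv a) := by
    intro a
    rw [show (word [.inl a, .inr (.inl a)] : Series k (GArrow V E)) =
      word [.inl a] * word [.inr (.inl a)] from (word_mul_word [Sum.inl a] [Sum.inr (Sum.inl a)]).symm,
      der_mul, der_word_singleton, der_word_singleton, hs, gEmb_mul, gEmb_word]
    simp [gDelta, gdeg]
  have h2 : ∀ a : E, der gdeg (gDelta Q S) (word [.inr (.inl a), .inl a]) =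
      gEmb (S.cyclicDeriv a * word [a]) := by
    intro a
    rw [show (word [.inr (.inl a), .inl a] : Series k (GArrow V E)) =
      word [.inr (.inl a)] * word [.inl a] from (word_mul_word [Sum.inr (Sum.inl a)] [Sum.inl a]).symm,
      der_mul, der_word_singleton, der_word_singleton, hs, gEmb_mul, gEmb_word]
    simp [gDelta]
  have h3 := congrArg (gEmbₗ (V := V)) (cyclic_identity S i)
  rw [map_zero, map_sum] at h3
  rw [gDelta, map_sum]
  refine Eq.trans ?_ h3
  refine Finset.sum_congr rfl fun a _ => ?_
  rw [map_sub, map_sub, apply_ite (der gdeg (gDelta Q S)), apply_ite (der gdeg (gDelta Q S)), h1,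
    h2, apply_ite (gEmbₗ (V := V)), apply_ite (gEmbₗ (V := V)), map_zero, map_zero]
  rfl

theorem isPathDifferential_gDelta : IsPathDifferential Q.bar gdeg (gDelta Q S) where
  path := by
    rintro (a | a | i) w hw
    · exact absurd rfl hw
    · obtain ⟨u, rfl, hu⟩ := exists_of_gEmb_ne hw
      exact (isPath_bar_map Q _ _ _).2 (cyclicDeriv_isPath S hu)
    · obtain ⟨a, ⟨rfl, rfl⟩ | ⟨rfl, rfl⟩⟩ := gDelta_loop_ne Q S hw <;>
      exact ⟨rfl, rfl, rfl⟩
  deg_eq := by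
    rintro (a | a | i) w hw
    · exact absurd rfl hw
    · obtain ⟨u, rfl, hu⟩ := exists_of_gEmb_ne hw
      rw [wdeg_map]; rfl
    · obtain ⟨a, ⟨rfl, rfl⟩ | ⟨rfl, rfl⟩⟩ := gDelta_loop_ne Q S hw <;>
      simp [gdeg]
  der_eq_zero := by
    rintro (a | a | i)
    · exact map_zero _
    · exact der_gEmb Q S _
    · exact der_gDelta_loop Q S i

/-- The complete Ginzburg dg algebra of the quiver with potential `(Q, S)`. -/
def ginzburg : DGAlgebra k := pathDG (isPathDifferential_gDelta Q S)

end Ginzburg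

/-! ### Elements of the Ginzburg dg algebra -/

section GinzburgElements

variable {k : Type*} [CommRing k] {V E : Type*} [Fintype V] [DecidableEq V] [Fintype E]
  {Q : Quiv V E} (S : Potential k Q)

/-- The coefficient of the path `w` from `j` to `i` in an element of the Ginzburg dg algebra. -/
def gCoeff (x : ginzburg Q S) (i j : V) (w : List (GArrow V E)) : k :=
  (show completePath k Q.bar gdeg from x).1 i j w

/-- The vertex idempotent `e_i` of the Ginzburg dg algebra. -/
def gVertex (i : V) : ginzburg Q S := (vertexElt Q.bar i : completePath k Q.bar gdeg)

/-- The arrow `a` of `Q`, as an element of the Ginzburg dg algebra. -/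
def gArrow (a : E) : ginzburg Q S := (arrowElt Q.bar (.inl a) : completePath k Q.bar gdeg)

/-- The potential `S`, as an element of the Ginzburg dg algebra. -/
def gPotential : ginzburg Q S :=
  show completePath k Q.bar gdeg from
  ⟨fun i j => ⟨fun w => open Classical in
      if i = j ∧ Q.bar.IsPath i w j then gEmb S.series w else 0⟩, by
    have key : ∀ (i j : V) (w : List (GArrow V E)), (open Classical in
        if i = j ∧ Q.bar.IsPath i w j then gEmb S.series w else 0) ≠ 0 →
        Q.bar.IsPath i w j ∧ gEmb S.series w ≠ 0 := by
      intro i j w h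
      split_ifs at h with h'
      · exact ⟨h'.2, h⟩
      · exact absurd rfl h
    refine ⟨fun i j w h => (key i j w h).1, {0}, fun i j w h => ?_⟩
    obtain ⟨u, rfl, -⟩ := exists_of_gEmb_ne (key i j w h).2
    rw [wdeg_map]
    exact Finset.mem_singleton_self 0⟩

end GinzburgElements

/-! ### Actions of the group with two elements on a quiver -/

/-- An action of the group `G` on the quiver `Q`. -/
structure Quiv.Action (G : Type*) [Group G] {V E : Type*} (Q : Quiv V E) where
  /-- The action on vertices. -/
  onV : G →* Equiv.Perm V
  /-- The action on arrows. -/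
  onE : G →* Equiv.Perm E
  s_map : ∀ g a, Q.s (onE g a) = onV g (Q.s a)
  t_map : ∀ g a, Q.t (onE g a) = onV g (Q.t a)

namespace Quiv.Action

variable {G : Type*} [Group G] {V E : Type*} {Q : Quiv V E} (σ : Q.Action G)

theorem isPath_map (g : G) {i j : V} {w : List E} (h : Q.IsPath i w j) :
    Q.IsPath (σ.onV g i) (w.map (σ.onE g)) (σ.onV g j) := by
  induction w generalizing i with
  | nil => exact congrArg (σ.onV g) h
  | cons a w ih =>
    refine ⟨(σ.t_map g a).trans (congrArg _ h.1), ?_⟩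
    have := ih h.2
    rwa [← σ.s_map] at this

/-- The image `g(S)` of a potential: the coefficient of `g(w)` in `g(S)` is the coefficient of `w`
in `S`. -/
def mapPotential {k : Type*} [CommRing k] (g : G) (S : Potential k Q) : Potential k Q where
  series := ⟨fun w => S.series (w.map (σ.onE g⁻¹))⟩
  isCycle w hw := by
    obtain ⟨h, i, hi⟩ := S.isCycle _ hw
    refine ⟨fun h0 => h (by rw [h0]; rfl), σ.onV g i, ?_⟩
    have := σ.isPath_map g hi
    rwa [List.map_map, ← Equiv.Perm.coe_mul, ← map_mul, mul_inv_cancel, map_one,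
      Equiv.Perm.coe_one, List.map_id] at this

/-- The action of `g` on the arrows of `Q̄`. -/
def onBar (g : G) : GArrow V E → GArrow V E :=
  Sum.map (σ.onE g) (Sum.map (σ.onE g) (σ.onV g))

/-- The action `ρ` on the Ginzburg dg algebra is the one induced by the action `σ` on the quiver:
`ρ g` is the continuous linear map sending every path of `Q̄` to its image under `g`. -/
def Induces {k : Type*} [CommRing k] [Fintype V] [DecidableEq V] [Fintype E] {S : Potential k Q}
    (ρ : DGAction G (ginzburg Q S)) : Prop :=
  ∀ (g : G) (x : ginzburg Q S) (i j : V) (w : List (GArrow V E)),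
    gCoeff S (ρ.hom g x) (σ.onV g i) (σ.onV g j) (w.map (σ.onBar g)) = gCoeff S x i j w

end Quiv.Action

/-- The group `ℤ/2`, written multiplicatively. -/
abbrev C2 : Type := Multiplicative (ZMod 2)

/-- The generator of `ℤ/2`. -/
abbrev gen : C2 := Multiplicative.ofAdd 1

namespace Quiv.Action

variable {V E : Type*} {Q : Quiv V E} (σ : Q.Action C2)

/-- The vertex `i` is fixed by the action. -/
def IsFixed (i : V) : Prop := σ.onV gen i = i

/-- Every arrow between two fixed vertices is fixed. -/
def FixesArrows : Prop := ∀ a, σ.IsFixed (Q.s a) → σ.IsFixed (Q.t a) → σ.onE gen a = a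

/-- A choice of representatives of the orbits of non-fixed vertices and of the orbits of arrows. -/
structure Choice where
  /-- The representatives of the orbits of non-fixed vertices. -/
  oW : Set V
  /-- The representatives of the orbits of arrows. -/
  oE : Set E
  not_isFixed : ∀ i ∈ oW, ¬ σ.IsFixed i
  existsUnique_oW : ∀ i, ¬ σ.IsFixed i → ∃! j, j ∈ oW ∧ (j = i ∨ j = σ.onV gen i)
  existsUnique_oE : ∀ a, ∃! b, b ∈ oE ∧ (b = a ∨ b = σ.onE gen a)

namespace Choice

variable {σ} (c : σ.Choice)

/-- The vertices of `Q_G`: `i⁺` and `i⁻` for every fixed vertex `i`, and `j⁺` for every chosen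
representative `j` of an orbit of non-fixed vertices. -/
def Vertex : Type _ := {p : V × ℤˣ // σ.IsFixed p.1 ∨ (p.1 ∈ c.oW ∧ p.2 = 1)}

/-- The arrows of `Q_G`: for every chosen representative `a` of an orbit of arrows, `a⁺` and `a⁻`
if one of the endpoints of `a` is fixed, and `a⁺` otherwise. -/
def Arrow : Type _ :=
  {p : E × ℤˣ // p.1 ∈ c.oE ∧ (¬ σ.IsFixed (Q.s p.1) → ¬ σ.IsFixed (Q.t p.1) → p.2 = 1)}

instance : DecidableEq c.Vertex := Classical.decEq _

instance [Fintype V] : Fintype c.Vertex := by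
  classical exact Subtype.fintype _

instance [Fintype E] : Fintype c.Arrow := by
  classical exact Subtype.fintype _

open Classical in
/-- The vertex `i^ε` if `i` is fixed, and the vertex `j⁺` for the representative `j` of the orbit
of `i` otherwise. -/
def vertex (i : V) (ε : ℤˣ) : c.Vertex :=
  if h : σ.IsFixed i then ⟨(i, ε), Or.inl h⟩
  else ⟨((c.existsUnique_oW i h).choose, 1), Or.inr ⟨(c.existsUnique_oW i h).choose_spec.1.1, rfl⟩⟩

/-- The quiver `Q_G`. -/
def quiv : Quiv c.Vertex c.Arrow where
  s a := c.vertex (Q.s a.1.1) a.1.2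
  t a := c.vertex (Q.t a.1.1) a.1.2

end Choice

end Quiv.Action

/-! ### The algebra `ē Γ̂G ē` and the potential `S_G` -/

section SkewElements

variable {k : Type*} [Field k] {V E : Type*} [Fintype V] [DecidableEq V] [Fintype E]
  {Q : Quiv V E} {S : Potential k Q} {σ : Q.Action C2} (c : σ.Choice)
  (ρ : DGAction C2 (ginzburg Q S))

/-- The element `x ⊗ g` of the skew group algebra. -/
def tens (x : ginzburg Q S) (g : C2) : DGAlgebra.skew ρ :=
  (SkewMonoidAlgebra.single g x : SkewMonoidAlgebra (ginzburg Q S) C2)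

/-- The coefficient of `w ⊗ g`, where `w` is a path of `Q̄` from `j` to `i`. -/
def skewCoeff (x : DGAlgebra.skew ρ) (g : C2) (i j : V) (w : List (GArrow V E)) : k :=
  gCoeff S ((show SkewMonoidAlgebra (ginzburg Q S) C2 from x).coeff g) i j w

open Classical in
/-- The idempotents `e_i^± = ½ e_i ⊗ (1 ± σ)` for `i` fixed and `e_j⁺ = ½ (e_j + e_{σ j}) ⊗ (1 + σ)`
for `j` not fixed. -/
def idem (v : c.Vertex) : DGAlgebra.skew ρ :=
  let u : ginzburg Q S := if σ.IsFixed v.1.1 then gVertex S v.1.1 else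
    gVertex S v.1.1 + gVertex S (σ.onV gen v.1.1)
  (2⁻¹ : k) • (tens ρ u 1 + ((v.1.2 : ℤ) : k) • tens ρ u gen)

/-- The idempotent `ē`, the sum of all `e_i^±` and `e_j⁺`. -/
def eBar : DGAlgebra.skew ρ := ∑ v : c.Vertex, idem c ρ v

/-- The element `a^± = e_{t a}^± (a ⊗ 1) e_{s a}^±` corresponding to an arrow of `Q_G`. -/
def arrowPM (a : c.Arrow) : DGAlgebra.skew ρ :=
  idem c ρ (c.quiv.t a) * tens ρ (gArrow S a.1.1) 1 * idem c ρ (c.quiv.s a)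

/-- The map `ι : x ↦ ē (x ⊗ 1) ē`. -/
def iota (x : ginzburg Q S) : DGAlgebra.skew ρ := eBar c ρ * tens ρ x 1 * eBar c ρ

open Classical in
/-- The element `ι'(S)`: the part of `S` consisting of the cyclic paths at fixed vertices is mapped
by `ι`, and the part consisting of the cyclic paths at non-fixed vertices is mapped by `2 ι`. -/
def iotaPrime : DGAlgebra.skew ρ :=
  ∑ i : V, (if σ.IsFixed i then (1 : k) else 2) •
    iota c ρ (gVertex S i * gPotential S * gVertex S i)

/-- The cyclic part of `ι'(S)`: the non-cyclic paths of `Q_G`, which are cyclically equivalent to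
`0`, are discarded. -/
def cyclicIotaPrime : DGAlgebra.skew ρ :=
  ∑ v : c.Vertex, idem c ρ v * iotaPrime c ρ * idem c ρ v

/-- The element `x` is the value of the potential `T` on `Q_G`, that is, the sum of the series
obtained from `T` by replacing every path `a₁ ⋯ aₘ` of `Q_G` by the product of the elements
corresponding to its arrows; convergence is for the topology defined by the length of paths. -/
def IsValue (T : Potential k c.quiv) (x : DGAlgebra.skew ρ) : Prop :=
  ∀ (N : ℕ) (g : C2) (i j : V) (w : List (GArrow V E)), w.length < N →
    skewCoeff ρ x g i j w =
      skewCoeff ρ (∑ n ∈ Finset.range N, ∑ u : Fin n → c.Arrow,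
        T.series (List.ofFn u) • (List.ofFn fun l => arrowPM c ρ (u l)).prod) g i j w

end SkewElements

end QP

/-! Write Γ for the Ginzburg algebra of (Q, S), s_p = ±1 for the sign of a vertex p of Q_G, |p| for
the length of the orbit under p, and ε_p ∈ Γ for the sum of the vertex idempotents over that orbit
(`orbitElt`).

Removal of the group. Since (1 ⊗ σ) e_q = s_q e_q, every element of ΓG e_q is (x ⊗ 1) e_q for some x
in Γ. Averaging over G shows that e_p ΓG e_q consists of the (x ⊗ 1) e_q with x ∈ ε_p Γ ε_q and σ(x)
= s_p s_q x, and such an x is unique (`idem_mul_mul_idem`, `IsFoldedElt.eq_zero`). For such x one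
has e_p (x ⊗ 1) = (x ⊗ 1) e_q, hence (x ⊗ 1) e_q · (y ⊗ 1) e_r = (xy ⊗ 1) e_r. So the corner is an
algebra of matrices whose (p, q) entries are the s_p s_q-isotypic elements of ε_p Γ ε_q.

Paths. These isotypic pieces are identified with series of paths of the bar quiver of Q_G by a
substitution of letters: an arrow β goes to a combination ∑ M(β, b) b over an orbit of arrows of the
bar quiver of Q. Two orthogonality relations between M and a second matrix N
(`IsEnds.sum_coef_mul_coef`, `IsEnds.sum_coef_mul_coef'`) say that words can be translated in both
directions letter by letter. They make the substitution injective (`Folding.eq_zero_of_fold`) and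
onto the isotypic pieces (`Folding.fold_unfold`). It is multiplicative (`Folding.fold_mul`), and it
commutes with the differentials as soon as it does so on arrows (`Folding.der_fold`).

Normalisation. The image of α^± is forced: it is the average of α twisted by signs
(`coef_div_weight`). The scalars of the reversed arrows and of the loops are free, and are chosen so
that the differentials match. For the loops this is `fold_gDelta_loop`. For reversed arrows, ∂_a S
is obtained by stripping a first letter a from the sum cyc S of all rotations of S
(`Potential.cyclicDeriv_eq`). The potential S_G is the image under N of the average of S, restricted
to cycles. Substitution of letters commutes with rotation, so cyc S_G is the image of cyc S, and ∂_β
S_G can be computed (`fold_gDelta_bar`). The weights 1 and 2 in ι' are the orbit lengths |p|; with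
them the coefficients of S_G are given by one and the same substitution at every base vertex, which
is what makes rotation available.

Since the differential sees S only through cyc S, which is strictly invariant when S is invariant up
to cyclic equivalence, that weaker invariance suffices, both here and for the action of G on Γ
(`comap_gDelta`).

Value of S_G. The substitution preserves the length of words, so infinite sums may be evaluated
length by length, and the value of a potential T is the image of T under the isomorphism
(`isValue_iff`). The diagonal components of ι'(S) are the images of those of S_G
(`foldPart_weighted_self`), the off-diagonal ones vanish if σ(S) = S (`foldPart_weighted_of_ne`),
and injectivity gives uniqueness. -/

namespace QP
open Series

/-! ### Foldings of a quiver with involution, and the induced correspondence of path series -/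

section Folding

open scoped Classical

/-- The linear substitution of letters `b ↦ ∑ β, N β b • β`, as a family of coefficients. -/
def substCoeff {k X Y : Type*} [CommRing k] [Fintype Y] (N : X → Y → k) :
    List X → (Series k Y →ₗ[k] k)
  | [] => coeffₗ []
  | β :: u => ∑ b, N β b • (substCoeff N u ∘ₗ shift b)

/-- The linear substitution of letters `b ↦ ∑ β, N β b • β`, extended multiplicatively and
continuously to series. -/
def subst {k X Y : Type*} [CommRing k] [Fintype Y] (N : X → Y → k) :
    Series k Y →ₗ[k] Series k X where
  toFun f := ⟨fun u => substCoeff N u f⟩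
  map_add' f g := by ext u; exact map_add (substCoeff N u) f g
  map_smul' c f := by ext u; exact map_smul (substCoeff N u) c f

section subst

variable {k X Y : Type*} [CommRing k] [Fintype Y] (N : X → Y → k)

@[simp] theorem subst_nil (f : Series k Y) : subst N f [] = f [] := rfl

theorem subst_cons (f : Series k Y) (β : X) (u : List X) :
    subst N f (β :: u) = ∑ b, N β b * subst N (shift b f) u := by
  change substCoeff N (β :: u) f = _
  simp only [substCoeff, LinearMap.sum_apply, LinearMap.smul_apply, smul_eq_mul]
  rfl

end subst

/-- The series supported on paths from `q` to `p`. -/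
def Supported {k P X : Type*} (Q : Quiv P X) [CommRing k] (p q : P) (f : Series k X) : Prop :=
  ∀ w, f w ≠ 0 → Q.IsPath p w q

theorem Supported.shift {k P X : Type*} {Q : Quiv P X} [CommRing k] {p q : P} {f : Series k X}
    (h : Supported Q p q f) (β : X) : Supported Q (Q.s β) q (Series.shift β f) :=
  fun w hw => (h (β :: w) hw).2

theorem Supported.shift_eq_zero {k P X : Type*} {Q : Quiv P X} [CommRing k] {p q : P}
    {f : Series k X} (h : Supported Q p q f) {β : X} (hβ : Q.t β ≠ p) : Series.shift β f = 0 := by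
  ext w
  by_contra hw
  exact hβ (h (β :: w) hw).1

/-- The combinatorial data of a folding of the quiver `QY` with involution: the vertices `p` of `QX`
are signed orbits of vertices of `QY`, and the arrows of `QX` correspond to linear combinations,
with coefficients `M`, of the arrows of `QY`; the coefficients `N` describe the inverse
correspondence. -/
structure Folding (k : Type*) [Field k] {P V X Y : Type*} [Fintype V] [Fintype X] [Fintype Y]
    (QX : Quiv P X) (QY : Quiv V Y) where
  /-- The involution on vertices. -/
  onV : V → V
  /-- The involution on arrows. -/
  onE : Y → Y
  onV_onV : ∀ i, onV (onV i) = i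
  onE_onE : ∀ b, onE (onE b) = b
  s_onE : ∀ b, QY.s (onE b) = onV (QY.s b)
  t_onE : ∀ b, QY.t (onE b) = onV (QY.t b)
  /-- A representative of the orbit. -/
  rep : P → V
  /-- The vertex `i` belongs to the orbit `p`. -/
  mem : P → V → Prop
  mem_iff : ∀ p i, mem p i ↔ i = rep p ∨ i = onV (rep p)
  /-- The sign of a vertex. -/
  sg : P → k
  sg_mul_self : ∀ p, sg p * sg p = 1
  two_ne_zero : (2 : k) ≠ 0
  -- Two vertices of `QX` can only overlap as i^+ and i^- over a fixed vertex i.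
  of_ne : ∀ p q i, p ≠ q → mem p i → mem q i → onV i = i ∧ sg p * sg q = -1
  /-- The length of an orbit. -/
  size : P → k
  size_ne_zero : ∀ p, size p ≠ 0
  size_eq : ∀ p, size p = ∑ i, if mem p i then 1 else 0
  /-- The coefficients of the arrows of `QX` as combinations of the arrows of `QY`. -/
  M : X → Y → k
  /-- The coefficients of the inverse correspondence. -/
  N : X → Y → k
  M_ne : ∀ β b, M β b ≠ 0 → mem (QX.t β) (QY.t b) ∧ mem (QX.s β) (QY.s b)
  N_ne : ∀ β b, N β b ≠ 0 → mem (QX.t β) (QY.t b) ∧ mem (QX.s β) (QY.s b)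
  M_onE : ∀ β b, M β (onE b) = sg (QX.t β) * sg (QX.s β) * M β b
  N_onE : ∀ β b, N β (onE b) = sg (QX.t β) * sg (QX.s β) * N β b
  -- The two orthogonality relations: M and N are mutually inverse once the target, and a vertex at
  -- the source, are prescribed. The first yields surjectivity of `fold`, the second injectivity.
  sum_M_N : ∀ p b b', mem p (QY.t b) → mem p (QY.t b') → QY.s b = QY.s b' →
    (∑ β, if QX.t β = p then M β b * N β b' else 0) = if b = b' then 1 else 0
  sum_N_M : ∀ β β' l, QX.t β = QX.t β' → mem (QX.s β) l →
    (∑ b, if QY.s b = l then N β b * M β' b else 0) = if β = β' then 1 else 0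

namespace Folding

variable {k : Type*} [Field k] {P V X Y : Type*} [Fintype V] [Fintype X] [Fintype Y]
    {QX : Quiv P X} {QY : Quiv V Y} (D : Folding k QX QY)

/-- The coefficients of `Folding.fold`. -/
def foldCoeff : P → V → V → List Y → (Series k X →ₗ[k] k)
  -- The trivial path at p becomes the sum of the vertex idempotents over the orbit of p.
  | p, i, j, [] => if i = j ∧ D.mem p i then coeffₗ [] else 0
  | _, i, j, b :: w => if QY.t b = i then
      ∑ β, D.M β b • (foldCoeff (QX.s β) (QY.s b) j w ∘ₗ shift β) else 0

/-- The entry at `(i, j)` of the image of a series supported on paths ending at `p` under the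
substitution `β ↦ ∑ b, M β b • b`. -/
def fold (p : P) (i j : V) : Series k X →ₗ[k] Series k Y where
  toFun f := ⟨fun w => D.foldCoeff p i j w f⟩
  map_add' f g := by ext u; exact map_add (D.foldCoeff p i j u) f g
  map_smul' c f := by ext u; exact map_smul (D.foldCoeff p i j u) c f

variable {D}

theorem fold_nil (p : P) (i j : V) (f : Series k X) :
    D.fold p i j f [] = if i = j ∧ D.mem p i then f [] else 0 := by
  change D.foldCoeff p i j [] f = _
  rw [foldCoeff]
  split_ifs <;> rfl

theorem fold_cons (p : P) (i j : V) (f : Series k X) (b : Y) (w : List Y) :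
    D.fold p i j f (b :: w) = if QY.t b = i then
      ∑ β, D.M β b * D.fold (QX.s β) (QY.s b) j (shift β f) w else 0 := by
  change D.foldCoeff p i j (b :: w) f = _
  rw [foldCoeff]
  split_ifs
  · simp only [LinearMap.sum_apply, LinearMap.smul_apply, smul_eq_mul]
    rfl
  · rfl

theorem shift_fold (p : P) (i j : V) (f : Series k X) (b : Y) :
    shift b (D.fold p i j f) = if QY.t b = i then
      ∑ β, D.M β b • D.fold (QX.s β) (QY.s b) j (shift β f) else 0 := by
  ext w
  rw [shift_apply, fold_cons]
  split_ifs
  · rw [Series.sum_apply]; rfl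
  · rfl

/-- Words letterwise related by nonzero coefficients. -/
theorem exists_of_fold_ne {p : P} {i j : V} {f : Series k X} {w : List Y}
    (h : D.fold p i j f w ≠ 0) :
    ∃ u, f u ≠ 0 ∧ List.Forall₂ (fun β b => D.M β b ≠ 0) u w := by
  induction w generalizing p i f with
  | nil =>
    rw [fold_nil] at h
    exact ⟨[], fun h0 => h (by simp [h0]), List.Forall₂.nil⟩
  | cons b w ih =>
    rw [fold_cons] at h
    split_ifs at h
    · obtain ⟨β, -, hβ⟩ := Finset.exists_ne_zero_of_sum_ne_zero h
      obtain ⟨u, hu, huw⟩ := ih (right_ne_zero_of_mul hβ)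
      exact ⟨β :: u, hu, List.Forall₂.cons (left_ne_zero_of_mul hβ) huw⟩
    · exact absurd rfl h

theorem fold_isPath {p : P} {i j : V} {f : Series k X} {w : List Y}
    (h : D.fold p i j f w ≠ 0) : QY.IsPath i w j := by
  induction w generalizing p i f with
  | nil =>
    rw [fold_nil] at h
    by_contra h'
    exact h (if_neg fun h0 => h' h0.1)
  | cons b w ih =>
    rw [fold_cons] at h
    split_ifs at h with hb
    · obtain ⟨β, -, hβ⟩ := Finset.exists_ne_zero_of_sum_ne_zero h
      exact ⟨hb, ih (right_ne_zero_of_mul hβ)⟩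
    · exact absurd rfl h

theorem fold_mem {p q : P} {i j : V} {f : Series k X} {w : List Y} (hf : Supported QX p q f)
    (h : D.fold p i j f w ≠ 0) : D.mem p i ∧ D.mem q j := by
  induction w generalizing p i f with
  | nil =>
    rw [fold_nil] at h
    split_ifs at h with hi
    · have : p = q := hf _ h
      subst this
      exact ⟨hi.2, hi.1 ▸ hi.2⟩
    · exact absurd rfl h
  | cons b w ih =>
    rw [fold_cons] at h
    split_ifs at h with hb
    · obtain ⟨β, -, hβ⟩ := Finset.exists_ne_zero_of_sum_ne_zero h
      refine ⟨?_, (ih (hf.shift β) (right_ne_zero_of_mul hβ)).2⟩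
      have h1 := (D.M_ne _ _ (left_ne_zero_of_mul hβ)).1
      by_cases hp : QX.t β = p
      · rwa [hp, hb] at h1
      · rw [hf.shift_eq_zero hp, map_zero] at hβ
        exact absurd (mul_zero _) hβ
    · exact absurd rfl h

theorem mem_onV {p : P} {i : V} : D.mem p (D.onV i) ↔ D.mem p i := by
  have h : ∀ i, D.mem p i → D.mem p (D.onV i) := by
    intro i hi
    rw [D.mem_iff] at hi ⊢
    rcases hi with rfl | rfl
    · exact Or.inr rfl
    · exact Or.inl (D.onV_onV _)
  exact ⟨fun hi => by simpa only [D.onV_onV] using h _ hi, h i⟩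

theorem onV_inj {i j : V} : D.onV i = D.onV j ↔ i = j :=
  ⟨fun h => by rw [← D.onV_onV i, h, D.onV_onV], congrArg _⟩

theorem isPath_onE {i j : V} {w : List Y} :
    QY.IsPath (D.onV i) (w.map D.onE) (D.onV j) ↔ QY.IsPath i w j := by
  induction w generalizing i with
  | nil => exact onV_inj
  | cons b w ih => simp only [List.map_cons, Quiv.isPath_cons, D.t_onE, D.s_onE, ih, onV_inj]

/-- Each letter contributes the product of the signs of its two ends. The sign of an intermediate
vertex occurs twice and cancels, so only the signs of p and q remain. -/
theorem fold_onE {p q : P} {f : Series k X} (hf : Supported QX p q f) (i j : V) (w : List Y) :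
    D.fold p (D.onV i) (D.onV j) f (w.map D.onE) = D.sg p * D.sg q * D.fold p i j f w := by
  induction w generalizing p i f with
  | nil =>
    rw [List.map_nil, fold_nil, fold_nil]
    simp only [onV_inj, mem_onV]
    by_cases h : f [] = 0
    · simp [h]
    · have : p = q := hf _ h
      rw [this, D.sg_mul_self, one_mul]
  | cons b w ih =>
    rw [List.map_cons, fold_cons, fold_cons]
    simp only [D.t_onE, onV_inj, D.s_onE]
    split_ifs
    · rw [Finset.mul_sum]
      refine Finset.sum_congr rfl fun β _ => ?_
      rw [ih (hf.shift β), D.M_onE]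
      by_cases hp : QX.t β = p
      · rw [hp]
        linear_combination (D.M β b * D.sg p * D.sg q *
          D.fold (QX.s β) (QY.s b) j (shift β f) w) * D.sg_mul_self (QX.s β)
      · rw [hf.shift_eq_zero hp]; simp
    · simp

/-- The supports force both factors to meet at the same signed vertex q. The sum over all l is
harmless, since entries with l outside the orbit of q vanish. The induction strips the first letter
of the word, as in `mul_cons`. -/
theorem fold_mul {p q r : P} {f g : Series k X} (hf : Supported QX p q f)
    (hg : Supported QX q r g) (i j : V) :
    D.fold p i j (f * g) = ∑ l, D.fold p i l f * D.fold q l j g := by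
  ext w
  rw [Series.sum_apply]
  -- The constant term of f is nonzero only if p = q, and then its fold acts as the identity on rows
  -- in the orbit.
  have hnil : ∀ (p : P) (f : Series k X) (i : V) (w : List Y), Supported QX p q f →
      ∑ l, D.fold p i l f [] * D.fold q l j g w = f [] * D.fold q i j g w := by
    intro p f i w hf
    by_cases h : f [] = 0
    · simp [fold_nil, h]
    · have : p = q := hf _ h
      subst this
      rw [Finset.sum_eq_single i]
      · by_cases h0 : D.fold p i j g w = 0
        · rw [h0, mul_zero, mul_zero]
        · rw [fold_nil, if_pos ⟨rfl, (fold_mem hg h0).1⟩]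
      · intro l _ hl
        rw [fold_nil, if_neg (fun h => hl h.1.symm), zero_mul]
      · simp
  induction w generalizing p i f with
  | nil =>
    simp only [mul_nil]
    rw [hnil p f i [] hf, fold_nil, fold_nil, mul_nil]
    by_cases h : f [] = 0
    · simp [h]
    · have : p = q := hf _ h
      subst this
      split_ifs <;> simp
  | cons b w ih =>
    simp only [mul_cons, Finset.sum_add_distrib, hnil p f i (b :: w) hf]
    simp only [shift_fold, fold_cons]
    split_ifs with hb
    · simp only [Finset.sum_mul, Series.sum_apply, smul_mul_assoc, Series.smul_apply]
      rw [Finset.sum_comm, Finset.mul_sum, ← Finset.sum_add_distrib]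
      refine Finset.sum_congr rfl fun β _ => ?_
      rw [shift_mul, map_add, map_smul, Series.add_apply, Series.smul_apply, ih (hf.shift β),
        ← Finset.mul_sum]
      ring
    · simp

/-- Pairing the first letter with N isolates β by `sum_N_M`: what follows β in f is thus read off
from the fold of f. Both injectivity and the computation of cyclic derivatives of S_G rest on this.
-/
theorem sum_N_mul_fold {p q : P} {f : Series k X} (hf : Supported QX p q f) {β : X}
    (hβ : QX.t β = p) {l : V} (hl : D.mem (QX.s β) l) (j : V) (w : List Y) :
    (∑ b, if QY.s b = l then D.N β b * D.fold p (QY.t b) j f (b :: w) else 0) =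
      D.fold (QX.s β) l j (shift β f) w := by
  have h1 : ∀ b, (if QY.s b = l then D.N β b * D.fold p (QY.t b) j f (b :: w) else 0) =
      ∑ β', (if QY.s b = l then D.N β b * D.M β' b else 0) *
        D.fold (QX.s β') l j (shift β' f) w := by
    intro b
    split_ifs with hb
    · rw [fold_cons, if_pos rfl, Finset.mul_sum, hb]
      exact Finset.sum_congr rfl fun _ _ => (mul_assoc _ _ _).symm
    · simp
  rw [Finset.sum_congr rfl fun b _ => h1 b, Finset.sum_comm, Finset.sum_eq_single β]
  · rw [← Finset.sum_mul, D.sum_N_M β β l rfl hl, if_pos rfl, one_mul]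
  · intro β' _ hne
    by_cases hp : QX.t β' = p
    · rw [← Finset.sum_mul, D.sum_N_M β β' l (hβ.trans hp.symm) hl, if_neg hne.symm, zero_mul]
    · rw [hf.shift_eq_zero hp, map_zero]; simp
  · simp

/-- The constant term is read at the representative of the orbit. By `sum_N_mul_fold` the fold of
every `shift β f` vanishes as well, so induction on the word applies. -/
theorem eq_zero_of_fold {p q : P} {f : Series k X} (hf : Supported QX p q f)
    (h : ∀ i j, D.fold p i j f = 0) : f = 0 := by
  ext u
  induction u generalizing p f with
  | nil =>
    by_contra h0
    have h1 := DFunLike.congr_fun (h (D.rep p) (D.rep p)) []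
    rw [fold_nil, if_pos ⟨rfl, (D.mem_iff _ _).2 (Or.inl rfl)⟩] at h1
    exact h0 h1
  | cons β u ih =>
    by_cases hp : QX.t β = p
    · refine ih (f := shift β f) (hf.shift β) fun l j => ?_
      ext w
      by_cases hl : D.mem (QX.s β) l
      · rw [← sum_N_mul_fold hf hp hl]
        simp [h]
      · by_contra h0
        exact hl (fold_mem (hf.shift β) h0).1
    · exact DFunLike.congr_fun (hf.shift_eq_zero hp) u

/-- The families of series that are the images of series supported on paths from `q` to `p`. -/
structure IsFolded (D : Folding k QX QY) (p q : P) (F : V → V → Series k Y) : Prop where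
  path : ∀ i j w, F i j w ≠ 0 → QY.IsPath i w j
  mem : ∀ i j w, F i j w ≠ 0 → D.mem p i ∧ D.mem q j
  equiv : ∀ i j w, F (D.onV i) (D.onV j) (w.map D.onE) = D.sg p * D.sg q * F i j w

theorem isFolded_fold {p q : P} {f : Series k X} (hf : Supported QX p q f) :
    D.IsFolded p q fun i j => D.fold p i j f :=
  ⟨fun _ _ _ h => fold_isPath h, fun _ _ _ h => fold_mem hf h, fold_onE hf⟩

/-- The inverse of `Folding.fold`. -/
def unfold (D : Folding k QX QY) (p q : P) (F : V → V → Series k Y) : Series k X :=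
  -- Summing over all entries counts the result once for each vertex of the orbit of q, whence the
  -- division.
  ⟨fun u => if QX.IsPath p u q then (D.size q)⁻¹ * subst D.N (∑ i, ∑ j, F i j) u else 0⟩

theorem unfold_apply (p q : P) (F : V → V → Series k Y) (u : List X) :
    D.unfold p q F u =
      if QX.IsPath p u q then (D.size q)⁻¹ * subst D.N (∑ i, ∑ j, F i j) u else 0 := rfl

theorem supported_unfold (p q : P) (F : V → V → Series k Y) :
    Supported QX p q (D.unfold p q F) := by
  intro w h
  by_contra h'
  exact h (if_neg h')

/-- The counterpart for families of removing the first letter `β`. -/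
def peel (D : Folding k QX QY) (β : X) (F : V → V → Series k Y) (l j : V) : Series k Y :=
  ∑ b, D.N β b • if QY.s b = l then shift b (F (QY.t b) j) else 0

theorem peel_apply (β : X) (F : V → V → Series k Y) (l j : V) (w : List Y) :
    D.peel β F l j w =
      ∑ b, D.N β b * if QY.s b = l then F (QY.t b) j (b :: w) else 0 := by
  rw [peel, Series.sum_apply]
  refine Finset.sum_congr rfl fun b _ => ?_
  rw [Series.smul_apply]
  split_ifs <;> rfl

/-- Equivariance comes from reindexing the sum by the involution: N contributes the signs of p and
of the source of β, F contributes those of p and q, and the sign of p squares to 1. -/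
theorem IsFolded.peel {p q : P} {F : V → V → Series k Y} (hF : D.IsFolded p q F) {β : X}
    (hβ : QX.t β = p) : D.IsFolded (QX.s β) q (D.peel β F) := by
  have key : ∀ l j w, D.peel β F l j w ≠ 0 →
      ∃ b, D.N β b ≠ 0 ∧ QY.s b = l ∧ F (QY.t b) j (b :: w) ≠ 0 := by
    intro l j w h
    rw [peel_apply] at h
    obtain ⟨b, -, hb⟩ := Finset.exists_ne_zero_of_sum_ne_zero h
    refine ⟨b, left_ne_zero_of_mul hb, ?_⟩
    have := right_ne_zero_of_mul hb
    split_ifs at this with h'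
    · exact ⟨h', this⟩
    · exact absurd rfl this
  refine ⟨fun l j w h => ?_, fun l j w h => ?_, fun l j w => ?_⟩
  · obtain ⟨b, -, rfl, hb⟩ := key l j w h
    exact (hF.path _ _ _ hb).2
  · obtain ⟨b, hN, rfl, hb⟩ := key l j w h
    exact ⟨(D.N_ne _ _ hN).2, (hF.mem _ _ _ hb).2⟩
  · rw [peel_apply, peel_apply, Finset.mul_sum]
    refine (Equiv.sum_comp (Function.Involutive.toPerm _ D.onE_onE) _).symm.trans
      (Finset.sum_congr rfl fun b _ => ?_)
    have he : Function.Involutive.toPerm _ D.onE_onE b = D.onE b := rfl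
    simp only [he, D.s_onE, onV_inj, D.t_onE, D.N_onE, hβ]
    split_ifs
    · rw [← List.map_cons, hF.equiv]
      linear_combination (D.sg (QX.s β) * D.N β b * D.sg q * F (QY.t b) j (b :: w)) *
        D.sg_mul_self p
    · simp

/-- Entries are supported on paths, so stripping a letter b leaves only the row at the target of b.
Each b is then counted for exactly one source l. -/
theorem shift_unfold {p q : P} {F : V → V → Series k Y} (hF : D.IsFolded p q F) {β : X}
    (hβ : QX.t β = p) : shift β (D.unfold p q F) = D.unfold (QX.s β) q (D.peel β F) := by
  ext u
  rw [shift_apply, unfold_apply, unfold_apply]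
  simp only [Quiv.isPath_cons, hβ, true_and]
  split_ifs
  · congr 1
    have h1 : ∀ b, shift b (∑ i, ∑ j, F i j) = ∑ j, shift b (F (QY.t b) j) := by
      intro b
      rw [map_sum, Finset.sum_eq_single (QY.t b), map_sum]
      · intro i _ hi
        ext w
        rw [map_sum, Series.sum_apply]
        refine Finset.sum_eq_zero fun j _ => ?_
        by_contra h0
        exact hi (hF.path _ _ _ h0).1.symm
      · simp
    have h2 : ∑ l, ∑ j, D.peel β F l j = ∑ b, D.N β b • ∑ j, shift b (F (QY.t b) j) := by
      simp only [Folding.peel]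
      simp only [Finset.smul_sum]
      rw [Finset.sum_comm]
      rw [Finset.sum_congr rfl fun j _ => Finset.sum_comm, Finset.sum_comm]
      refine Finset.sum_congr rfl fun b _ => Finset.sum_congr rfl fun j _ => ?_
      rw [← Finset.smul_sum]
      simp
    rw [subst_cons, h2, map_sum, Series.sum_apply]
    simp only [h1, map_smul, Series.smul_apply]
  · rfl

/-- Longer words reduce to shorter ones by `shift_unfold` and `sum_M_N`. At the empty word with p =
q, the values at the vertices of the orbit all agree by equivariance, so their average is exact. If
p ≠ q share a vertex i, equivariance reads F i i [] = -F i i [], and 2 is invertible. -/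
theorem fold_unfold {p q : P} {F : V → V → Series k Y} (hF : D.IsFolded p q F) (i j : V) :
    D.fold p i j (D.unfold p q F) = F i j := by
  ext w
  induction w generalizing p i F with
  | nil =>
    rw [fold_nil, unfold_apply]
    simp only [Quiv.isPath_nil, subst_nil]
    by_cases hij : i = j ∧ D.mem p i
    swap
    · rw [if_neg hij]
      by_contra h0
      exact hij ⟨hF.path _ _ _ (Ne.symm h0), (hF.mem _ _ _ (Ne.symm h0)).1⟩
    rw [if_pos hij]
    obtain ⟨rfl, hi⟩ := hij
    by_cases hpq : p = q
    · subst hpq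
      rw [if_pos rfl, inv_mul_eq_iff_eq_mul₀ (D.size_ne_zero p)]
      have h1 : ∀ i, D.mem p i → F i i [] = F (D.rep p) (D.rep p) [] := by
        intro i hi
        rcases (D.mem_iff _ _).1 hi with rfl | rfl
        · rfl
        · have := hF.equiv (D.rep p) (D.rep p) []
          rwa [D.sg_mul_self, one_mul] at this
      rw [D.size_eq, h1 i hi, Finset.sum_mul, Series.sum_apply]
      refine Finset.sum_congr rfl fun i' _ => ?_
      rw [Series.sum_apply, Finset.sum_eq_single i']
      · split_ifs with hi'
        · rw [one_mul, h1 i' hi']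
        · rw [zero_mul]
          by_contra h0
          exact hi' (hF.mem _ _ _ h0).1
      · intro j _ hj
        by_contra h0
        exact hj (hF.path _ _ _ h0).symm
      · simp
    · rw [if_neg hpq]
      by_contra h0
      obtain ⟨h1, h2⟩ := D.of_ne p q i hpq hi (hF.mem _ _ _ (Ne.symm h0)).2
      have h3 := hF.equiv i i []
      rw [h1, h2, List.map_nil] at h3
      have h4 : (2 : k) * F i i [] = 0 := by linear_combination h3
      exact h0 ((mul_eq_zero.1 h4).resolve_left D.two_ne_zero).symm
  | cons b w ih =>
    rw [fold_cons]
    by_cases hb : QY.t b = i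
    swap
    · rw [if_neg hb]
      by_contra h0
      exact hb (hF.path _ _ _ (Ne.symm h0)).1
    rw [if_pos hb]
    have h1 : ∀ β, D.M β b * D.fold (QX.s β) (QY.s b) j (shift β (D.unfold p q F)) w =
        ∑ b', (if QX.t β = p then D.M β b * D.N β b' else 0) *
          if QY.s b' = QY.s b then F (QY.t b') j (b' :: w) else 0 := by
      intro β
      split_ifs with hβ
      · rw [shift_unfold hF hβ, ih (hF.peel hβ), peel_apply, Finset.mul_sum]
        exact Finset.sum_congr rfl fun _ _ => (mul_assoc _ _ _).symm
      · rw [(supported_unfold p q F).shift_eq_zero hβ, map_zero]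
        simp
    rw [Finset.sum_congr rfl fun β _ => h1 β, Finset.sum_comm]
    simp only [← Finset.sum_mul]
    by_cases hi : D.mem p i
    · rw [Finset.sum_eq_single b]
      · rw [D.sum_M_N p b b (hb ▸ hi) (hb ▸ hi) rfl, if_pos rfl, if_pos rfl, one_mul, hb]
      · intro b' _ hne
        split_ifs with hs
        · by_cases hp : D.mem p (QY.t b')
          · rw [D.sum_M_N p b b' (hb ▸ hi) hp hs.symm, if_neg hne.symm, zero_mul]
          · have : F (QY.t b') j (b' :: w) = 0 := by
              by_contra h0
              exact hp (hF.mem _ _ _ h0).1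
            rw [this, mul_zero]
        · rw [mul_zero]
      · simp
    · have h2 : F i j (b :: w) = 0 := by
        by_contra h0
        exact hi (hF.mem _ _ _ h0).1
      rw [h2]
      refine Finset.sum_eq_zero fun b' _ => ?_
      rw [Finset.sum_eq_zero, zero_mul]
      intro β _
      split_ifs with hβ
      · have : D.M β b = 0 := by
          by_contra h0
          have := (D.M_ne _ _ h0).1
          rw [hβ, hb] at this
          exact hi this
        rw [this, zero_mul]
      · rfl

/-! ### Compatibility of a folding with differentials -/

section der

variable {degX : X → ℤ} {degY : Y → ℤ} {δX : X → Series k X} {δY : Y → Series k Y}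

/-- Compatibility of the prescribed values of two differentials with a folding. -/
structure IsFoldedDer (D : Folding k QX QY) (degX : X → ℤ) (degY : Y → ℤ)
    (δX : X → Series k X) (δY : Y → Series k Y) : Prop where
  deg_eq : ∀ β b, D.M β b ≠ 0 → degX β = degY b
  supported : ∀ β, Supported QX (QX.t β) (QX.s β) (δX β)
  fold_eq : ∀ β i l, D.mem (QX.t β) i → D.mem (QX.s β) l → D.fold (QX.t β) i l (δX β) =
    ∑ b, D.M β b • if QY.t b = i ∧ QY.s b = l then δY b else 0

/-- Multiplicativity of `fold` applied to the products of `δX β` and `shift β f`. For l outside the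
orbit of the source of β the second factor vanishes, which is why `fold_eq` is only demanded at
vertices of the orbits. -/
theorem headSubst_fold (h : IsFoldedDer D degX degY δX δY) {p q : P} {f : Series k X}
    (hf : Supported QX p q f) {i : V} (hi : D.mem p i) (j : V) :
    headSubst δY (D.fold p i j f) = D.fold p i j (headSubst δX f) := by
  change ∑ b, δY b * shift b (D.fold p i j f) = D.fold p i j (∑ β, δX β * shift β f)
  rw [map_sum]
  have h1 : ∀ b, δY b * shift b (D.fold p i j f) = ∑ β, if QY.t b = i then
      D.M β b • (δY b * D.fold (QX.s β) (QY.s b) j (shift β f)) else 0 := by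
    intro b
    rw [shift_fold]
    split_ifs
    · rw [Finset.mul_sum]
      exact Finset.sum_congr rfl fun β _ => mul_smul_comm _ _ _
    · simp
  rw [Finset.sum_congr rfl fun b _ => h1 b, Finset.sum_comm]
  refine Finset.sum_congr rfl fun β _ => ?_
  by_cases hβ : QX.t β = p
  swap
  · rw [hf.shift_eq_zero hβ]; simp
  have h2 : ∀ l, D.fold p i l (δX β) * D.fold (QX.s β) l j (shift β f) = ∑ b, D.M β b •
      if QY.t b = i ∧ QY.s b = l then δY b * D.fold (QX.s β) l j (shift β f) else 0 := by
    intro l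
    by_cases hl : D.mem (QX.s β) l
    · rw [← hβ, h.fold_eq β i l (hβ ▸ hi) hl, Finset.sum_mul]
      refine Finset.sum_congr rfl fun b _ => ?_
      split_ifs <;> simp
    · have : D.fold (QX.s β) l j (shift β f) = 0 := by
        ext w
        by_contra h0
        exact hl (fold_mem (hf.shift β) h0).1
      simp [this]
  rw [fold_mul (hβ ▸ h.supported β) (hf.shift β), Finset.sum_congr rfl fun l _ => h2 l,
    Finset.sum_comm]
  refine Finset.sum_congr rfl fun b _ => ?_
  rw [← Finset.smul_sum]
  split_ifs with hb
  · congr 1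
    simp [hb]
  · simp [hb]

/-- The derivation either hits the first letter, which is `headSubst_fold`, or skips it at the cost
of a sign. M relates only letters of equal degree, so the signs agree and induction handles the
rest. -/
theorem der_fold (h : IsFoldedDer D degX degY δX δY) {p q : P} {f : Series k X}
    (hf : Supported QX p q f) {i : V} (hi : D.mem p i) (j : V) :
    der degY δY (D.fold p i j f) = D.fold p i j (der degX δX f) := by
  ext w
  induction w generalizing p i f with
  | nil =>
    rw [der_nil, headSubst_fold h hf hi, fold_nil, fold_nil, der_nil]
  | cons b w ih =>
    rw [der_cons, headSubst_fold h hf hi, der_eq degX δX f, map_add, Series.add_apply,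
      fold_cons p i j (tailDer degX δX f), shift_fold]
    congr 1
    split_ifs with hb
    · rw [map_sum, Series.sum_apply, Finset.mul_sum]
      refine Finset.sum_congr rfl fun β _ => ?_
      by_cases hM : D.M β b = 0
      · simp [hM]
      · rw [map_smul, Series.smul_apply, ih (hf.shift β) (D.M_ne _ _ hM).2, shift_tailDer,
          map_smul, Series.smul_apply, h.deg_eq β b hM]
        ring
    · simp

end der

end Folding
end Folding
-- Signed orbits of vertices and arrows; the orthogonality relations
theorem gen_mul_gen : gen * gen = 1 := by decide

theorem C2.eq_one_or_gen (g : C2) : g = 1 ∨ g = gen := by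
  revert g; decide

namespace Quiv.Action

variable {V E : Type*} {Q : Quiv V E} (σ : Q.Action C2)

theorem onV_onV (i : V) : σ.onV gen (σ.onV gen i) = i := by
  rw [← Equiv.Perm.mul_apply, ← map_mul, gen_mul_gen, map_one]; rfl

theorem onE_onE (a : E) : σ.onE gen (σ.onE gen a) = a := by
  rw [← Equiv.Perm.mul_apply, ← map_mul, gen_mul_gen, map_one]; rfl

theorem isFixed_onV {i : V} : σ.IsFixed (σ.onV gen i) ↔ σ.IsFixed i :=
  (σ.onV gen).injective.eq_iff

namespace Choice

variable {σ} (c : σ.Choice) (k : Type*) [Field k]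

/-- The sign of a vertex of `Q_G`. -/
def sg (p : c.Vertex) : k := ((p.1.2 : ℤ) : k)

/-- The vertex `i` of `Q` belongs to the orbit underlying the vertex `p` of `Q_G`. -/
def mem (p : c.Vertex) (i : V) : Prop := i = p.1.1 ∨ i = σ.onV gen p.1.1

open Classical in
/-- The length of the orbit underlying a vertex of `Q_G`. -/
def size (p : c.Vertex) : k := if σ.IsFixed p.1.1 then 1 else 2

open Classical in
/-- The coefficients of the arrows of `Q_G` as combinations of arrows of `Q`, up to scalars. -/
def coef (β : c.Arrow) (b : E) : k :=
  if b = β.1.1 then 1 else if b = σ.onE gen β.1.1 then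
    c.sg k (c.quiv.t β) * c.sg k (c.quiv.s β) else 0

open Classical in
/-- This is `1` if both endpoints are fixed and `2` otherwise. -/
def weight (β : c.Arrow) : k :=
  if σ.IsFixed (Q.s β.1.1) ∧ σ.IsFixed (Q.t β.1.1) then 1 else 2

variable {c k}

theorem units_cast_mul_self (ε : ℤˣ) : ((ε : ℤ) : k) * ((ε : ℤ) : k) = 1 := by
  rw [← Int.cast_mul, ← Units.val_mul, Int.units_mul_self]; simp

theorem sg_mul_self (p : c.Vertex) : c.sg k p * c.sg k p = 1 := units_cast_mul_self _

theorem isFixed_of_mem {p : c.Vertex} {i : V} (h : c.mem p i) :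
    σ.IsFixed p.1.1 ↔ σ.IsFixed i := by
  rcases h with rfl | rfl
  · rfl
  · rw [isFixed_onV]

theorem size_ne_zero (hk : (2 : k) ≠ 0) (p : c.Vertex) : c.size k p ≠ 0 := by
  rw [size]; split_ifs
  · exact one_ne_zero
  · exact hk

theorem weight_ne_zero (hk : (2 : k) ≠ 0) (β : c.Arrow) : c.weight k β ≠ 0 := by
  rw [weight]; split_ifs
  · exact one_ne_zero
  · exact hk

theorem size_eq_one {p : c.Vertex} {i : V} (h : c.mem p i) (hi : σ.IsFixed i) :
    c.size k p = 1 := if_pos ((isFixed_of_mem h).2 hi)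

theorem size_eq_two {p : c.Vertex} {i : V} (h : c.mem p i) (hi : ¬ σ.IsFixed i) :
    c.size k p = 2 := if_neg fun h' => hi ((isFixed_of_mem h).1 h')

theorem vertex_of_isFixed {i : V} (hi : σ.IsFixed i) (ε : ℤˣ) :
    c.vertex i ε = ⟨(i, ε), Or.inl hi⟩ := dif_pos hi

theorem vertex_of_not_isFixed {i : V} (hi : ¬ σ.IsFixed i) (ε : ℤˣ) :
    c.vertex i ε = ⟨((c.existsUnique_oW i hi).choose, 1),
      Or.inr ⟨(c.existsUnique_oW i hi).choose_spec.1.1, rfl⟩⟩ := dif_neg hi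

theorem eq_vertex_of_mem {p : c.Vertex} {i : V} (h : c.mem p i) {ε : ℤˣ}
    (hε : σ.IsFixed i → ε = p.1.2) : p = c.vertex i ε := by
  by_cases hi : σ.IsFixed i
  · have : p.1.1 = i := by
      rcases h with rfl | rfl
      · rfl
      · exact ((isFixed_onV σ).1 hi).symm
    rw [vertex_of_isFixed hi, hε hi]
    exact Subtype.ext (Prod.ext this rfl)
  · have h1 := p.2.resolve_left fun h' => hi ((isFixed_of_mem h).1 h')
    rw [vertex_of_not_isFixed hi]
    refine Subtype.ext (Prod.ext ?_ h1.2)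
    refine (c.existsUnique_oW i hi).unique ⟨h1.1, ?_⟩ (c.existsUnique_oW i hi).choose_spec.1
    rcases h with rfl | rfl
    · exact Or.inl rfl
    · right; rw [onV_onV]

theorem mem_vertex (i : V) (ε : ℤˣ) : c.mem (c.vertex i ε) i := by
  by_cases hi : σ.IsFixed i
  · rw [vertex_of_isFixed hi]; exact Or.inl rfl
  · rw [vertex_of_not_isFixed hi]
    rcases (c.existsUnique_oW i hi).choose_spec.1.2 with h | h
    · exact Or.inl h.symm
    · right
      change i = σ.onV gen (c.existsUnique_oW i hi).choose
      rw [h, onV_onV]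

theorem mem_onV {p : c.Vertex} {i : V} : c.mem p (σ.onV gen i) ↔ c.mem p i := by
  have h : ∀ i, c.mem p i → c.mem p (σ.onV gen i) := by
    rintro i (rfl | rfl)
    · exact Or.inr rfl
    · exact Or.inl (onV_onV σ _)
  exact ⟨fun hi => by simpa only [onV_onV] using h _ hi, h i⟩

theorem eq_or_of_mem {p : c.Vertex} {i j : V} (hi : c.mem p i) (hj : c.mem p j) :
    j = i ∨ j = σ.onV gen i := by
  rcases hi with rfl | rfl <;> rcases hj with rfl | rfl
  · exact Or.inl rfl
  · exact Or.inr rfl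
  · right; rw [onV_onV]
  · exact Or.inl rfl

theorem sg_vertex_of_isFixed {i : V} (hi : σ.IsFixed i) (ε : ℤˣ) :
    c.sg k (c.vertex i ε) = ((ε : ℤ) : k) := by
  rw [vertex_of_isFixed hi]; rfl

theorem sg_of_not_isFixed {p : c.Vertex} {i : V} (h : c.mem p i) (hi : ¬ σ.IsFixed i) :
    c.sg k p = 1 := by
  rw [sg, (p.2.resolve_left fun h' => hi ((isFixed_of_mem h).1 h')).2]; simp

theorem vertex_eq_iff_of_isFixed {p : c.Vertex} {i : V} (h : c.mem p i) (hi : σ.IsFixed i)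
    (ε : ℤˣ) : c.vertex i ε = p ↔ ε = p.1.2 := by
  constructor
  · rintro rfl
    rw [vertex_of_isFixed hi]
  · intro hε
    exact (eq_vertex_of_mem h fun _ => hε).symm

theorem vertex_eq_of_not_isFixed {p : c.Vertex} {i : V} (h : c.mem p i) (hi : ¬ σ.IsFixed i)
    (ε : ℤˣ) : c.vertex i ε = p := (eq_vertex_of_mem h fun h' => absurd h' hi).symm

/-- A non-fixed orbit carries a single vertex of Q_G, a fixed vertex carries two, of opposite signs.
-/
theorem eq_of_mem_of_ne {p q : c.Vertex} {i : V} (hpq : p ≠ q) (hp : c.mem p i) (hq : c.mem q i) :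
    σ.IsFixed i ∧ c.sg k p * c.sg k q = -1 := by
  have hi : σ.IsFixed i := by
    by_contra hi
    exact hpq ((vertex_eq_of_not_isFixed hp hi 1).symm.trans (vertex_eq_of_not_isFixed hq hi 1))
  refine ⟨hi, ?_⟩
  have h1 : p.1.2 ≠ q.1.2 := fun h =>
    hpq (((vertex_eq_iff_of_isFixed hp hi _).2 rfl).symm.trans
      ((vertex_eq_iff_of_isFixed hq hi _).2 h))
  rw [sg, sg]
  rcases Int.units_eq_one_or p.1.2 with hp' | hp' <;> rcases Int.units_eq_one_or q.1.2 with hq' | hq'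
  · exact absurd (hp'.trans hq'.symm) h1
  · simp [hp', hq']
  · simp [hp', hq']
  · exact absurd (hp'.trans hq'.symm) h1

theorem exists_rep (c : σ.Choice) (b : E) : ∃ r ∈ c.oE, b = r ∨ b = σ.onE gen r := by
  obtain ⟨r, ⟨hr, h⟩, -⟩ := c.existsUnique_oE b
  refine ⟨r, hr, ?_⟩
  rcases h with rfl | rfl
  · exact Or.inl rfl
  · right; rw [onE_onE]

theorem rep_unique {r r' b : E} (hr : r ∈ c.oE) (hr' : r' ∈ c.oE) (h : b = r ∨ b = σ.onE gen r)
    (h' : b = r' ∨ b = σ.onE gen r') : r = r' := by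
  have key : ∀ r, (b = r ∨ b = σ.onE gen r) → (r = b ∨ r = σ.onE gen b) := by
    rintro r (rfl | rfl)
    · exact Or.inl rfl
    · right; rw [onE_onE]
  exact (c.existsUnique_oE b).unique ⟨hr, key r h⟩ ⟨hr', key r' h'⟩

theorem coef_ne {β : c.Arrow} {b : E} (h : c.coef k β b ≠ 0) :
    b = β.1.1 ∨ b = σ.onE gen β.1.1 := by
  by_contra! h'
  exact h (by rw [coef, if_neg h'.1, if_neg h'.2])

theorem coef_self (β : c.Arrow) : c.coef k β β.1.1 = 1 := if_pos rfl

/-- The two clauses of `coef` overlap when σ fixes the arrow. Both ends are then fixed and carry the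
same sign, so the product of signs is 1 and the clauses agree. -/
theorem coef_onE_self (β : c.Arrow) :
    c.coef k β (σ.onE gen β.1.1) = c.sg k (c.quiv.t β) * c.sg k (c.quiv.s β) := by
  rw [coef]
  split_ifs with h1
  · have hs : σ.IsFixed (Q.s β.1.1) := by rw [IsFixed, ← σ.s_map, h1]
    have ht : σ.IsFixed (Q.t β.1.1) := by rw [IsFixed, ← σ.t_map, h1]
    change 1 = c.sg k (c.vertex _ _) * c.sg k (c.vertex _ _)
    rw [sg_vertex_of_isFixed hs, sg_vertex_of_isFixed ht, units_cast_mul_self]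
  · rfl
  · exact absurd rfl ‹_›

theorem coef_onE (β : c.Arrow) (b : E) :
    c.coef k β (σ.onE gen b) = c.sg k (c.quiv.t β) * c.sg k (c.quiv.s β) * c.coef k β b := by
  by_cases h1 : b = β.1.1
  · rw [h1, coef_onE_self, coef_self, mul_one]
  by_cases h2 : b = σ.onE gen β.1.1
  · rw [h2, onE_onE, coef_self, coef_onE_self]
    linear_combination -(c.sg k (c.quiv.s β)) ^ 2 * sg_mul_self (k := k) (c.quiv.t β) -
      sg_mul_self (k := k) (c.quiv.s β)
  · rw [coef, coef, if_neg h1, if_neg h2, if_neg, if_neg, mul_zero]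
    · intro h; exact h1 ((σ.onE gen).injective h)
    · intro h; exact h2 (by rw [← h, onE_onE])

/-- The two maps `x` and `y` are the source and the target maps, in some order. -/
def IsEnds (x y : E → V) (Q : Quiv V E) : Prop := (x = Q.s ∧ y = Q.t) ∨ (x = Q.t ∧ y = Q.s)

theorem sum_arrow_of_not_isFixed [Fintype E] {β₀ : c.Arrow} (hs : ¬ σ.IsFixed (Q.s β₀.1.1))
    (ht : ¬ σ.IsFixed (Q.t β₀.1.1)) (f : c.Arrow → k)
    (hf : ∀ β : c.Arrow, β.1.1 ≠ β₀.1.1 → f β = 0) : ∑ β, f β = f β₀ := by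
  refine Finset.sum_eq_single _ (fun β _ hβ => hf β fun h => hβ ?_)
    (fun h => absurd (Finset.mem_univ _) h)
  refine Subtype.ext (Prod.ext h ?_)
  rw [β₀.2.2 hs ht]
  refine β.2.2 ?_ ?_ <;> rwa [h]

theorem sum_arrow_of_isFixed [Fintype E] {r : E} {β₁ β₂ : c.Arrow} (h₁ : β₁.1 = (r, 1))
    (h₂ : β₂.1 = (r, -1)) (f : c.Arrow → k) (hf : ∀ β : c.Arrow, β.1.1 ≠ r → f β = 0) :
    ∑ β, f β = f β₁ + f β₂ := by
  classical
  have hne : β₁ ≠ β₂ := by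
    rintro rfl
    exact absurd (congrArg Prod.snd (h₁.symm.trans h₂)) (show (1 : ℤˣ) ≠ -1 by decide)
  rw [← Finset.sum_pair hne]
  symm
  refine Finset.sum_subset (Finset.subset_univ _) fun β _ hβ => hf β fun h => hβ ?_
  rw [Finset.mem_insert, Finset.mem_singleton]
  rcases Int.units_eq_one_or β.1.2 with h' | h'
  · exact Or.inl (Subtype.ext ((Prod.ext h h').trans h₁.symm))
  · exact Or.inr (Subtype.ext ((Prod.ext h h').trans h₂.symm))

theorem IsEnds.map_left {x y : E → V}
    (hxy : IsEnds x y Q) (a : E) : x (σ.onE gen a) = σ.onV gen (x a) := by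
  rcases hxy with ⟨rfl, rfl⟩ | ⟨rfl, rfl⟩
  · exact σ.s_map _ _
  · exact σ.t_map _ _

theorem IsEnds.map_right {x y : E → V}
    (hxy : IsEnds x y Q) (a : E) : y (σ.onE gen a) = σ.onV gen (y a) := by
  rcases hxy with ⟨rfl, rfl⟩ | ⟨rfl, rfl⟩
  · exact σ.t_map _ _
  · exact σ.s_map _ _

theorem IsEnds.onE_eq {x y : E → V} (hxy : IsEnds x y Q) (hfix : σ.FixesArrows) {a : E}
    (h1 : σ.IsFixed (x a))
    (h2 : σ.IsFixed (y a)) : σ.onE gen a = a := by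
  rcases hxy with ⟨rfl, rfl⟩ | ⟨rfl, rfl⟩
  · exact hfix a h1 h2
  · exact hfix a h2 h1

theorem IsEnds.coef_onE_self {x y : E → V} (hxy : IsEnds x y Q) (β : c.Arrow) :
    c.coef k β (σ.onE gen β.1.1) =
      c.sg k (c.vertex (x β.1.1) β.1.2) * c.sg k (c.vertex (y β.1.1) β.1.2) := by
  rw [Choice.coef_onE_self]
  rcases hxy with ⟨rfl, rfl⟩ | ⟨rfl, rfl⟩
  · exact mul_comm _ _
  · rfl

theorem IsEnds.weight_eq_one {x y : E → V} (hxy : IsEnds x y Q) {β : c.Arrow}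
    (h1 : σ.IsFixed (x β.1.1)) (h2 : σ.IsFixed (y β.1.1)) :
    c.weight k β = 1 := by
  rcases hxy with ⟨rfl, rfl⟩ | ⟨rfl, rfl⟩
  · exact if_pos ⟨h1, h2⟩
  · exact if_pos ⟨h2, h1⟩

theorem IsEnds.weight_eq_two {x y : E → V} (hxy : IsEnds x y Q) {β : c.Arrow}
    (h : σ.IsFixed (x β.1.1) → ¬ σ.IsFixed (y β.1.1)) :
    c.weight k β = 2 := by
  rcases hxy with ⟨rfl, rfl⟩ | ⟨rfl, rfl⟩
  · exact if_neg fun h' => h h'.1 h'.2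
  · exact if_neg fun h' => h h'.2 h'.1

theorem IsEnds.eq_one {x y : E → V} (hxy : IsEnds x y Q) {β : c.Arrow}
    (h1 : ¬ σ.IsFixed (x β.1.1)) (h2 : ¬ σ.IsFixed (y β.1.1)) :
    β.1.2 = 1 := by
  rcases hxy with ⟨rfl, rfl⟩ | ⟨rfl, rfl⟩
  · exact β.2.2 h1 h2
  · exact β.2.2 h2 h1

/-- A representative r gives the single arrow r^+ if both of its ends move, and the two arrows r^+
and r^- otherwise. -/
theorem IsEnds.sum_arrow {x y : E → V} (hxy : IsEnds x y Q) [Fintype E] {r : E} (hr : r ∈ c.oE)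
    (f : c.Arrow → k) (hf : ∀ β : c.Arrow, β.1.1 ≠ r → f β = 0) :
    (¬ σ.IsFixed (x r) ∧ ¬ σ.IsFixed (y r) ∧ ∃ β : c.Arrow, β.1 = (r, 1) ∧ ∑ β, f β = f β) ∨
    ((σ.IsFixed (x r) ∨ σ.IsFixed (y r)) ∧ ∃ β β' : c.Arrow, β.1 = (r, 1) ∧ β'.1 = (r, -1) ∧
      ∑ β, f β = f β + f β') := by
  by_cases h : σ.IsFixed (Q.s r) ∨ σ.IsFixed (Q.t r)
  · right
    refine ⟨?_, ⟨(r, 1), hr, fun _ _ => rfl⟩, ⟨(r, -1), hr, fun h1 h2 => (h.elim h1 h2).elim⟩,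
      rfl, rfl, sum_arrow_of_isFixed rfl rfl f hf⟩
    · rcases hxy with ⟨rfl, rfl⟩ | ⟨rfl, rfl⟩
      · exact h
      · exact h.symm
  · left
    rw [not_or] at h
    refine ⟨?_, ?_, _, rfl, sum_arrow_of_not_isFixed (β₀ := ⟨(r, 1), hr,
      fun _ _ => rfl⟩) h.1 h.2 f hf⟩
    · rcases hxy with ⟨rfl, rfl⟩ | ⟨rfl, rfl⟩
      · exact h.1
      · exact h.2
    · rcases hxy with ⟨rfl, rfl⟩ | ⟨rfl, rfl⟩
      · exact h.2
      · exact h.1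

theorem coef_mul_self {β : c.Arrow} {b : E} (h : b = β.1.1 ∨ b = σ.onE gen β.1.1) :
    c.coef k β b * c.coef k β b = 1 := by
  rcases h with rfl | rfl
  · rw [coef_self, one_mul]
  · rw [coef_onE_self]
    linear_combination (c.sg k (c.quiv.s β)) ^ 2 * sg_mul_self (k := k) (c.quiv.t β) +
      sg_mul_self (k := k) (c.quiv.s β)

open Classical in
-- First orthogonality relation. Only arrows over the common representative r of b and b'
-- contribute, and the cases are those of fixed or moving ends of r. Leaving open which of x and y
-- is the source lets the same computation serve arrows and reversed arrows.
theorem IsEnds.sum_coef_mul_coef [Fintype E] {x y : E → V} (hxy : IsEnds x y Q)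
    (hfix : σ.FixesArrows) (hk : (2 : k) ≠ 0) {p : c.Vertex} {b b' : E} (hb : c.mem p (y b))
    (hb' : c.mem p (y b')) (hx : x b = x b') :
    (∑ β : c.Arrow, if c.vertex (y β.1.1) β.1.2 = p then c.coef k β b * c.coef k β b' *
      (c.size k (c.vertex (x β.1.1) β.1.2) / c.weight k β) else 0) =
      if b = b' then 1 else 0 := by
  obtain ⟨r, hr, hbr⟩ := c.exists_rep b
  set g : c.Arrow → k := fun β => if c.vertex (y β.1.1) β.1.2 = p then c.coef k β b *
    c.coef k β b' * (c.size k (c.vertex (x β.1.1) β.1.2) / c.weight k β) else 0 with hg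
  have hz : ∀ β : c.Arrow, β.1.1 ≠ r → g β = 0 := by
    intro β hβ
    by_contra h0
    refine hβ (rep_unique β.2.1 hr (coef_ne (k := k) (b := b) fun h => h0 ?_) hbr)
    simp [hg, h]
  have hxr : σ.IsFixed (x b) ↔ σ.IsFixed (x r) := by
    rcases hbr with rfl | rfl
    · rfl
    · rw [hxy.map_left, isFixed_onV]
  have hyr : c.mem p (y r) := by
    rcases hbr with rfl | rfl
    · exact hb
    · rwa [hxy.map_right, mem_onV] at hb
  by_cases hbr' : b' = r ∨ b' = σ.onE gen r
  swap
  · rw [if_neg]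
    · refine Finset.sum_eq_zero fun β _ => ?_
      by_cases hβ : β.1.1 = r
      · have : c.coef k β b' = 0 := by
          by_contra h
          exact hbr' (hβ ▸ coef_ne h)
        simp [this]
      · exact hz β hβ
    · rintro rfl
      exact hbr' hbr
  have h2 : (2 : k) / 2 = 1 := div_self hk
  by_cases hx' : σ.IsFixed (x r)
  · by_cases hy' : σ.IsFixed (y r)
    -- Both ends fixed: r is alone in its orbit, and among r^+ and r^- exactly one has its y-end at
    -- p.
    · have hσ := hxy.onE_eq hfix hx' hy'
      rw [hσ, or_self] at hbr hbr'
      subst hbr hbr'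
      have hv : ∀ β : c.Arrow, β.1.1 = b' → g β = if β.1.2 = p.1.2 then 1 else 0 := by
        rintro β rfl
        simp only [hg]
        rw [coef_self, size_eq_one (mem_vertex _ _) hx', hxy.weight_eq_one hx' hy']
        simp only [vertex_eq_iff_of_isFixed hyr hy']
        simp
      obtain ⟨h, -, -⟩ | ⟨-, β₁, β₂, h₁, h₂, h⟩ := hxy.sum_arrow hr g hz
      · exact absurd hx' h
      · rw [h, hv β₁ (by rw [h₁]), hv β₂ (by rw [h₂]), h₁, h₂, if_pos rfl]
        rcases Int.units_eq_one_or p.1.2 with hp | hp <;> rw [hp] <;> simp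
    -- Only the x-end fixed: both r^+ and r^- have their y-end at p, each with factor 1/2. For b =
    -- b' the terms add up to 1; otherwise the products of coefficients are +1 and -1 and cancel.
    · have hv : ∀ β : c.Arrow, β.1.1 = r → g β = c.coef k β b * c.coef k β b' * (1 / 2) := by
        rintro β rfl
        simp only [hg]
        rw [size_eq_one (mem_vertex _ _) hx', hxy.weight_eq_two fun _ => hy',
          if_pos (vertex_eq_of_not_isFixed hyr hy' _)]
      obtain ⟨h, -, -⟩ | ⟨-, β₁, β₂, h₁, h₂, h⟩ := hxy.sum_arrow hr g hz
      · exact absurd hx' h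
      have hr1 : β₁.1.1 = r := by rw [h₁]
      have hr2 : β₂.1.1 = r := by rw [h₂]
      rw [h, hv β₁ hr1, hv β₂ hr2]
      by_cases hbb : b = b'
      · subst hbb
        rw [coef_mul_self (hr1.symm ▸ hbr), coef_mul_self (hr2.symm ▸ hbr), if_pos rfl]
        linear_combination h2
      · rw [if_neg hbb]
        have hc : ∀ β : c.Arrow, β.1.1 = r →
            c.coef k β b * c.coef k β b' = ((β.1.2 : ℤ) : k) := by
          rintro β rfl
          have : c.coef k β (σ.onE gen β.1.1) = ((β.1.2 : ℤ) : k) := by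
            rw [hxy.coef_onE_self, sg_vertex_of_isFixed hx', sg_of_not_isFixed (mem_vertex _ _) hy',
              mul_one]
          rcases hbr with rfl | rfl <;> rcases hbr' with rfl | rfl
          · exact absurd rfl hbb
          · rw [this, coef_self, one_mul]
          · rw [this, coef_self, mul_one]
          · exact absurd rfl hbb
        rw [hc β₁ hr1, hc β₂ hr2, h₁, h₂]
        simp
  -- The x-end moves, so arrows of one orbit with equal x-ends coincide. Exactly one arrow over r
  -- has its y-end at p, with factor 2/2.
  · have hbb : b = b' := by
      have hne : ∀ r, ¬ σ.IsFixed (x r) → x (σ.onE gen r) ≠ x r := by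
        intro r h h'
        rw [hxy.map_left] at h'
        exact h h'
      rcases hbr with rfl | rfl <;> rcases hbr' with rfl | rfl
      · rfl
      · exact absurd hx.symm (hne _ hx')
      · exact absurd hx (hne _ hx')
      · rfl
    subst hbb
    rw [if_pos rfl]
    have hv : ∀ β : c.Arrow, β.1.1 = r → g β = if c.vertex (y r) β.1.2 = p then 1 else 0 := by
      rintro β rfl
      simp only [hg]
      rw [coef_mul_self hbr, size_eq_two (mem_vertex _ _) hx',
        hxy.weight_eq_two fun h => absurd h hx',
        one_mul, h2]
    obtain ⟨-, hy', β₁, h₁, h⟩ | ⟨hy', β₁, β₂, h₁, h₂, h⟩ := hxy.sum_arrow hr g hz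
    · rw [h, hv β₁ (by rw [h₁]), if_pos (vertex_eq_of_not_isFixed hyr hy' _)]
    · rw [h, hv β₁ (by rw [h₁]), hv β₂ (by rw [h₂]), h₁, h₂]
      simp only [vertex_eq_iff_of_isFixed hyr (hy'.resolve_left hx')]
      rcases Int.units_eq_one_or p.1.2 with hp | hp <;> rw [hp] <;> simp

open Classical in
-- Dual orthogonality relation, summing over arrows of Q. Different representatives have disjoint
-- orbits. Over one representative, r^+ and r^- share their y-end and have a fixed x-end only when y
-- moves and x is fixed: their coefficient vectors are then (1, 1) and (1, -1). In all other cases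
-- the hypothesis on y-ends, or the absence of r^-, forces β = β'.
theorem IsEnds.sum_coef_mul_coef' [Fintype E] {x y : E → V} (hxy : IsEnds x y Q)
    (hfix : σ.FixesArrows) (hk : (2 : k) ≠ 0) {β β' : c.Arrow} {l : V}
    (hy : c.vertex (y β.1.1) β.1.2 = c.vertex (y β'.1.1) β'.1.2)
    (hl : c.mem (c.vertex (x β.1.1) β.1.2) l) :
    (∑ b, if x b = l then c.coef k β b * c.coef k β' b *
      (c.size k (c.vertex (x β.1.1) β.1.2) / c.weight k β) else 0) =
      if β = β' then 1 else 0 := by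
  have h2 : (2 : k) / 2 = 1 := div_self hk
  by_cases hββ : β.1.1 = β'.1.1
  swap
  · rw [if_neg (fun h => hββ (by rw [h])), Finset.sum_eq_zero]
    intro b _
    have : c.coef k β b * c.coef k β' b = 0 := by
      by_contra h0
      exact hββ (rep_unique β.2.1 β'.2.1 (coef_ne (left_ne_zero_of_mul h0))
        (coef_ne (right_ne_zero_of_mul h0)))
    simp [this]
  have hl' := eq_or_of_mem (mem_vertex _ _) hl
  have heq : ∀ ε, β.1.2 = ε → β'.1.2 = ε → β = β' := fun ε h h' =>
    Subtype.ext (Prod.ext hββ (h.trans h'.symm))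
  have hsq : ∀ b, (b = β.1.1 ∨ b = σ.onE gen β.1.1) → β = β' →
      c.coef k β b * c.coef k β' b = 1 := by
    rintro b hb rfl
    exact coef_mul_self hb
  by_cases hx' : σ.IsFixed (x β.1.1)
  · have hlx : l = x β.1.1 := by
      rcases hl' with h | h
      · exact h
      · exact h.trans hx'
    by_cases hy' : σ.IsFixed (y β.1.1)
    · have hσ := hxy.onE_eq hfix hx' hy'
      have he : β = β' := by
        rw [← hββ, vertex_of_isFixed hy', vertex_of_isFixed hy'] at hy
        exact heq _ (congrArg (fun p : c.Vertex => p.1.2) hy) rfl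
      rw [if_pos he, Finset.sum_eq_single β.1.1]
      · rw [if_pos hlx.symm, hsq _ (Or.inl rfl) he, size_eq_one (mem_vertex _ _) hx',
          hxy.weight_eq_one hx' hy']
        simp
      · intro b _ hb
        have : c.coef k β b = 0 := by
          by_contra h0
          have := coef_ne h0
          rw [hσ, or_self] at this
          exact hb this
        simp [this]
      · simp
    · have hne : β.1.1 ≠ σ.onE gen β.1.1 := by
        intro h
        have := hxy.map_right (σ := σ) β.1.1
        rw [← h] at this
        exact hy' this.symm
      have hs : ∀ β : c.Arrow, σ.IsFixed (x β.1.1) → ¬ σ.IsFixed (y β.1.1) →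
          c.coef k β (σ.onE gen β.1.1) = ((β.1.2 : ℤ) : k) := by
        intro β hx' hy'
        rw [hxy.coef_onE_self, sg_vertex_of_isFixed hx', sg_of_not_isFixed (mem_vertex _ _) hy',
          mul_one]
      rw [← Finset.sum_subset (Finset.subset_univ {β.1.1, σ.onE gen β.1.1}), Finset.sum_pair hne]
      · have hs' := hs β' (hββ ▸ hx') (hββ ▸ hy')
        have hc' := coef_self (k := k) β'
        rw [← hββ] at hs' hc'
        have hxσ : x (σ.onE gen β.1.1) = l := by rw [hxy.map_left, hlx]; exact hx'
        rw [if_pos hlx.symm, if_pos hxσ, coef_self, hs β hx' hy', hc', hs',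
          size_eq_one (mem_vertex _ _) hx', hxy.weight_eq_two fun _ => hy']
        by_cases he : β = β'
        · rw [if_pos he, ← he, units_cast_mul_self]
          linear_combination h2
        · rw [if_neg he]
          rcases Int.units_eq_one_or β.1.2 with h | h <;>
            rcases Int.units_eq_one_or β'.1.2 with h' | h'
          · exact absurd (heq _ h h') he
          · rw [h, h']; simp
          · rw [h, h']; simp
          · exact absurd (heq _ h h') he
      · intro b _ hb
        have : c.coef k β b = 0 := by
          by_contra h0
          refine hb ?_
          rw [Finset.mem_insert, Finset.mem_singleton]
          exact coef_ne h0
        simp [this]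
  · have he : β = β' := by
      by_cases hy' : σ.IsFixed (y β.1.1)
      · rw [← hββ, vertex_of_isFixed hy', vertex_of_isFixed hy'] at hy
        exact heq _ (congrArg (fun p : c.Vertex => p.1.2) hy) rfl
      · exact heq 1 (hxy.eq_one hx' hy') (hxy.eq_one (hββ ▸ hx') (hββ ▸ hy'))
    have hne : ∀ i, ¬ σ.IsFixed i → σ.onV gen i ≠ i := fun i h => h
    -- As the x-end moves, each of the two vertices of its orbit is the x-end of exactly one arrow
    -- of the orbit.
    obtain ⟨b₀, hb₀, hxb, huniq⟩ : ∃ b₀, (b₀ = β.1.1 ∨ b₀ = σ.onE gen β.1.1) ∧ x b₀ = l ∧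
        ∀ b, (b = β.1.1 ∨ b = σ.onE gen β.1.1) → x b = l → b = b₀ := by
      rcases hl' with rfl | rfl
      · refine ⟨β.1.1, Or.inl rfl, rfl, ?_⟩
        rintro b (rfl | rfl) hb
        · rfl
        · rw [hxy.map_left] at hb
          exact absurd hb hx'
      · refine ⟨σ.onE gen β.1.1, Or.inr rfl, hxy.map_left _, ?_⟩
        rintro b (rfl | rfl) hb
        · exact absurd hb.symm hx'
        · rfl
    rw [if_pos he, Finset.sum_eq_single b₀]
    · rw [if_pos hxb, hsq _ hb₀ he, size_eq_two (mem_vertex _ _) hx',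
        hxy.weight_eq_two fun h => absurd h hx', one_mul, h2]
    · intro b _ hb
      split_ifs with hbl
      · have : c.coef k β b = 0 := by
          by_contra h0
          exact hb (huniq b (coef_ne h0) hbl)
        simp [this]
      · rfl
    · simp

end Choice
end Quiv.Action
end QP

/-! ### The folding of the bar quiver of Q onto that of Q_G -/

namespace QP
open Series
namespace Quiv.Action.Choice

variable {k : Type*} [Field k] {V E : Type*} {Q : Quiv V E} {σ : Q.Action C2} (c : σ.Choice)

open Classical in
/-- The arrows of the bar quiver of `Q_G` as combinations of the arrows of `Q̄`. -/
def barM (k : Type*) [Field k] : GArrow c.Vertex c.Arrow → GArrow V E → k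
  -- The signed average of α, which is the component of α ⊗ 1 between the idempotents at the ends of
  -- β.
  | .inl β, .inl b => c.coef k β b / c.weight k β
  -- This factor, and the orbit length used for loops, are the normalisations for which the values
  -- of the Ginzburg differentials on reversed arrows and loops correspond exactly.
  | .inr (.inl β), .inr (.inl b) =>
      c.size k (c.quiv.s β) * c.size k (c.quiv.t β) * c.coef k β b
  | .inr (.inr p), .inr (.inr i) => if c.mem p i then c.size k p else 0
  | _, _ => 0

open Classical in
/-- The coefficients of the correspondence inverse to `barM`. -/
def barN (k : Type*) [Field k] : GArrow c.Vertex c.Arrow → GArrow V E → k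
  -- Chosen so that products of M and N become the summands of `IsEnds.sum_coef_mul_coef`, with x
  -- the source for arrows and x the target for reversed arrows.
  | .inl β, .inl b => c.size k (c.quiv.s β) * c.coef k β b
  | .inr (.inl β), .inr (.inl b) => c.coef k β b / (c.weight k β * c.size k (c.quiv.s β))
  | .inr (.inr p), .inr (.inr i) => if c.mem p i then (c.size k p)⁻¹ else 0
  | _, _ => 0

variable {c}

theorem isEnds_s_t : IsEnds Q.s Q.t Q := Or.inl ⟨rfl, rfl⟩
theorem isEnds_t_s : IsEnds Q.t Q.s Q := Or.inr ⟨rfl, rfl⟩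

theorem mem_of_coef_ne {β : c.Arrow} {b : E} (h : c.coef k β b ≠ 0) :
    c.mem (c.quiv.t β) (Q.t b) ∧ c.mem (c.quiv.s β) (Q.s b) := by
  rcases coef_ne h with rfl | rfl
  · exact ⟨mem_vertex _ _, mem_vertex _ _⟩
  · rw [σ.t_map, σ.s_map, mem_onV, mem_onV]
    exact ⟨mem_vertex _ _, mem_vertex _ _⟩

theorem size_eq_sum [Fintype V] (p : c.Vertex) :
    c.size k p = ∑ i, open Classical in if c.mem p i then (1 : k) else 0 := by
  classical
  by_cases hp : σ.IsFixed p.1.1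
  · rw [size, if_pos hp, Finset.sum_eq_single p.1.1]
    · exact (if_pos (Or.inl rfl)).symm
    · intro i _ hi
      refine if_neg ?_
      rintro (h | h)
      · exact hi h
      · exact hi (h.trans hp)
    · simp
  · rw [size, if_neg hp, ← Finset.sum_subset (Finset.subset_univ {p.1.1, σ.onV gen p.1.1}),
      Finset.sum_pair (fun h => hp h.symm), if_pos (show c.mem p p.1.1 from Or.inl rfl),
      if_pos (show c.mem p (σ.onV gen p.1.1) from Or.inr rfl)]
    · norm_num
    · intro i _ hi
      rw [Finset.mem_insert, Finset.mem_singleton] at hi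
      exact if_neg hi

theorem barM_ne {β : GArrow c.Vertex c.Arrow} {b : GArrow V E} (h : c.barM k β b ≠ 0) :
    c.mem (c.quiv.bar.t β) (Q.bar.t b) ∧ c.mem (c.quiv.bar.s β) (Q.bar.s b) := by
  rcases β with β | β | p <;> rcases b with b | b | i
  · exact mem_of_coef_ne (k := k) fun h0 => h (by simp [barM, h0])
  · exact absurd rfl h
  · exact absurd rfl h
  · exact absurd rfl h
  · exact (mem_of_coef_ne (k := k) fun h0 => h (by simp [barM, h0])).symm
  · exact absurd rfl h
  · exact absurd rfl h
  · exact absurd rfl h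
  · have : c.mem p i := by
      by_contra h0
      exact h (if_neg h0)
    exact ⟨this, this⟩

theorem barN_ne {β : GArrow c.Vertex c.Arrow} {b : GArrow V E} (h : c.barN k β b ≠ 0) :
    c.mem (c.quiv.bar.t β) (Q.bar.t b) ∧ c.mem (c.quiv.bar.s β) (Q.bar.s b) := by
  rcases β with β | β | p <;> rcases b with b | b | i
  · exact mem_of_coef_ne (k := k) fun h0 => h (by simp [barN, h0])
  · exact absurd rfl h
  · exact absurd rfl h
  · exact absurd rfl h
  · exact (mem_of_coef_ne (k := k) fun h0 => h (by simp [barN, h0])).symm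
  · exact absurd rfl h
  · exact absurd rfl h
  · exact absurd rfl h
  · have : c.mem p i := by
      by_contra h0
      exact h (if_neg h0)
    exact ⟨this, this⟩

theorem barM_onBar (β : GArrow c.Vertex c.Arrow) (b : GArrow V E) :
    c.barM k β (σ.onBar gen b) =
      c.sg k (c.quiv.bar.t β) * c.sg k (c.quiv.bar.s β) * c.barM k β b := by
  rcases β with β | β | p <;> rcases b with b | b | i
  · change c.coef k β (σ.onE gen b) / _ = c.sg k (c.quiv.t β) * c.sg k (c.quiv.s β) *
      (c.coef k β b / _)
    rw [coef_onE]; ring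
  · exact (mul_zero _).symm
  · exact (mul_zero _).symm
  · exact (mul_zero _).symm
  · change _ * c.coef k β (σ.onE gen b) = c.sg k (c.quiv.s β) * c.sg k (c.quiv.t β) *
      (_ * c.coef k β b)
    rw [coef_onE]; ring
  · exact (mul_zero _).symm
  · exact (mul_zero _).symm
  · exact (mul_zero _).symm
  · change c.barM k (.inr (.inr p)) (.inr (.inr (σ.onV gen i))) = c.sg k p * c.sg k p * _
    rw [sg_mul_self, one_mul]
    simp only [barM]
    classical exact if_congr mem_onV rfl rfl

theorem barN_onBar (β : GArrow c.Vertex c.Arrow) (b : GArrow V E) :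
    c.barN k β (σ.onBar gen b) =
      c.sg k (c.quiv.bar.t β) * c.sg k (c.quiv.bar.s β) * c.barN k β b := by
  rcases β with β | β | p <;> rcases b with b | b | i
  · change _ * c.coef k β (σ.onE gen b) = c.sg k (c.quiv.t β) * c.sg k (c.quiv.s β) *
      (_ * c.coef k β b)
    rw [coef_onE]; ring
  · exact (mul_zero _).symm
  · exact (mul_zero _).symm
  · exact (mul_zero _).symm
  · change c.coef k β (σ.onE gen b) / _ = c.sg k (c.quiv.s β) * c.sg k (c.quiv.t β) *
      (c.coef k β b / _)
    rw [coef_onE]; ring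
  · exact (mul_zero _).symm
  · exact (mul_zero _).symm
  · exact (mul_zero _).symm
  · change c.barN k (.inr (.inr p)) (.inr (.inr (σ.onV gen i))) = c.sg k p * c.sg k p * _
    rw [sg_mul_self, one_mul]
    simp only [barN]
    classical exact if_congr mem_onV rfl rfl

theorem barM_mul_barN_inl (hk : (2 : k) ≠ 0) (β β' : c.Arrow) (b b' : E) :
    c.coef k β b / c.weight k β * (c.size k (c.quiv.s β') * c.coef k β' b') =
      c.coef k β b * c.coef k β' b' * (c.size k (c.quiv.s β') / c.weight k β) := by
  have := weight_ne_zero hk β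
  field_simp

theorem barM_mul_barN_inr (hk : (2 : k) ≠ 0) (β : c.Arrow) (x y : k) :
    c.size k (c.quiv.s β) * c.size k (c.quiv.t β) * x *
      (y / (c.weight k β * c.size k (c.quiv.s β))) =
      x * y * (c.size k (c.quiv.t β) / c.weight k β) := by
  have := weight_ne_zero hk β
  have := size_ne_zero hk (c.quiv.s β)
  field_simp

open Classical in
theorem sum_barM_mul_barN [Fintype V] [Fintype E] (hfix : σ.FixesArrows)
    (hk : (2 : k) ≠ 0) (p : c.Vertex)
    (b b' : GArrow V E) (hb : c.mem p (Q.bar.t b)) (hb' : c.mem p (Q.bar.t b'))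
    (hs : Q.bar.s b = Q.bar.s b') :
    (∑ β, if c.quiv.bar.t β = p then c.barM k β b * c.barN k β b' else 0) =
      if b = b' then 1 else 0 := by
  rw [Fintype.sum_sum_type, Fintype.sum_sum_type]
  rcases b with b | b | i <;> rcases b' with b' | b' | i'
  · have := isEnds_s_t.sum_coef_mul_coef hfix hk hb hb' hs
    simp only [barM, barN, zero_mul, ite_self, Finset.sum_const_zero, add_zero,
      Sum.inl.injEq, barM_mul_barN_inl hk]
    exact this
  · simp [barM, barN]
  · simp [barM, barN]
  · simp [barM, barN]
  · have := isEnds_t_s.sum_coef_mul_coef hfix hk hb hb' hs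
    simp only [barM, barN, zero_mul, ite_self, Finset.sum_const_zero, add_zero, zero_add,
      Sum.inl.injEq, Sum.inr.injEq, barM_mul_barN_inr hk]
    exact this
  · simp [barM, barN]
  · simp [barM, barN]
  · simp [barM, barN]
  · change i = i' at hs
    subst hs
    simp only [barM, barN, zero_mul, ite_self, Finset.sum_const_zero, zero_add]
    rw [Finset.sum_eq_single p, if_pos (show True from trivial)]
    · have : c.mem p i := hb
      rw [if_pos (show c.quiv.bar.t (Sum.inr (Sum.inr p)) = p from rfl), if_pos this,
        if_pos this, mul_inv_cancel₀ (size_ne_zero hk p)]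
    · intro p' _ hp'
      exact if_neg hp'
    · simp

open Classical in
theorem sum_barN_mul_barM [Fintype V] [Fintype E] (hfix : σ.FixesArrows) (hk : (2 : k) ≠ 0)
    (β β' : GArrow c.Vertex c.Arrow) (l : V) (ht : c.quiv.bar.t β = c.quiv.bar.t β')
    (hl : c.mem (c.quiv.bar.s β) l) :
    (∑ b, if Q.bar.s b = l then c.barN k β b * c.barM k β' b else 0) =
      if β = β' then 1 else 0 := by
  rw [Fintype.sum_sum_type, Fintype.sum_sum_type]
  rcases β with β | β | p <;> rcases β' with β' | β' | p'
  · have := isEnds_s_t.sum_coef_mul_coef' (k := k) hfix hk ht hl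
    have hw := weight_ne_zero hk β
    have hw' := weight_ne_zero hk β'
    -- M carries the weight of β' where the orthogonality relation has that of β. The ratio is 1
    -- whenever the sum is nonzero, since then β = β'.
    have h1 : ∀ b, (if Q.bar.s (Sum.inl b) = l then
        c.size k (c.quiv.s β) * c.coef k β b * (c.coef k β' b / c.weight k β') else 0) =
        c.weight k β / c.weight k β' * if Q.s b = l then c.coef k β b * c.coef k β' b *
          (c.size k (c.quiv.s β) / c.weight k β) else 0 := by
      intro b
      rw [mul_ite, mul_zero]
      refine if_congr Iff.rfl ?_ rfl
      field_simp
    simp only [barM, barN, mul_zero, ite_self, Finset.sum_const_zero, add_zero,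
      Sum.inl.injEq, h1, ← Finset.mul_sum]
    refine (congrArg _ this).trans ?_
    split_ifs with h
    · rw [h, div_self hw', one_mul]
    · rw [mul_zero]
  · simp [barM, barN]
  · simp [barM, barN]
  · simp [barM, barN]
  · have := isEnds_t_s.sum_coef_mul_coef' (k := k) hfix hk ht hl
    have hw := weight_ne_zero hk β
    have hs : c.quiv.s β = c.quiv.s β' := ht
    have hs0 := size_ne_zero hk (c.quiv.s β')
    have ht0 := size_ne_zero hk (c.quiv.t β)
    have ht0' := size_ne_zero hk (c.quiv.t β')
    have h1 : ∀ b, (if Q.bar.s (Sum.inr (Sum.inl b)) = l then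
        c.coef k β b / (c.weight k β * c.size k (c.quiv.s β)) *
        (c.size k (c.quiv.s β') * c.size k (c.quiv.t β') * c.coef k β' b) else 0) =
        c.size k (c.quiv.t β') / c.size k (c.quiv.t β) *
          if Q.t b = l then c.coef k β b * c.coef k β' b *
            (c.size k (c.quiv.t β) / c.weight k β) else 0 := by
      intro b
      rw [mul_ite, mul_zero]
      refine if_congr Iff.rfl ?_ rfl
      rw [hs]
      field_simp
    simp only [barM, barN, mul_zero, ite_self, Finset.sum_const_zero, add_zero, zero_add,
      Sum.inl.injEq, Sum.inr.injEq, h1, ← Finset.mul_sum]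
    refine (congrArg _ this).trans ?_
    split_ifs with h
    · rw [h, div_self ht0', one_mul]
    · rw [mul_zero]
  · simp [barM, barN]
  · simp [barM, barN]
  · simp [barM, barN]
  · obtain rfl : p = p' := ht
    have hl' : c.mem p l := hl
    simp only [barM, barN, mul_zero, ite_self, Finset.sum_const_zero, zero_add]
    rw [Finset.sum_eq_single l, if_pos (show Q.bar.s (Sum.inr (Sum.inr l)) = l from rfl),
      if_pos hl', if_pos hl', inv_mul_cancel₀ (size_ne_zero hk p), if_pos (show True from trivial)]
    · intro i _ hi
      exact if_neg hi
    · simp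

/-- The folding of the bar quiver of `Q` onto the bar quiver of `Q_G`. -/
def folding [Fintype V] [Fintype E] (c : σ.Choice) (hfix : σ.FixesArrows) (hk : (2 : k) ≠ 0) :
    Folding k c.quiv.bar Q.bar where
  onV := σ.onV gen
  onE := σ.onBar gen
  onV_onV := σ.onV_onV
  onE_onE := by
    rintro (a | a | i)
    · exact congrArg Sum.inl (σ.onE_onE a)
    · exact congrArg (fun x => Sum.inr (Sum.inl x)) (σ.onE_onE a)
    · exact congrArg (fun x => Sum.inr (Sum.inr x)) (σ.onV_onV i)
  s_onE := by
    rintro (a | a | i)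
    · exact σ.s_map _ _
    · exact σ.t_map _ _
    · rfl
  t_onE := by
    rintro (a | a | i)
    · exact σ.t_map _ _
    · exact σ.s_map _ _
    · rfl
  rep p := p.1.1
  mem := c.mem
  mem_iff _ _ := Iff.rfl
  sg := c.sg k
  sg_mul_self := sg_mul_self
  two_ne_zero := hk
  of_ne _ _ _ h h1 h2 := eq_of_mem_of_ne h h1 h2
  size := c.size k
  size_ne_zero := size_ne_zero hk
  size_eq := size_eq_sum
  M := c.barM k
  N := c.barN k
  M_ne _ _ := barM_ne
  N_ne _ _ := barN_ne
  M_onE := barM_onBar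
  N_onE := barN_onBar
  sum_M_N p b b' h1 h2 h3 := by
    convert sum_barM_mul_barN (k := k) hfix hk p b b' h1 h2 h3
  sum_N_M β β' l h1 h2 := by
    convert sum_barN_mul_barM (k := k) hfix hk β β' l h1 h2

end Quiv.Action.Choice
-- Sums of rotations, cyclic derivatives and substitution
section Cyc

variable {k X Y : Type*} [CommRing k]

/-- The sum of all rotations. -/
def cyc : Series k X →ₗ[k] Series k X where
  toFun f := ⟨fun w => ∑ n ∈ Finset.range w.length, f (w.rotate n)⟩
  map_add' f g := by ext w; simp [Finset.sum_add_distrib]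
  map_smul' c f := by ext w; simp [Finset.mul_sum]

theorem cyc_apply (f : Series k X) (w : List X) :
    cyc f w = ∑ n ∈ Finset.range w.length, f (w.rotate n) := rfl

theorem cyc_rotate_succ (f : Series k X) (w : List X) :
    ∑ n ∈ Finset.range w.length, f (w.rotate (n + 1)) = cyc f w := by
  have h1 := Finset.sum_range_succ (fun n => f (w.rotate n)) w.length
  have h2 := Finset.sum_range_succ' (fun n => f (w.rotate n)) w.length
  rw [List.rotate_length] at h1
  rw [List.rotate_zero] at h2
  exact add_right_cancel (h2.symm.trans h1)

/-- Each occurrence of a in a cyclic word is brought to the front by exactly one rotation, and ∂_a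
then strips it. -/
theorem Potential.cyclicDeriv_eq {P : Type*} {Q : Quiv P X} (S : Potential k Q) (a : X) :
    S.cyclicDeriv a = shift a (cyc S.series) := by
  ext u
  rw [cyclicDeriv_cons, cyc_rotate_succ, shift_apply]

theorem cyc_word_rotate (v : List X) : cyc (word (v.rotate 1) : Series k X) = cyc (word v) := by
  classical
  ext w
  rw [← cyc_rotate_succ, cyc_apply]
  refine Finset.sum_congr rfl fun n _ => ?_
  rw [word_apply, word_apply, ← List.rotate_rotate]
  exact if_congr (List.rotate_injective 1).eq_iff rfl rfl

/-- `cyc` kills the differences of a word and its rotation. Its coefficient at w involves only words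
of the length of w, so an approximation up to that length replaces the closure. -/
theorem Potential.CyclicEquiv.cyc_eq {P : Type*} {Q : Quiv P X} {S T : Potential k Q}
    (h : S.CyclicEquiv T) : cyc S.series = cyc T.series := by
  ext w
  obtain ⟨c, hc, h⟩ := h (w.length + 1)
  have h0 : cyc c = 0 := by
    refine Submodule.span_induction (p := fun c _ => cyc c = 0) ?_ (map_zero _) ?_ ?_ hc
    · rintro _ ⟨v, -, rfl⟩
      rw [map_sub, cyc_word_rotate, sub_self]
    · intro x y _ _ hx hy
      rw [map_add, hx, hy, add_zero]
    · intro a x _ hx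
      rw [map_smul, hx, smul_zero]
  have h1 : cyc (S.series - T.series) w = cyc c w := by
    rw [cyc_apply, cyc_apply]
    exact Finset.sum_congr rfl fun n _ =>
      h _ (by rw [List.length_rotate]; exact Nat.lt_succ_self _)
  rw [h0, map_sub] at h1
  exact sub_eq_zero.1 h1

/-- The recursion at the other end of the word; a rotation moves a letter from the front to the
back, so both recursions are needed. -/
theorem subst_append [Fintype Y] (N : X → Y → k) (f : Series k Y) (β : X) (u : List X) :
    subst N f (u ++ [β]) =
      ∑ b, N β b * subst N (⟨fun w => f (w ++ [b])⟩ : Series k Y) u := by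
  induction u generalizing f with
  | nil => rw [List.nil_append, subst_cons]; rfl
  | cons α u ih =>
    rw [List.cons_append, subst_cons]
    simp only [ih, subst_cons, Finset.mul_sum]
    rw [Finset.sum_comm]
    refine Finset.sum_congr rfl fun b _ => Finset.sum_congr rfl fun a _ => mul_left_comm _ _ _

theorem subst_rotate_one [Fintype Y] (N : X → Y → k) (f : Series k Y) (u : List X) :
    subst N (⟨fun w => f (w.rotate 1)⟩ : Series k Y) u = subst N f (u.rotate 1) := by
  cases u with
  | nil => rfl
  | cons β u =>
    rw [List.rotate_cons_succ, List.rotate_zero, subst_append, subst_cons]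
    refine Finset.sum_congr rfl fun b _ => ?_
    congr 3
    ext w
    rw [shift_apply, Series.mk_apply, List.rotate_cons_succ, List.rotate_zero]
    rfl

theorem subst_rotate [Fintype Y] (N : X → Y → k) (f : Series k Y) (u : List X) (n : ℕ) :
    subst N (⟨fun w => f (w.rotate n)⟩ : Series k Y) u = subst N f (u.rotate n) := by
  induction n generalizing u with
  | zero => simp only [List.rotate_zero]; rfl
  | succ n ih =>
    rw [add_comm n 1, ← List.rotate_rotate, ← ih, ← subst_rotate_one]
    congr 2
    ext w
    rw [Series.mk_apply, ← List.rotate_rotate]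
    rfl

theorem subst_congr [Fintype Y] (N : X → Y → k) {f g : Series k Y} {u : List X}
    (h : ∀ w, w.length = u.length → f w = g w) : subst N f u = subst N g u := by
  induction u generalizing f g with
  | nil => exact h [] rfl
  | cons β u ih =>
    rw [subst_cons, subst_cons]
    refine Finset.sum_congr rfl fun b _ => ?_
    rw [ih (f := shift b f) (g := shift b g) fun w hw => h (b :: w) (by simp [hw])]

/-- Substitution acts on each letter independently and preserves length, so it commutes with each
rotation and with the number of them. -/
theorem subst_cyc [Fintype Y] (N : X → Y → k) (f : Series k Y) :
    subst N (cyc f) = cyc (subst N f) := by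
  ext u
  have h : subst N (cyc f) u =
      subst N (∑ n ∈ Finset.range u.length, (⟨fun w => f (w.rotate n)⟩ : Series k Y)) u := by
    refine subst_congr N fun w hw => ?_
    rw [cyc_apply, hw, Series.sum_apply]
    rfl
  rw [h, map_sum, Series.sum_apply, cyc_apply]
  exact Finset.sum_congr rfl fun n _ => subst_rotate N f u n

end Cyc

/-! ### Cyclic parts of series and images of short words -/

namespace Folding

open scoped Classical

variable {k : Type*} [Field k] {P V X Y : Type*} [Fintype V] [Fintype X] [Fintype Y]
    {QX : Quiv P X} {QY : Quiv V Y} {D : Folding k QX QY}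

/-- The part of a multiple of a series consisting of the cyclic paths at the vertices of an
orbit. -/
def diag (D : Folding k QX QY) (p : P) (f : Series k Y) (i j : V) : Series k Y :=
  ⟨fun w => if i = j ∧ D.mem p i ∧ QY.IsPath i w j then D.size p * f w else 0⟩

theorem diag_apply (p : P) (f : Series k Y) (i j : V) (w : List Y) : D.diag p f i j w =
    if i = j ∧ D.mem p i ∧ QY.IsPath i w j then D.size p * f w else 0 := rfl

theorem isFolded_diag {f : Series k Y} (hf : ∀ w, f (w.map D.onE) = f w) (p : P) :
    D.IsFolded p p (D.diag p f) := by
  have key : ∀ i j w, D.diag p f i j w ≠ 0 → i = j ∧ D.mem p i ∧ QY.IsPath i w j := by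
    intro i j w h
    by_contra h'
    exact h (if_neg h')
  refine ⟨fun i j w h => (key i j w h).2.2, fun i j w h => ?_, fun i j w => ?_⟩
  · obtain ⟨rfl, h, -⟩ := key i j w h
    exact ⟨h, h⟩
  · rw [D.sg_mul_self, one_mul, diag_apply, diag_apply, hf]
    simp only [onV_inj, mem_onV, isPath_onE]

/-- The factor `size p` put into `diag` cancels the one in `unfold`. Hence the coefficient comes
from one substitution regardless of the base vertex. A nonempty cycle has its base vertex at the
target of its first letter, which collapses the double sum of entries. -/
theorem unfold_diag {f : Series k Y} (hf : ∀ w, f w ≠ 0 → QY.IsCycle w) (p : P) (u : List X) :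
    D.unfold p p (D.diag p f) u = if QX.IsPath p u p then subst D.N f u else 0 := by
  have h0 : f [] = 0 := by
    by_contra h
    exact (hf _ h).1 rfl
  rw [unfold_apply]
  split_ifs with hu
  swap
  · rfl
  rw [inv_mul_eq_iff_eq_mul₀ (D.size_ne_zero p)]
  cases u with
  | nil => simp [Series.sum_apply, diag_apply, h0]
  | cons β u =>
    rw [subst_cons, subst_cons, Finset.mul_sum]
    refine Finset.sum_congr rfl fun b _ => ?_
    by_cases hN : D.N β b = 0
    · simp [hN]
    have hb := (D.N_ne _ _ hN).1
    rw [hu.1] at hb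
    have : shift b (∑ i, ∑ j, D.diag p f i j) = D.size p • shift b f := by
      ext w
      simp only [shift_apply, Series.sum_apply, diag_apply, Series.smul_apply]
      rw [Finset.sum_eq_single (QY.t b), Finset.sum_eq_single (QY.t b)]
      · by_cases hw : f (b :: w) = 0
        · simp [hw]
        · obtain ⟨-, i, hi⟩ := hf _ hw
          have hbi : QY.t b = i := hi.1
          rw [if_pos ⟨rfl, hb, hbi ▸ hi⟩]
      · intro j _ hj
        exact if_neg fun h => hj h.1.symm
      · simp
      · intro i _ hi
        refine Finset.sum_eq_zero fun j _ => if_neg fun h => hi h.2.2.1.symm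
      · simp
    rw [this, map_smul, Series.smul_apply]
    ring

theorem fold_word_nil (p : P) (i j : V) : D.fold p i j (word []) =
    if i = j ∧ D.mem p i then word [] else 0 := by
  ext w
  cases w with
  | nil =>
    rw [fold_nil]
    split_ifs <;> rfl
  | cons b w =>
    have h1 : ∀ β : X, shift β (word [] : Series k X) = 0 := shift_one
    rw [fold_cons]
    simp only [h1, map_zero, Series.zero_apply, mul_zero, Finset.sum_const_zero, ite_self]
    split_ifs
    · rw [word_apply, if_neg (by simp)]
    · rfl

theorem fold_word_cons (p : P) (i j : V) (x : X) (u : List X) : D.fold p i j (word (x :: u)) =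
    ∑ b, if QY.t b = i then
      D.M x b • (word [b] * D.fold (QX.s x) (QY.s b) j (word u)) else 0 := by
  ext w
  rw [Series.sum_apply]
  have hl : ∀ (c : Prop) (f : Series k Y), (if c then f else 0) w = if c then f w else 0 := by
    intros; split_ifs <;> rfl
  simp only [hl, Series.smul_apply]
  cases w with
  | nil => simp [fold_nil, word_apply]
  | cons b w =>
    simp only [word_singleton_mul_cons]
    rw [Finset.sum_eq_single b, fold_cons, Finset.sum_eq_single x]
    · rw [if_pos rfl]
      congr 4
      ext v
      simp [word_apply]
    · intro β _ hβ
      have : shift β (word (x :: u) : Series k X) = 0 := by ext v; simp [word_apply, hβ]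
      rw [this]; simp
    · simp
    · intro b' _ hb'
      simp [hb'.symm]
    · simp

theorem fold_word_pair (p : P) (i l : V) (x y : X) : D.fold p i l (word [x, y]) =
    ∑ b, ∑ b', if QY.t b = i ∧ QY.t b' = QY.s b ∧ QY.s b' = l then
      (D.M x b * D.M y b') • word [b, b'] else 0 := by
  rw [fold_word_cons]
  refine Finset.sum_congr rfl fun b _ => ?_
  split_ifs with hb
  · rw [fold_word_cons, Finset.mul_sum, Finset.smul_sum]
    refine Finset.sum_congr rfl fun b' _ => ?_
    rw [fold_word_nil]
    by_cases hM : D.M y b' = 0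
    · simp [hM]
    · have h1 : (QY.s b' = l ∧ D.mem (QX.s y) (QY.s b')) ↔ QY.s b' = l :=
        and_iff_left (D.M_ne _ _ hM).2
      simp only [h1, hb, true_and]
      by_cases h2 : QY.t b' = QY.s b <;> by_cases h3 : QY.s b' = l
      · simp only [h2, h3, if_true, true_and, mul_smul_comm, word_mul_word, smul_smul]
        simp
      · simp [h3]
      · simp [h2]
      · simp [h2]
  · simp [hb]

end Folding
-- The potential S_G and its cyclic derivatives
theorem gen_inv : gen⁻¹ = gen := by decide

theorem shift_inl_gEmb {k V E : Type*} [CommRing k] (f : Series k E) (a : E) :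
    shift (.inl a) (gEmb f : Series k (GArrow V E)) = gEmb (shift a f) := by
  ext w
  by_cases hw : ∃ u : List E, w = u.map Sum.inl
  · obtain ⟨u, rfl⟩ := hw
    rw [shift_apply, ← List.map_cons, gEmb_map, gEmb_map, shift_apply]
  · have h1 : (gEmb (shift a f) : Series k (GArrow V E)) w = 0 := by
      by_contra h
      obtain ⟨u, hu, -⟩ := exists_of_gEmb_ne h
      exact hw ⟨u, hu⟩
    rw [h1, shift_apply]
    by_contra h
    obtain ⟨u, hu, -⟩ := exists_of_gEmb_ne h
    cases u with
    | nil => simp at hu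
    | cons b u => exact hw ⟨u, (List.cons.inj hu).2⟩

theorem gEmb_inr_cons {k V E : Type*} [CommRing k] (f : Series k E) (a : E ⊕ V)
    (w : List (GArrow V E)) : (gEmb f : Series k (GArrow V E)) (.inr a :: w) = 0 := by
  by_contra h
  obtain ⟨u, hu, -⟩ := exists_of_gEmb_ne h
  cases u with
  | nil => simp at hu
  | cons b u => simp at hu

theorem gEmb_ne_isCycle {k V E : Type*} [CommRing k] {Q : Quiv V E} {f : Series k E}
    (hf : ∀ w, f w ≠ 0 → Q.IsCycle w) {w : List (GArrow V E)}
    (h : (gEmb f : Series k (GArrow V E)) w ≠ 0) : Q.bar.IsCycle w := by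
  obtain ⟨u, rfl, hu⟩ := exists_of_gEmb_ne h
  obtain ⟨h0, i, hi⟩ := hf u hu
  exact ⟨by simpa using h0, i, (isPath_bar_map Q i i u).2 hi⟩

theorem cyc_ne_isCycle {k V E : Type*} [CommRing k] {Q : Quiv V E} {f : Series k E}
    (hf : ∀ w, f w ≠ 0 → Q.IsCycle w) {w : List E} (h : cyc f w ≠ 0) : Q.IsCycle w := by
  rw [cyc_apply] at h
  obtain ⟨n, -, hn⟩ := Finset.exists_ne_zero_of_sum_ne_zero h
  exact isCycle_rotate n (hf _ hn)

theorem isCycle_rotate_iff {V E : Type*} {Q : Quiv V E} (w : List E) (n : ℕ) :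
    Q.IsCycle (w.rotate n) ↔ Q.IsCycle w := by
  refine ⟨isCycle_rotate n, fun h => ?_⟩
  obtain ⟨m, hm⟩ : (w.rotate n).IsRotated w := List.IsRotated.symm ⟨n, rfl⟩
  exact isCycle_rotate m (by rwa [hm])

namespace Quiv.Action

variable {k : Type*} [Field k] {V E : Type*} {Q : Quiv V E} (σ : Q.Action C2)

theorem gEmb_onBar (g : C2) {f f' : Series k E} (hf : ∀ w, f (w.map (σ.onE g)) = f' w)
    (w : List (GArrow V E)) : gEmb f (w.map (σ.onBar g)) = gEmb f' w := by
  by_cases hw : ∃ u : List E, w = u.map Sum.inl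
  · obtain ⟨u, rfl⟩ := hw
    have : (u.map Sum.inl).map (σ.onBar g) = (u.map (σ.onE g)).map Sum.inl := by
      rw [List.map_map, List.map_map]; rfl
    rw [this, gEmb_map, gEmb_map, hf]
  · have h0 : ∀ (f : Series k E) (v : List (GArrow V E)),
        (¬ ∃ u : List E, v = u.map Sum.inl) → gEmb f v = 0 := by
      intro f v hv
      by_contra h
      obtain ⟨u, hu, -⟩ := exists_of_gEmb_ne h
      exact hv ⟨u, hu⟩
    rw [h0 f' w hw, h0]
    rintro ⟨u, hu⟩
    refine hw ⟨u.map (σ.onE g⁻¹), ?_⟩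
    have h1 : (w.map (σ.onBar g)).map (σ.onBar g⁻¹) = w := by
      rw [List.map_map]
      convert List.map_id w using 2
      funext a
      rcases a with a | a | i
      · exact congrArg Sum.inl (by rw [map_inv]; exact Equiv.symm_apply_apply _ _)
      · exact congrArg (fun a => Sum.inr (Sum.inl a))
          (by rw [map_inv]; exact Equiv.symm_apply_apply _ _)
      · exact congrArg (fun a => Sum.inr (Sum.inr a))
          (by rw [map_inv]; exact Equiv.symm_apply_apply _ _)
    rw [← h1, hu, List.map_map, List.map_map]
    rfl

theorem mapPotential_apply (g : C2) (S : Potential k Q) (w : List E) :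
    (σ.mapPotential g S).series w = S.series (w.map (σ.onE g⁻¹)) := rfl

/-- The average of a potential over the group. -/
def avg (S : Potential k Q) : Series k E :=
  (2⁻¹ : k) • (S.series + (σ.mapPotential gen S).series)

theorem map_onE_onE (w : List E) : (w.map (σ.onE gen)).map (σ.onE gen) = w := by
  rw [List.map_map]
  convert List.map_id w using 2
  exact funext σ.onE_onE

theorem avg_onE (S : Potential k Q) (w : List E) :
    σ.avg S (w.map (σ.onE gen)) = σ.avg S w := by
  rw [avg, Series.smul_apply, Series.smul_apply, Series.add_apply, Series.add_apply,
    mapPotential_apply, mapPotential_apply, gen_inv, map_onE_onE, add_comm]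

theorem avg_isCycle (S : Potential k Q) (w : List E) (h : σ.avg S w ≠ 0) : Q.IsCycle w := by
  by_cases h1 : S.series w = 0
  · refine (σ.mapPotential gen S).isCycle w fun h2 => h ?_
    rw [avg, Series.smul_apply, Series.add_apply, h1, h2, add_zero, mul_zero]
  · exact S.isCycle w h1

theorem cyc_avg (hk : (2 : k) ≠ 0) {S : Potential k Q}
    (hS : S.CyclicEquiv (σ.mapPotential gen S)) : cyc (σ.avg S) = cyc S.series := by
  rw [avg, map_smul, map_add, ← hS.cyc_eq, ← two_smul k, smul_smul, inv_mul_cancel₀ hk, one_smul]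

/-- Although S is invariant only up to cyclic equivalence, its rotation sum is strictly invariant;
the differential depends on nothing else. -/
theorem cyc_onE {S : Potential k Q} (hS : S.CyclicEquiv (σ.mapPotential gen S)) (w : List E) :
    cyc S.series (w.map (σ.onE gen)) = cyc S.series w := by
  conv_rhs => rw [hS.cyc_eq]
  rw [cyc_apply, cyc_apply, List.length_map]
  refine Finset.sum_congr rfl fun n _ => ?_
  rw [mapPotential_apply, gen_inv, List.map_rotate]

namespace Choice

variable {σ} (c : σ.Choice)

open Classical in
/-- The series on `Q_G` corresponding to an invariant series of cyclic paths on `Q`. -/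
def lift [Fintype E] (f : Series k E) : Series k c.Arrow :=
  ⟨fun u => if c.quiv.IsCycle u then
    subst (fun β b => c.size k (c.quiv.s β) * c.coef k β b) f u else 0⟩

variable {c}

open Classical in
theorem lift_apply [Fintype E] (f : Series k E) (u : List c.Arrow) :
    c.lift f u = if c.quiv.IsCycle u then
      subst (fun β b => c.size k (c.quiv.s β) * c.coef k β b) f u else 0 := rfl

theorem lift_isCycle [Fintype E] (f : Series k E) (u : List c.Arrow) (h : c.lift f u ≠ 0) :
    c.quiv.IsCycle u := by
  by_contra h'
  exact h (if_neg h')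

/-- Rotations commute with the substitution and preserve the property of being a cycle, so they
commute with the restriction to cycles. -/
theorem cyc_lift [Fintype E] (f : Series k E) : cyc (c.lift f) = c.lift (cyc f) := by
  ext u
  rw [lift_apply, subst_cyc, cyc_apply]
  split_ifs with hu
  · rw [cyc_apply]
    exact Finset.sum_congr rfl fun n _ => if_pos ((isCycle_rotate_iff u n).2 hu)
  · exact Finset.sum_eq_zero fun n _ => if_neg fun h => hu ((isCycle_rotate_iff u n).1 h)

/-- `barN` relates letters of degree 0 only to letters of degree 0, so the substitution may be
carried out before passing to the bar quivers. -/
theorem subst_gEmb [Fintype V] [Fintype E] (f : Series k E) :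
    subst (c.barN k) (gEmb f) =
      gEmb (subst (fun β b => c.size k (c.quiv.s β) * c.coef k β b) f) := by
  ext u
  induction u generalizing f with
  | nil =>
    have h1 := gEmb_map (V := V) f []
    have h2 := gEmb_map (V := c.Vertex)
      (subst (fun β b => c.size k (c.quiv.s β) * c.coef k β b) f) []
    exact h1.trans h2.symm
  | cons β u ih =>
    have h0 : ∀ b : E ⊕ V, shift (.inr b) (gEmb f : Series k (GArrow V E)) = 0 := by
      intro b
      ext w
      exact gEmb_inr_cons f b w
    rw [subst_cons, Fintype.sum_sum_type]
    simp only [h0, map_zero, Series.zero_apply, mul_zero, Finset.sum_const_zero, add_zero,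
      shift_inl_gEmb, ih]
    rcases β with β | β
    · have h1 : shift β (subst (fun β b => c.size k (c.quiv.s β) * c.coef k β b) f) =
          ∑ b, (c.size k (c.quiv.s β) * c.coef k β b) •
            subst (fun β b => c.size k (c.quiv.s β) * c.coef k β b) (shift b f) := by
        ext u
        rw [shift_apply, subst_cons, Series.sum_apply]
        rfl
      rw [← shift_apply (Sum.inl β) _ u, shift_inl_gEmb, h1]
      have h2 := map_sum (gEmbₗ (k := k) (V := c.Vertex)) (fun b =>
        (c.size k (c.quiv.s β) * c.coef k β b) •
            subst (fun β b => c.size k (c.quiv.s β) * c.coef k β b) (shift b f)) Finset.univ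
      refine Eq.trans ?_ (DFunLike.congr_fun h2 u).symm
      rw [Series.sum_apply]
      refine Finset.sum_congr rfl fun b _ => ?_
      rw [map_smul]
      rfl
    · rw [gEmb_inr_cons]
      refine Finset.sum_eq_zero fun b _ => ?_
      rcases β with β | β <;> exact zero_mul _

/-- The part of a series consisting of the cyclic paths at a vertex. -/
def cyclesAt {k P X : Type*} [CommRing k] (Q : Quiv P X) (p : P) (f : Series k X) : Series k X :=
  ⟨fun u => open Classical in if Q.IsPath p u p then f u else 0⟩

open Classical in
theorem cyclesAt_apply {k P X : Type*} [CommRing k] (Q : Quiv P X) (p : P) (f : Series k X)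
    (u : List X) : cyclesAt Q p f u = if Q.IsPath p u p then f u else 0 := rfl

theorem supported_cyclesAt {k P X : Type*} [CommRing k] (Q : Quiv P X) (p : P) (f : Series k X) :
    Supported Q p p (cyclesAt Q p f) := by
  intro u h
  by_contra h'
  exact h (if_neg h')

variable [Fintype V] [Fintype E] (hfix : σ.FixesArrows) (hk : (2 : k) ≠ 0)

/-- By `unfold_diag` the cycles at p in `lift f` are the unfolding of the weighted diagonal family
of f; folding undoes this. It is used for the average of S, to evaluate S_G, and for cyc S, to
differentiate S_G. -/
theorem fold_lift {f : Series k E} (hf : ∀ w, f w ≠ 0 → Q.IsCycle w)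
    (hσ : ∀ w, f (w.map (σ.onE gen)) = f w) (p : c.Vertex) (i j : V) :
    (c.folding hfix hk).fold p i j (cyclesAt c.quiv.bar p (gEmb (c.lift f))) =
      (c.folding hfix hk).diag p (gEmb f) i j := by
  have h1 := (c.folding hfix hk).fold_unfold
    (Folding.isFolded_diag (D := c.folding hfix hk) (f := gEmb f) (gEmb_onBar σ gen hσ) p) i j
  rw [← h1]
  congr 1
  ext u
  rw [Folding.unfold_diag fun w => gEmb_ne_isCycle hf, cyclesAt_apply]
  by_cases hu : c.quiv.bar.IsPath p u p
  swap
  · rw [if_neg hu, if_neg hu]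
  rw [if_pos hu, if_pos hu]
  change _ = subst (c.barN k) (gEmb f) u
  rw [subst_gEmb]
  by_cases hw : ∃ v : List c.Arrow, u = v.map Sum.inl
  · obtain ⟨v, rfl⟩ := hw
    rw [gEmb_map, gEmb_map, lift_apply]
    rw [isPath_bar_map] at hu
    cases v with
    | nil =>
      -- Cycles have positive length, so f has no constant term and the excluded empty word loses
      -- nothing.
      rw [if_neg fun h => h.1 rfl, subst_nil]
      by_contra h
      exact (hf _ (Ne.symm h)).1 rfl
    | cons b v => rw [if_pos ⟨by simp, p, hu⟩]
  · have h0 : ∀ f : Series k c.Arrow, (gEmb f : Series k (GArrow c.Vertex c.Arrow)) u = 0 := by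
      intro f
      by_contra h
      obtain ⟨v, hv, -⟩ := exists_of_gEmb_ne h
      exact hw ⟨v, hv⟩
    rw [h0, h0]

/-- The potential `S_G`. -/
def potential (c : σ.Choice) (S : Potential k Q) : Potential k c.quiv where
  series := c.lift (σ.avg S)
  isCycle := lift_isCycle _

/-- ∂_β S_G is what follows β in cyc S_G, which is the lift of cyc S. By `sum_N_mul_fold` its fold
is a sum of N(β, b) times what follows b in the weighted cyc S. N supplies the length of the source
orbit and the weight that of the target orbit: together they give exactly the coefficient of the
reversed arrow in `barM`. -/
theorem fold_gDelta_bar [DecidableEq V] {S : Potential k Q}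
    (hS : S.CyclicEquiv (σ.mapPotential gen S)) (β : c.Arrow) (i l : V)
    (hi : c.mem (c.quiv.s β) i) (hl : c.mem (c.quiv.t β) l) :
    (c.folding hfix hk).fold (c.quiv.s β) i l (gEmb ((c.potential S).cyclicDeriv β)) =
      ∑ b : E, (c.size k (c.quiv.s β) * c.size k (c.quiv.t β) * c.coef k β b) •
        if Q.s b = i ∧ Q.t b = l then gEmb (S.cyclicDeriv b) else 0 := by
  have hcyc : ∀ w, cyc S.series w ≠ 0 → Q.IsCycle w := fun w => cyc_ne_isCycle S.isCycle
  have hσ := σ.cyc_onE hS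
  have h1 : gEmb ((c.potential S).cyclicDeriv β) =
      shift (.inl β) (cyclesAt c.quiv.bar (c.quiv.t β) (gEmb (c.lift (cyc S.series)))) := by
    have h2 : cyc (c.potential S).series = c.lift (cyc S.series) := by
      rw [← cyc_avg σ hk hS, ← cyc_lift]; rfl
    rw [Potential.cyclicDeriv_eq, h2, ← shift_inl_gEmb]
    ext u
    rw [shift_apply, shift_apply, cyclesAt_apply]
    split_ifs with h
    · rfl
    · by_contra h0
      obtain ⟨-, p, hp⟩ := gEmb_ne_isCycle (lift_isCycle _) h0
      have : c.quiv.t β = p := hp.1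
      exact h (this ▸ hp)
  rw [h1]
  ext w
  refine (Folding.sum_N_mul_fold (D := c.folding hfix hk) (supported_cyclesAt _ _ _)
    (β := .inl β) rfl hi l w).symm.trans ?_
  simp only [fold_lift hfix hk hcyc hσ]
  rw [Fintype.sum_sum_type, Series.sum_apply]
  have h0 : ∀ b : E ⊕ V, (c.folding hfix hk).N (.inl β) (.inr b) = 0 := fun b => rfl
  simp only [h0, zero_mul, ite_self, Finset.sum_const_zero, add_zero]
  refine Finset.sum_congr rfl fun b _ => ?_
  change (if Q.s b = i then c.size k (c.quiv.s β) * c.coef k β b *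
    (c.folding hfix hk).diag (c.quiv.t β) (gEmb (cyc S.series)) (Q.t b) l (.inl b :: w) else 0) = _
  rw [Series.smul_apply]
  by_cases hs : Q.s b = i
  swap
  · simp [hs]
  rw [if_pos hs, Folding.diag_apply]
  by_cases ht : Q.t b = l
  swap
  · simp [ht]
  rw [if_pos (show Q.s b = i ∧ Q.t b = l from ⟨hs, ht⟩), Potential.cyclicDeriv_eq,
    ← shift_inl_gEmb, shift_apply]
  by_cases hw : (gEmb (cyc S.series) : Series k (GArrow V E)) (.inl b :: w) = 0
  · rw [hw]; simp
  · obtain ⟨-, j, hj⟩ := gEmb_ne_isCycle hcyc hw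
    have hbj : Q.t b = j := hj.1
    rw [if_pos ⟨ht, ht ▸ hl, ht ▸ hbj ▸ hj⟩]
    change _ * (c.size k (c.quiv.t β) * _) = _
    ring

end Choice
end Quiv.Action
end QP

/-! ### Matching the Ginzburg differentials on generators -/

namespace QP
open Series
namespace Quiv.Action.Choice

variable {k : Type*} [Field k] {V E : Type*} {Q : Quiv V E} {σ : Q.Action C2} {c : σ.Choice}
/-- The common computation for both terms of the differential of a loop. -/
theorem sum_ends_word [DecidableEq V] [Fintype E] {x y : E → V} (hxy : IsEnds x y Q)
    (hfix : σ.FixesArrows)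
    (hk : (2 : k) ≠ 0) {Z : Type*} (W : E → E → Series k Z) {p : c.Vertex} {i l : V}
    (hi : c.mem p i) (hl : c.mem p l) :
    (∑ β : c.Arrow, if c.vertex (y β.1.1) β.1.2 = p then
      ∑ b : E, ∑ b' : E, if y b = i ∧ x b' = x b ∧ y b' = l then
        (c.size k (c.vertex (y β.1.1) β.1.2) * (c.coef k β b * c.coef k β b' *
          (c.size k (c.vertex (x β.1.1) β.1.2) / c.weight k β))) • W b b' else 0 else 0) =
      if i = l then c.size k p • ∑ b : E, (if y b = i then W b b else 0) else 0 := by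
  classical
  -- For a fixed pair (b, b') the sum over β is the first orthogonality relation, which leaves only
  -- the diagonal terms b = b'.
  have h1 : ∀ b b', (∑ β : c.Arrow, if c.vertex (y β.1.1) β.1.2 = p then
      if y b = i ∧ x b' = x b ∧ y b' = l then
        (c.size k (c.vertex (y β.1.1) β.1.2) * (c.coef k β b * c.coef k β b' *
          (c.size k (c.vertex (x β.1.1) β.1.2) / c.weight k β))) • W b b' else 0 else 0) =
      if i = l ∧ y b = i ∧ b' = b then c.size k p • W b b else 0 := by
    intro b b'
    by_cases h : y b = i ∧ x b' = x b ∧ y b' = l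
    · obtain ⟨rfl, hx, rfl⟩ := h
      have := hxy.sum_coef_mul_coef (k := k) hfix hk hi hl hx.symm
      have h2 : ∀ β : c.Arrow, (if c.vertex (y β.1.1) β.1.2 = p then
          if y b = y b ∧ x b' = x b ∧ y b' = y b' then
            (c.size k (c.vertex (y β.1.1) β.1.2) * (c.coef k β b * c.coef k β b' *
              (c.size k (c.vertex (x β.1.1) β.1.2) / c.weight k β))) • W b b' else 0 else 0) =
          (if c.vertex (y β.1.1) β.1.2 = p then c.coef k β b * c.coef k β b' *
            (c.size k (c.vertex (x β.1.1) β.1.2) / c.weight k β) else 0) •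
            (c.size k p • W b b') := by
        intro β
        split_ifs with h3 h4
        · rw [h3, smul_smul, mul_comm]
        · exact absurd ⟨rfl, hx, rfl⟩ h4
        · rw [zero_smul]
      rw [Finset.sum_congr rfl fun β _ => h2 β, ← Finset.sum_smul, this]
      by_cases hbb : b = b'
      · subst hbb
        rw [if_pos rfl, one_smul, if_pos ⟨rfl, rfl, rfl⟩]
      · rw [if_neg hbb, zero_smul, if_neg fun h => hbb h.2.2.symm]
    · rw [if_neg]
      · simp [h]
      · rintro ⟨rfl, rfl, rfl⟩
        exact h ⟨rfl, rfl, rfl⟩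
  have h2 : ∀ (q : Prop) [Decidable q] (F : E → E → Series k Z),
      (if q then ∑ b, ∑ b', F b b' else 0) = ∑ b, ∑ b', if q then F b b' else 0 := by
    intro q _ F
    split_ifs <;> simp
  simp only [h2]
  rw [Finset.sum_comm]
  have h3 : ∀ b, (∑ β : c.Arrow, ∑ b', if c.vertex (y β.1.1) β.1.2 = p then
      if y b = i ∧ x b' = x b ∧ y b' = l then
        (c.size k (c.vertex (y β.1.1) β.1.2) * (c.coef k β b * c.coef k β b' *
          (c.size k (c.vertex (x β.1.1) β.1.2) / c.weight k β))) • W b b' else 0 else 0) =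
      if i = l ∧ y b = i then c.size k p • W b b else 0 := by
    intro b
    rw [Finset.sum_comm, Finset.sum_congr rfl fun b' _ => h1 b b', Finset.sum_eq_single b]
    · simp
    · intro b' _ hb'
      exact if_neg fun h => hb' h.2.2
    · simp
  rw [Finset.sum_congr rfl fun b _ => h3 b]
  split_ifs with hil
  · rw [Finset.smul_sum]
    refine Finset.sum_congr rfl fun b _ => ?_
    by_cases hb : y b = i <;> simp [hil, hb]
  · simp [hil]

variable [Fintype V] [Fintype E] (hfix : σ.FixesArrows) (hk : (2 : k) ≠ 0)

/-- The scalars of β and of its reverse are regrouped into the shape required by `sum_ends_word`,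
with y the target. -/
theorem fold_word_arrow_bar [DecidableEq V] (β : c.Arrow) (p : c.Vertex) (i l : V) :
    (c.folding hfix hk).fold p i l (word [.inl β, .inr (.inl β)]) =
      ∑ b : E, ∑ b' : E, if Q.t b = i ∧ Q.s b' = Q.s b ∧ Q.t b' = l then
        (c.size k (c.quiv.t β) * (c.coef k β b * c.coef k β b' *
          (c.size k (c.quiv.s β) / c.weight k β))) • word [.inl b, .inr (.inl b')] else 0 := by
  rw [Folding.fold_word_pair, Fintype.sum_sum_type]
  have h1 : ∀ b b', (c.folding hfix hk).M (.inl β) (.inr b) *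
      (c.folding hfix hk).M (.inr (.inl β)) b' = 0 := fun b b' => zero_mul _
  simp only [h1, zero_smul, ite_self, Finset.sum_const_zero, add_zero]
  refine Finset.sum_congr rfl fun b _ => ?_
  rw [Fintype.sum_sum_type, Fintype.sum_sum_type]
  have h2 : ∀ b', (c.folding hfix hk).M (.inl β) (.inl b) *
      (c.folding hfix hk).M (.inr (.inl β)) (.inl b') = 0 := fun b' => mul_zero _
  have h3 : ∀ i, (c.folding hfix hk).M (.inl β) (.inl b) *
      (c.folding hfix hk).M (.inr (.inl β)) (.inr (.inr i)) = 0 := fun b' => mul_zero _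
  simp only [h2, h3, zero_smul, ite_self, Finset.sum_const_zero, add_zero, zero_add]
  refine Finset.sum_congr rfl fun b' _ => ?_
  by_cases h : Q.t b = i ∧ Q.s b' = Q.s b ∧ Q.t b' = l
  swap
  · exact (if_neg h).trans (if_neg h).symm
  refine (if_pos h).trans (Eq.trans ?_ (if_pos h).symm)
  congr 1
  change c.coef k β b / c.weight k β *
    (c.size k (c.quiv.s β) * c.size k (c.quiv.t β) * c.coef k β b') = _
  have := weight_ne_zero hk β
  field_simp

theorem fold_word_bar_arrow [DecidableEq V] (β : c.Arrow) (p : c.Vertex) (i l : V) :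
    (c.folding hfix hk).fold p i l (word [.inr (.inl β), .inl β]) =
      ∑ b : E, ∑ b' : E, if Q.s b = i ∧ Q.t b' = Q.t b ∧ Q.s b' = l then
        (c.size k (c.quiv.s β) * (c.coef k β b * c.coef k β b' *
          (c.size k (c.quiv.t β) / c.weight k β))) • word [.inr (.inl b), .inl b'] else 0 := by
  rw [Folding.fold_word_pair, Fintype.sum_sum_type, Fintype.sum_sum_type]
  have h1 : ∀ b b', (c.folding hfix hk).M (.inr (.inl β)) (.inl b) *
      (c.folding hfix hk).M (.inl β) b' = 0 := fun b b' => zero_mul _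
  have h2 : ∀ b b', (c.folding hfix hk).M (.inr (.inl β)) (.inr (.inr b)) *
      (c.folding hfix hk).M (.inl β) b' = 0 := fun b b' => zero_mul _
  simp only [h1, h2, zero_smul, ite_self, Finset.sum_const_zero, add_zero, zero_add]
  refine Finset.sum_congr rfl fun b _ => ?_
  rw [Fintype.sum_sum_type]
  have h3 : ∀ b', (c.folding hfix hk).M (.inr (.inl β)) (.inr (.inl b)) *
      (c.folding hfix hk).M (.inl β) (.inr b') = 0 := fun b' => mul_zero _
  simp only [h3, zero_smul, ite_self, Finset.sum_const_zero, add_zero]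
  refine Finset.sum_congr rfl fun b' _ => ?_
  by_cases h : Q.s b = i ∧ Q.t b' = Q.t b ∧ Q.s b' = l
  swap
  · exact (if_neg h).trans (if_neg h).symm
  refine (if_pos h).trans (Eq.trans ?_ (if_pos h).symm)
  congr 1
  change c.size k (c.quiv.s β) * c.size k (c.quiv.t β) * c.coef k β b *
    (c.coef k β b' / c.weight k β) = _
  have := weight_ne_zero hk β
  field_simp

/-- The differential of the loop at p has one sum over the arrows ending at p and one over those
starting there. `sum_ends_word`, used with the two orders of the ends, turns each into `size p`
times its counterpart for Q. -/
theorem fold_gDelta_loop [DecidableEq V] (S : Potential k Q) (p : c.Vertex) (i l : V)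
    (hi : c.mem p i) (hl : c.mem p l) :
    (c.folding hfix hk).fold p i l (gDelta c.quiv (c.potential S) (.inr (.inr p))) =
      if i = l then c.size k p • gDelta Q S (.inr (.inr i)) else 0 := by
  rw [gDelta, gDelta, Finset.sum_sub_distrib, Finset.sum_sub_distrib, map_sub, map_sum, map_sum]
  have h1 := sum_ends_word isEnds_s_t hfix hk
    (fun b b' => (word [.inl b, .inr (.inl b')] : Series k (GArrow V E))) hi hl
  have h2 := sum_ends_word isEnds_t_s hfix hk
    (fun b b' => (word [.inr (.inl b), .inl b'] : Series k (GArrow V E))) hi hl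
  simp only [apply_ite ((c.folding hfix hk).fold p i l), map_zero, fold_word_arrow_bar,
    fold_word_bar_arrow]
  refine (congrArg₂ (· - ·) h1 h2).trans ?_
  split_ifs
  · rw [smul_sub]
  · rw [sub_zero]

theorem isFoldedDer [DecidableEq V] {S : Potential k Q}
    (hS : S.CyclicEquiv (σ.mapPotential gen S)) :
    (c.folding hfix hk).IsFoldedDer gdeg gdeg (gDelta c.quiv (c.potential S)) (gDelta Q S) where
  deg_eq := by
    rintro (β | β | p) (b | b | i) h
    all_goals first | rfl | exact absurd rfl h
  supported := (isPathDifferential_gDelta c.quiv (c.potential S)).path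
  fold_eq := by
    classical
    rintro (β | β | p) i l hi hl
    · change (c.folding hfix hk).fold _ i l 0 = _
      rw [map_zero]
      symm
      refine Finset.sum_eq_zero ?_
      rintro (b | b) -
      · rw [show gDelta Q S (.inl b) = 0 from rfl, ite_self, smul_zero]
      · exact zero_smul _ _
    · refine (fold_gDelta_bar hfix hk hS β i l hi hl).trans ?_
      rw [Fintype.sum_sum_type, Fintype.sum_sum_type]
      have h1 : ∀ b, (c.folding hfix hk).M (.inr (.inl β)) (.inl b) = 0 := fun b => rfl
      have h2 : ∀ i, (c.folding hfix hk).M (.inr (.inl β)) (.inr (.inr i)) = 0 := fun b => rfl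
      simp only [h1, h2, zero_smul, Finset.sum_const_zero, add_zero, zero_add]
      refine Finset.sum_congr rfl fun b _ => ?_
      refine congrArg _ ?_
      by_cases h : Q.s b = i ∧ Q.t b = l
      · exact (if_pos h).trans (if_pos h).symm
      · exact (if_neg h).trans (if_neg h).symm
    · refine (fold_gDelta_loop hfix hk S p i l hi hl).trans ?_
      rw [Fintype.sum_sum_type, Fintype.sum_sum_type]
      have h1 : ∀ b, (c.folding hfix hk).M (.inr (.inr p)) (.inl b) = 0 := fun b => rfl
      have h2 : ∀ b, (c.folding hfix hk).M (.inr (.inr p)) (.inr (.inl b)) = 0 := fun b => rfl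
      simp only [h1, h2, zero_smul, Finset.sum_const_zero, zero_add]
      rw [Finset.sum_eq_single i]
      · have h3 : (c.folding hfix hk).M (.inr (.inr p)) (.inr (.inr i)) = c.size k p := if_pos hi
        rw [h3]
        split_ifs with h4 h5 h5
        · rfl
        · exact absurd ⟨rfl, h4⟩ h5
        · exact absurd h5.2 h4
        · rw [smul_zero]
      · intro j _ hj
        rw [if_neg fun h => hj h.1, smul_zero]
      · simp

end Quiv.Action.Choice
-- The action of G on the complete Ginzburg dg algebra
namespace Series

variable {k X Y : Type*} [CommRing k]

/-- Pull back the coefficients of a series along a map of letters. -/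
def comap (e : X → Y) : Series k Y →ₗ[k] Series k X where
  toFun f := ⟨fun w => f (w.map e)⟩
  map_add' _ _ := rfl
  map_smul' _ _ := rfl

@[simp] theorem comap_apply (e : X → Y) (f : Series k Y) (w : List X) :
    comap e f w = f (w.map e) := rfl

theorem comap_mul (e : X → Y) (f g : Series k Y) : comap e (f * g) = comap e f * comap e g := by
  ext w
  rw [comap_apply, mul_apply, mul_apply, List.length_map]
  refine Finset.sum_congr rfl fun n _ => ?_
  rw [comap_apply, comap_apply, List.map_take, List.map_drop]

theorem comap_one (e : X → Y) : comap e (1 : Series k Y) = 1 := by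
  ext w
  rw [comap_apply, one_def, one_def, word_apply, word_apply]
  exact if_congr List.map_eq_nil_iff rfl rfl

theorem comap_word {e : X → Y} (he : Function.Injective e) (v : List X) :
    comap e (word (v.map e) : Series k Y) = word v := by
  classical
  ext w
  rw [comap_apply, word_apply, word_apply]
  exact if_congr (List.map_injective_iff.2 he).eq_iff rfl rfl

theorem shift_comap (e : X → Y) (f : Series k Y) (b : X) :
    shift b (comap e f) = comap e (shift (e b) f) := rfl

/-- A degree-preserving permutation of the letters compatible with δ respects both terms of the
recursion `der_cons`. -/
theorem der_comap [Fintype X] {deg : X → ℤ} {δ : X → Series k X} (e : Equiv.Perm X)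
    (hdeg : ∀ a, deg (e a) = deg a) (hδ : ∀ a, comap e (δ (e a)) = δ a) (f : Series k X) :
    der deg δ (comap e f) = comap e (der deg δ f) := by
  have hhead : ∀ f, headSubst δ (comap e f) = comap e (headSubst δ f) := by
    intro f
    change ∑ a, δ a * shift a (comap e f) = comap e (∑ a, δ a * shift a f)
    rw [map_sum]
    refine Eq.trans (Finset.sum_congr rfl fun a _ => ?_)
      (Equiv.sum_comp e fun a => comap e (δ a * shift a f))
    rw [comap_mul, hδ, shift_comap]
  ext w
  induction w generalizing f with
  | nil => rw [comap_apply, List.map_nil, der_nil, der_nil, hhead]; rfl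
  | cons b w ih =>
    rw [comap_apply, List.map_cons, der_cons, der_cons, hhead, shift_comap, ih, hdeg]; rfl

end Series

section PathAction

variable {k : Type*} [CommRing k] {V X : Type*} {Q : Quiv V X} {deg : X → ℤ} {δ : X → Series k X}
  {G : Type*} [Group G] (τ : Q.Action G)

theorem Quiv.Action.wdeg_map (hdeg : ∀ g a, deg (τ.onE g a) = deg a) (g : G) (w : List X) :
    wdeg deg (w.map (τ.onE g)) = wdeg deg w := by
  induction w with
  | nil => rfl
  | cons a w ih => rw [List.map_cons, wdeg_cons, wdeg_cons, ih, hdeg]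

theorem Quiv.Action.isPath_of_map (g : G) {i j : V} {w : List X}
    (h : Q.IsPath (τ.onV g i) (w.map (τ.onE g)) (τ.onV g j)) : Q.IsPath i w j := by
  have := τ.isPath_map g⁻¹ h
  rwa [List.map_map, ← Equiv.Perm.coe_mul, ← map_mul, ← Equiv.Perm.mul_apply,
    ← Equiv.Perm.mul_apply, ← map_mul, inv_mul_cancel, map_one, map_one, Equiv.Perm.coe_one,
    Equiv.Perm.coe_one, List.map_id] at this

theorem Quiv.Action.map_inv_map (g : G) (w : List X) :
    (w.map (τ.onE g)).map (τ.onE g⁻¹) = w := by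
  rw [List.map_map, ← Equiv.Perm.coe_mul, ← map_mul, inv_mul_cancel, map_one, Equiv.Perm.coe_one,
    List.map_id]

theorem Quiv.Action.onV_inv_onV (g : G) (i : V) : τ.onV g⁻¹ (τ.onV g i) = i := by
  rw [← Equiv.Perm.mul_apply, ← map_mul, inv_mul_cancel, map_one]; rfl

variable [Fintype V] [DecidableEq V] 

/-- `Series.comap` as a morphism of algebras. -/
def Series.comapAlg {X Y : Type*} (e : X → Y) : Series k Y →ₐ[k] Series k X :=
  AlgHom.ofLinearMap (comap e) (comap_one e) (comap_mul e)

/-- The action of a group element on the complete path algebra. -/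
def pathActHom (hdeg : ∀ g a, deg (τ.onE g a) = deg a) (g : G) :
    completePath k Q deg →ₐ[k] completePath k Q deg :=
  -- Pulling coefficients back along g⁻¹ moves a path w to g(w).
  ((((comapAlg (τ.onE g⁻¹)).mapMatrix).comp
    (Matrix.reindexAlgEquiv k (Series k X) (τ.onV g⁻¹).symm).toAlgHom).comp
      (completePath k Q deg).val).codRestrict _ fun f => by
    obtain ⟨f, hf, F, hF⟩ := f
    refine ⟨fun i j w h => τ.isPath_of_map g⁻¹ (hf _ _ _ h), F, fun i j w h => ?_⟩
    rw [← τ.wdeg_map hdeg g⁻¹]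
    exact hF _ _ _ h

theorem pathActHom_apply (hdeg : ∀ g a, deg (τ.onE g a) = deg a) (g : G)
    (f : completePath k Q deg) (i j : V) (w : List X) :
    (pathActHom τ hdeg g f).1 i j w =
      f.1 (τ.onV g⁻¹ i) (τ.onV g⁻¹ j) (w.map (τ.onE g⁻¹)) := rfl

theorem completePath_ext {f f' : completePath k Q deg}
    (h : ∀ i j w, f.1 i j w = f'.1 i j w) : f = f' :=
  Subtype.ext (funext fun i => funext fun j => Series.ext fun w => h i j w)

theorem pathActHom_mul (hdeg : ∀ g a, deg (τ.onE g a) = deg a) (g h : G)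
    (f : completePath k Q deg) :
    pathActHom τ hdeg (g * h) f = pathActHom τ hdeg g (pathActHom τ hdeg h f) := by
  refine completePath_ext fun i j w => ?_
  simp only [pathActHom_apply, mul_inv_rev, map_mul, Equiv.Perm.coe_mul, List.map_map,
    Function.comp_apply]

theorem pathActHom_one (hdeg : ∀ g a, deg (τ.onE g a) = deg a) (f : completePath k Q deg) :
    pathActHom τ hdeg 1 f = f := by
  refine completePath_ext fun i j w => ?_
  simp only [pathActHom_apply, inv_one, map_one, Equiv.Perm.coe_one, List.map_id, id]

variable [Fintype X]

/-- The action on a complete path dg algebra induced by an action on the graded quiver preserving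
the differential of the arrows. -/
def pathAction (hp : IsPathDifferential Q deg δ) (hdeg : ∀ g a, deg (τ.onE g a) = deg a)
    (hδ : ∀ g a, comap (τ.onE g) (δ (τ.onE g a)) = δ a) : DGAction G (pathDG hp) where
  hom :=
    { toFun := fun g => AlgEquiv.ofAlgHom (pathActHom τ hdeg g) (pathActHom τ hdeg g⁻¹)
        (AlgHom.ext fun f => (pathActHom_mul τ hdeg g g⁻¹ f).symm.trans
          ((mul_inv_cancel g).symm ▸ pathActHom_one τ hdeg f))
        (AlgHom.ext fun f => (pathActHom_mul τ hdeg g⁻¹ g f).symm.trans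
          ((inv_mul_cancel g).symm ▸ pathActHom_one τ hdeg f))
      map_one' := AlgEquiv.ext (pathActHom_one τ hdeg)
      map_mul' := fun g h => AlgEquiv.ext (pathActHom_mul τ hdeg g h) }
  map_gr g n f hf i j w h := by
    rw [← τ.wdeg_map hdeg g⁻¹]
    exact hf _ _ _ h
  map_d g f := by
    refine Subtype.ext (funext fun i => funext fun j => ?_)
    exact (der_comap (τ.onE g⁻¹) (hdeg g⁻¹) (hδ g⁻¹) _).symm

end PathAction

namespace Quiv.Action

variable {k : Type*} [Field k] {V E : Type*} {Q : Quiv V E}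

/-- The action on the bar quiver. -/
def bar {G : Type*} [Group G] (σ : Q.Action G) : Q.bar.Action G where
  onV := σ.onV
  onE := (Equiv.Perm.sumCongrHom E (E ⊕ V)).comp
    (σ.onE.prod ((Equiv.Perm.sumCongrHom E V).comp (σ.onE.prod σ.onV)))
  s_map g a := by
    rcases a with a | a | i
    · exact σ.s_map g a
    · exact σ.t_map g a
    · rfl
  t_map g a := by
    rcases a with a | a | i
    · exact σ.t_map g a
    · exact σ.s_map g a
    · rfl

theorem bar_onE {G : Type*} [Group G] (σ : Q.Action G) (g : G) :
    ⇑(σ.bar.onE g) = σ.onBar g := by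
  funext a
  rcases a with a | a | i <;> rfl

theorem gdeg_onE {G : Type*} [Group G] (σ : Q.Action G) (g : G) (a : GArrow V E) :
    gdeg (σ.bar.onE g a) = gdeg a := by
  rcases a with a | a | i <;> rfl

variable (σ : Q.Action C2) {S : Potential k Q}

/-- On reversed arrows this is the invariance of cyc S, of which cyclic derivatives are shifts. On
loops it is a reindexing of the sum over arrows. -/
theorem comap_gDelta [DecidableEq V] [Fintype E] (hS : S.CyclicEquiv (σ.mapPotential gen S))
    (g : C2) (a : GArrow V E) :
    comap (σ.bar.onE g) (gDelta Q S (σ.bar.onE g a)) = gDelta Q S a := by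
  rw [bar_onE]
  rcases a with a | a | i
  · exact map_zero _
  · ext w
    refine σ.gEmb_onBar g (f := S.cyclicDeriv (σ.onE g a)) (f' := S.cyclicDeriv a) ?_ w
    intro u
    rw [Potential.cyclicDeriv_eq, Potential.cyclicDeriv_eq, shift_apply, shift_apply,
      ← List.map_cons]
    rcases C2.eq_one_or_gen g with rfl | rfl
    · rw [map_one, Equiv.Perm.coe_one, List.map_id]
    · exact σ.cyc_onE hS _
  · change comap _ (∑ a : E, _) = ∑ a : E, _
    rw [map_sum]
    refine (Equiv.sum_comp (σ.onE g) _).symm.trans (Finset.sum_congr rfl fun a _ => ?_)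
    have hw := fun v : List (GArrow V E) => comap_word (k := k) (e := σ.onBar g)
      (by rw [← bar_onE]; exact (σ.bar.onE g).injective) v
    have h1 := hw [.inl a, .inr (.inl a)]
    have h2 := hw [.inr (.inl a), .inl a]
    rw [map_sub, apply_ite (comap (σ.onBar g)), apply_ite (comap (σ.onBar g)), map_zero]
    refine congrArg₂ (· - ·) (if_congr ?_ h1 rfl) (if_congr ?_ h2 rfl)
    · rw [σ.t_map]; exact (σ.onV g).injective.eq_iff
    · rw [σ.s_map]; exact (σ.onV g).injective.eq_iff

variable [Fintype V] [DecidableEq V] [Fintype E]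

/-- The action on the complete Ginzburg dg algebra. -/
def ginzburgAction (hS : S.CyclicEquiv (σ.mapPotential gen S)) : DGAction C2 (ginzburg Q S) :=
  pathAction σ.bar (isPathDifferential_gDelta Q S) σ.gdeg_onE (σ.comap_gDelta hS)

theorem induces_ginzburgAction (hS : S.CyclicEquiv (σ.mapPotential gen S)) :
    σ.Induces (σ.ginzburgAction hS) := by
  intro g x i j w
  rw [← bar_onE]
  change x.1 (σ.bar.onV g⁻¹ (σ.bar.onV g i)) (σ.bar.onV g⁻¹ (σ.bar.onV g j))
    ((w.map (σ.bar.onE g)).map (σ.bar.onE g⁻¹)) = x.1 i j w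
  rw [map_inv_map, onV_inv_onV, onV_inv_onV]

end Quiv.Action
-- Isotypic pieces of the Ginzburg algebra as folded series
section Entries

variable {k : Type*} [CommRing k] {V E : Type*} [Fintype V] [DecidableEq V] [Fintype E]
  {Q : Quiv V E} {S : Potential k Q}

/-- The entries of an element of the Ginzburg dg algebra. -/
def gEntry (S : Potential k Q) (i j : V) : ginzburg Q S →ₗ[k] Series k (GArrow V E) where
  toFun x := (show completePath k Q.bar gdeg from x).1 i j
  map_add' _ _ := rfl
  map_smul' _ _ := rfl

theorem gEntry_ext {x y : ginzburg Q S} (h : ∀ i j, gEntry S i j x = gEntry S i j y) : x = y :=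
  Subtype.ext (funext fun i => funext fun j => h i j)

theorem gEntry_mul (x y : ginzburg Q S) (i j : V) :
    gEntry S i j (x * y) = ∑ l, gEntry S i l x * gEntry S l j y := rfl

theorem gEntry_isPath {x : ginzburg Q S} {i j : V} {w : List (GArrow V E)}
    (h : gEntry S i j x w ≠ 0) : Q.bar.IsPath i w j :=
  (show completePath k Q.bar gdeg from x).2.1 i j w h

theorem gEntry_gVertex (l i j : V) :
    gEntry S i j (gVertex S l) = if i = l ∧ j = l then 1 else 0 := by
  change Matrix.single l l 1 i j = _
  rw [Matrix.single_apply]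
  exact if_congr (and_congr eq_comm eq_comm) rfl rfl

theorem gEntry_d (x : ginzburg Q S) (i j : V) :
    gEntry S i j ((ginzburg Q S).d x) = der gdeg (gDelta Q S) (gEntry S i j x) := rfl

theorem gEntry_gPotential (i j : V) (w : List (GArrow V E)) :
    gEntry S i j (gPotential S) w =
      open Classical in if i = j ∧ Q.bar.IsPath i w j then gEmb S.series w else 0 := rfl

theorem gEntry_gVertex_mul (l i j : V) (x : ginzburg Q S) :
    gEntry S i j (gVertex S l * x) = if i = l then gEntry S i j x else 0 := by
  rw [gEntry_mul, Finset.sum_eq_single l]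
  · rw [gEntry_gVertex]
    by_cases h : i = l <;> simp [h]
  · intro l' _ hl
    rw [gEntry_gVertex, if_neg fun h => hl h.2, zero_mul]
  · simp

theorem gEntry_mul_gVertex (l i j : V) (x : ginzburg Q S) :
    gEntry S i j (x * gVertex S l) = if j = l then gEntry S i j x else 0 := by
  rw [gEntry_mul, Finset.sum_eq_single l]
  · rw [gEntry_gVertex]
    by_cases h : j = l <;> simp [h]
  · intro l' _ hl
    rw [gEntry_gVertex, if_neg fun h => hl h.1, mul_zero]
  · simp

end Entries

namespace Quiv.Action

variable {k : Type*} [Field k] {V E : Type*} {Q : Quiv V E} {σ : Q.Action C2} {S : Potential k Q}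
variable [Fintype V] [DecidableEq V] [Fintype E]

theorem gEntry_ginzburgAction (hS : S.CyclicEquiv (σ.mapPotential gen S)) (x : ginzburg Q S)
    (i j : V) : gEntry S i j ((σ.ginzburgAction hS).hom gen x) =
      comap (σ.onBar gen) (gEntry S (σ.onV gen i) (σ.onV gen j) x) := by
  rw [← bar_onE]
  rfl

namespace Choice

variable {c : σ.Choice}

open Classical in
/-- The sum of the vertex idempotents over an orbit. -/
def orbitElt (c : σ.Choice) (S : Potential k Q) (p : c.Vertex) : ginzburg Q S :=
  if σ.IsFixed p.1.1 then gVertex S p.1.1 else gVertex S p.1.1 + gVertex S (σ.onV gen p.1.1)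

open Classical in
theorem gEntry_orbitElt (p : c.Vertex) (i j : V) :
    gEntry S i j (c.orbitElt S p) = if i = j ∧ c.mem p i then 1 else 0 := by
  rw [orbitElt]
  by_cases hp : σ.IsFixed p.1.1
  · rw [if_pos hp, gEntry_gVertex]
    have : c.mem p i ↔ i = p.1.1 := by
      rw [mem, show σ.onV gen p.1.1 = p.1.1 from hp, or_self]
    by_cases h : i = p.1.1
    · by_cases hj : j = i
      · rw [if_pos ⟨h, hj.trans h⟩, if_pos ⟨hj.symm, this.2 h⟩]
      · rw [if_neg fun h' => hj (h'.2.trans h.symm), if_neg fun h' => hj h'.1.symm]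
    · rw [if_neg fun h' => h h'.1, if_neg fun h' => h (this.1 h'.2)]
  · rw [if_neg hp, map_add, gEntry_gVertex, gEntry_gVertex]
    by_cases h : i = p.1.1
    · have h2 : i ≠ σ.onV gen p.1.1 := fun h' => hp (h'.symm.trans h)
      rw [if_neg (fun h' => h2 h'.1 : ¬ (i = σ.onV gen p.1.1 ∧ j = σ.onV gen p.1.1)), add_zero]
      by_cases hj : j = i
      · rw [if_pos ⟨h, hj.trans h⟩, if_pos ⟨hj.symm, Or.inl h⟩]
      · rw [if_neg fun h' => hj (h'.2.trans h.symm), if_neg fun h' => hj h'.1.symm]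
    · rw [if_neg (fun h' => h h'.1 : ¬ (i = p.1.1 ∧ j = p.1.1)), zero_add]
      by_cases hj : j = i
      · by_cases h2 : i = σ.onV gen p.1.1
        · rw [if_pos ⟨h2, hj.trans h2⟩, if_pos ⟨hj.symm, Or.inr h2⟩]
        · rw [if_neg fun h' => h2 h'.1, if_neg fun h' => h'.2.elim h h2]
      · rw [if_neg fun h' => hj (h'.2.trans h'.1.symm), if_neg fun h' => hj h'.1.symm]

open Classical in
theorem gEntry_orbitElt_mul (p : c.Vertex) (x : ginzburg Q S) (i j : V) :
    gEntry S i j (c.orbitElt S p * x) = if c.mem p i then gEntry S i j x else 0 := by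
  rw [gEntry_mul, Finset.sum_eq_single i]
  · rw [gEntry_orbitElt]
    by_cases h : c.mem p i <;> simp [h]
  · intro l _ hl
    rw [gEntry_orbitElt, if_neg fun h => hl h.1.symm, zero_mul]
  · simp

open Classical in
theorem gEntry_mul_orbitElt (p : c.Vertex) (x : ginzburg Q S) (i j : V) :
    gEntry S i j (x * c.orbitElt S p) = if c.mem p j then gEntry S i j x else 0 := by
  rw [gEntry_mul, Finset.sum_eq_single j]
  · rw [gEntry_orbitElt]
    by_cases h : c.mem p j <;> simp [h]
  · intro l _ hl
    rw [gEntry_orbitElt, if_neg fun h => hl h.1, mul_zero]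
  · simp

theorem action_orbitElt (hS : S.CyclicEquiv (σ.mapPotential gen S)) (p : c.Vertex) :
    (σ.ginzburgAction hS).hom gen (c.orbitElt S p) = c.orbitElt S p := by
  refine gEntry_ext fun i j => ?_
  classical
  rw [gEntry_ginzburgAction, gEntry_orbitElt, gEntry_orbitElt, apply_ite (comap (σ.onBar gen)),
    comap_one, map_zero]
  exact if_congr (and_congr (σ.onV gen).injective.eq_iff mem_onV) rfl rfl

theorem orbitElt_mem (p : c.Vertex) : c.orbitElt S p ∈ (ginzburg Q S).gr 0 := by
  classical
  intro i j w h
  change gEntry S i j (c.orbitElt S p) w ≠ 0 at h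
  rw [gEntry_orbitElt] at h
  split_ifs at h
  · rw [one_def, word_apply] at h
    by_contra h'
    refine h (if_neg ?_)
    rintro rfl
    exact h' rfl
  · exact absurd rfl h

theorem d_orbitElt (p : c.Vertex) : (ginzburg Q S).d (c.orbitElt S p) = 0 := by
  classical
  refine gEntry_ext fun i j => ?_
  rw [gEntry_d, gEntry_orbitElt, map_zero]
  split_ifs
  · exact der_one _ _
  · exact map_zero _

/-- The elements of the Ginzburg dg algebra of `Q` corresponding to combinations of paths of the
bar quiver of `Q_G` from `q` to `p`. -/
structure IsFoldedElt (c : σ.Choice) (hS : S.CyclicEquiv (σ.mapPotential gen S)) (p q : c.Vertex)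
    (x : ginzburg Q S) : Prop where
  left : c.orbitElt S p * x = x
  right : x * c.orbitElt S q = x
  action : (σ.ginzburgAction hS).hom gen x = (c.sg k p * c.sg k q) • x

variable (hS : S.CyclicEquiv (σ.mapPotential gen S)) (hfix : σ.FixesArrows) (hk : (2 : k) ≠ 0)

/-- The two orbit idempotents express the support of the entries, and the eigenvalue equation
expresses their equivariance; being supported on paths is automatic in the path algebra. -/
theorem isFoldedElt_iff (p q : c.Vertex) (x : ginzburg Q S) :
    c.IsFoldedElt hS p q x ↔
      (c.folding hfix hk).IsFolded p q fun i j => gEntry S i j x := by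
  classical
  constructor
  · intro h
    refine ⟨fun i j w => gEntry_isPath, fun i j w hw => ⟨?_, ?_⟩, fun i j w => ?_⟩
    · rw [← h.left, gEntry_orbitElt_mul] at hw
      by_contra h'
      rw [if_neg (show ¬ c.mem p i from h')] at hw
      exact hw rfl
    · rw [← h.right, gEntry_mul_orbitElt] at hw
      by_contra h'
      rw [if_neg (show ¬ c.mem q j from h')] at hw
      exact hw rfl
    · have h1 := congrArg (fun y => gEntry S i j y w) h.action
      simp only [gEntry_ginzburgAction, map_smul] at h1
      exact h1
  · intro h
    refine ⟨gEntry_ext fun i j => ?_, gEntry_ext fun i j => ?_, gEntry_ext fun i j => ?_⟩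
    · rw [gEntry_orbitElt_mul]
      split_ifs with hi
      · rfl
      · ext w
        by_contra h'
        exact hi (h.mem i j w (Ne.symm h')).1
    · rw [gEntry_mul_orbitElt]
      split_ifs with hi
      · rfl
      · ext w
        by_contra h'
        exact hi (h.mem i j w (Ne.symm h')).2
    · rw [gEntry_ginzburgAction, map_smul]
      ext w
      exact h.equiv i j w

theorem gdeg_eq_of_M_ne {β : GArrow c.Vertex c.Arrow} {b : GArrow V E}
    (h : (c.folding hfix hk).M β b ≠ 0) : gdeg β = gdeg b := by
  rcases β with β | β | p <;> rcases b with b | b | i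
  all_goals first | rfl | exact absurd rfl h

theorem gdeg_eq_of_N_ne {β : GArrow c.Vertex c.Arrow} {b : GArrow V E}
    (h : (c.folding hfix hk).N β b ≠ 0) : gdeg β = gdeg b := by
  rcases β with β | β | p <;> rcases b with b | b | i
  all_goals first | rfl | exact absurd rfl h

theorem wdeg_eq_of_forall₂ {X Y : Type*} {degX : X → ℤ} {degY : Y → ℤ} {R : X → Y → Prop}
    (h : ∀ x y, R x y → degX x = degY y) {u : List X} {w : List Y} (huw : List.Forall₂ R u w) :
    wdeg degX u = wdeg degY w := by
  induction huw with
  | nil => rfl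
  | cons h' _ ih => rw [wdeg_cons, wdeg_cons, ih, h _ _ h']

theorem exists_of_subst_ne {X Y : Type*} [Fintype Y] {N : X → Y → k} {f : Series k Y} {u : List X}
    (h : subst N f u ≠ 0) : ∃ w, f w ≠ 0 ∧ List.Forall₂ (fun x y => N x y ≠ 0) u w := by
  induction u generalizing f with
  | nil => exact ⟨[], h, List.Forall₂.nil⟩
  | cons β u ih =>
    rw [subst_cons] at h
    obtain ⟨b, -, hb⟩ := Finset.exists_ne_zero_of_sum_ne_zero h
    obtain ⟨w, hw, huw⟩ := ih (right_ne_zero_of_mul hb)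
    exact ⟨b :: w, hw, List.Forall₂.cons (left_ne_zero_of_mul hb) huw⟩

/-- The map sending a combination of paths of the bar quiver of `Q_G` from `q` to `p` to the
corresponding combination of paths of the bar quiver of `Q`. -/
def foldElt (S : Potential k Q) (p q : c.Vertex) :
    completePath k c.quiv.bar gdeg →ₗ[k] ginzburg Q S where
  toFun f := show completePath k Q.bar gdeg from
    ⟨fun i j => (c.folding hfix hk).fold p i j (f.1 p q), by
      obtain ⟨f, hf, F, hF⟩ := f
      refine ⟨fun i j w h => Folding.fold_isPath h, F, fun i j w h => ?_⟩
      obtain ⟨u, hu, huw⟩ := Folding.exists_of_fold_ne h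
      rw [← wdeg_eq_of_forall₂ (degX := gdeg) (fun _ _ h => gdeg_eq_of_M_ne hfix hk h) huw]
      exact hF _ _ _ hu⟩
  map_add' f g := Subtype.ext (funext fun i => funext fun j =>
    map_add ((c.folding hfix hk).fold p i j) _ _)
  map_smul' a f := Subtype.ext (funext fun i => funext fun j =>
    map_smul ((c.folding hfix hk).fold p i j) _ _)

theorem gEntry_foldElt (p q : c.Vertex) (f : completePath k c.quiv.bar gdeg) (i j : V) :
    gEntry S i j (foldElt hfix hk S p q f) = (c.folding hfix hk).fold p i j (f.1 p q) := rfl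

theorem supported_entry (f : completePath k c.quiv.bar gdeg) (p q : c.Vertex) :
    Supported c.quiv.bar p q (f.1 p q) := f.2.1 p q

theorem isFoldedElt_foldElt (p q : c.Vertex) (f : completePath k c.quiv.bar gdeg) :
    c.IsFoldedElt hS p q (foldElt hfix hk S p q f) :=
  (isFoldedElt_iff hS hfix hk p q _).2 (Folding.isFolded_fold (supported_entry f p q))

theorem foldElt_one (p q : c.Vertex) :
    foldElt hfix hk S p q 1 = if p = q then c.orbitElt S p else 0 := by
  classical
  refine gEntry_ext fun i j => ?_
  rw [gEntry_foldElt]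
  change (c.folding hfix hk).fold p i j ((1 : Matrix _ _ (Series k _)) p q) = _
  rw [Matrix.one_apply]
  split_ifs
  · rw [gEntry_orbitElt]
    refine (Folding.fold_word_nil (D := c.folding hfix hk) p i j).trans ?_
    congr
  · rw [map_zero, map_zero]

theorem foldElt_mul (p r : c.Vertex) (f g : completePath k c.quiv.bar gdeg) :
    foldElt hfix hk S p r (f * g) =
      ∑ q, foldElt hfix hk S p q f * foldElt hfix hk S q r g := by
  refine gEntry_ext fun i j => ?_
  refine Eq.trans ?_ (map_sum (gEntry S i j)
    (fun q => foldElt hfix hk S p q f * foldElt hfix hk S q r g) Finset.univ).symm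
  change (c.folding hfix hk).fold p i j (∑ q : c.Vertex, f.1 p q * g.1 q r) = _
  rw [map_sum ((c.folding hfix hk).fold p i j)]
  exact Finset.sum_congr rfl fun q _ =>
    Folding.fold_mul (supported_entry f p q) (supported_entry g q r) i j

theorem foldElt_mem {n : ℤ} {f : completePath k c.quiv.bar gdeg}
    (hf : f ∈ completePathGr k c.quiv.bar gdeg n) (p q : c.Vertex) :
    foldElt hfix hk S p q f ∈ (ginzburg Q S).gr n := by
  intro i j w h
  obtain ⟨u, hu, huw⟩ := Folding.exists_of_fold_ne h
  rw [← wdeg_eq_of_forall₂ (degX := gdeg) (fun _ _ h => gdeg_eq_of_M_ne hfix hk h) huw]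
  exact hf _ _ _ hu

theorem d_foldElt (hS : S.CyclicEquiv (σ.mapPotential gen S)) (hfix : σ.FixesArrows)
    (hk : (2 : k) ≠ 0) (p q : c.Vertex) (f : ginzburg c.quiv (c.potential S)) :
    (ginzburg Q S).d (foldElt hfix hk S p q f) =
      foldElt hfix hk S p q ((ginzburg c.quiv (c.potential S)).d f) := by
  have hsup : ∀ f : ginzburg c.quiv (c.potential S),
      Supported c.quiv.bar p q (gEntry (c.potential S) p q f) := fun f w => gEntry_isPath
  refine gEntry_ext fun i j => ?_
  change der _ _ ((c.folding hfix hk).fold p i j (gEntry (c.potential S) p q f)) =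
    (c.folding hfix hk).fold p i j (gEntry (c.potential S) p q ((ginzburg c.quiv (c.potential S)).d f))
  by_cases hi : c.mem p i
  · rw [gEntry_d]
    exact Folding.der_fold (isFoldedDer hfix hk hS) (hsup f) hi j
  · have h0 : ∀ f : ginzburg c.quiv (c.potential S),
        (c.folding hfix hk).fold p i j (gEntry (c.potential S) p q f) = 0 := by
      intro f
      ext w
      by_contra h
      exact hi (Folding.fold_mem (hsup f) h).1
    rw [h0, h0, map_zero]

theorem eq_zero_of_foldElt {f : completePath k c.quiv.bar gdeg}
    (h : ∀ p q, foldElt hfix hk S p q f = 0) : f = 0 := by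
  refine Subtype.ext (funext fun p => funext fun q => ?_)
  refine Folding.eq_zero_of_fold (D := c.folding hfix hk) (supported_entry f p q) fun i j => ?_
  rw [← gEntry_foldElt (S := S), h, map_zero]

/-- The unfoldings of the entries form one element of the path algebra: N preserves degrees, and
finitely many pairs (p, q) involve only finitely many degrees. -/
theorem exists_foldElt (x : c.Vertex → c.Vertex → ginzburg Q S)
    (hx : ∀ p q, c.IsFoldedElt hS p q (x p q)) :
    ∃ f : completePath k c.quiv.bar gdeg, ∀ p q, foldElt hfix hk S p q f = x p q := by
  choose F hF using fun p q => (show completePath k Q.bar gdeg from x p q).2.2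
  refine ⟨⟨fun p q => (c.folding hfix hk).unfold p q fun i j => gEntry S i j (x p q),
    fun p q => Folding.supported_unfold p q _,
    Finset.univ.biUnion fun p => Finset.univ.biUnion fun q => F p q, fun p q u h => ?_⟩,
    fun p q => gEntry_ext fun i j => ?_⟩
  · rw [Finset.mem_biUnion]
    refine ⟨p, Finset.mem_univ _, ?_⟩
    rw [Finset.mem_biUnion]
    refine ⟨q, Finset.mem_univ _, ?_⟩
    rw [Folding.unfold_apply] at h
    split_ifs at h
    · obtain ⟨w, hw, huw⟩ := exists_of_subst_ne (right_ne_zero_of_mul h)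
      rw [wdeg_eq_of_forall₂ (degY := gdeg) (fun _ _ h => gdeg_eq_of_N_ne hfix hk h) huw]
      rw [Series.sum_apply] at hw
      obtain ⟨i, -, hi⟩ := Finset.exists_ne_zero_of_sum_ne_zero hw
      rw [Series.sum_apply] at hi
      obtain ⟨j, -, hj⟩ := Finset.exists_ne_zero_of_sum_ne_zero hi
      exact hF p q i j w hj
    · exact absurd rfl h
  · rw [gEntry_foldElt]
    exact Folding.fold_unfold ((isFoldedElt_iff hS hfix hk p q _).1 (hx p q)) i j

end Choice
end Quiv.Action
-- The skew group algebra and its components between the idempotents e_p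
section Tensors

variable {k : Type*} [Field k] {V E : Type*} [Fintype V] [DecidableEq V] [Fintype E]
  {Q : Quiv V E} {S : Potential k Q} (ρ : DGAction C2 (ginzburg Q S))

theorem tens_add (x y : ginzburg Q S) (g : C2) : tens ρ (x + y) g = tens ρ x g + tens ρ y g :=
  SkewMonoidAlgebra.single_add g x y

theorem tens_smul (a : k) (x : ginzburg Q S) (g : C2) : tens ρ (a • x) g = a • tens ρ x g :=
  (SkewMonoidAlgebra.smul_single a g x).symm

/-- The linear map `x ↦ x ⊗ g`. -/
def tensₗ (g : C2) : ginzburg Q S →ₗ[k] DGAlgebra.skew ρ where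
  toFun x := tens ρ x g
  map_add' x y := tens_add ρ x y g
  map_smul' a x := tens_smul ρ a x g

theorem tens_zero (g : C2) : tens ρ (0 : ginzburg Q S) g = 0 := map_zero (tensₗ ρ g)

theorem tens_sum {ι : Type*} (s : Finset ι) (x : ι → ginzburg Q S) (g : C2) :
    tens ρ (∑ i ∈ s, x i) g = ∑ i ∈ s, tens ρ (x i) g := map_sum (tensₗ ρ g) x s

theorem tens_mul_tens (x y : ginzburg Q S) (g h : C2) :
    tens ρ x g * tens ρ y h = tens ρ (x * ρ.hom g y) (g * h) :=
  letI := ρ.mulSemiringAction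
  SkewMonoidAlgebra.single_mul_single (k := ginzburg Q S) (G := C2)

theorem tens_one_mul_tens (x y : ginzburg Q S) (h : C2) :
    tens ρ x 1 * tens ρ y h = tens ρ (x * y) h := by
  rw [tens_mul_tens, map_one, one_mul]
  rfl

theorem tens_one_one : tens ρ (1 : ginzburg Q S) 1 = 1 := rfl

/-- The coefficient of `g` in an element of the skew group algebra. -/
def skewPart (g : C2) : DGAlgebra.skew ρ →ₗ[k] ginzburg Q S where
  toFun x := (show SkewMonoidAlgebra (ginzburg Q S) C2 from x).coeff g
  map_add' x y := by
    change (SkewMonoidAlgebra.coeff (k := ginzburg Q S) (G := C2) (x + y)) g = _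
    exact congrArg (fun f : C2 →₀ ginzburg Q S => f g) (SkewMonoidAlgebra.coeff_add _ _)
  map_smul' a x := by
    change (SkewMonoidAlgebra.coeff (k := ginzburg Q S) (G := C2) (a • x)) g = _
    exact congrArg (fun f : C2 →₀ ginzburg Q S => f g) (SkewMonoidAlgebra.coeff_smul a _)

theorem skewPart_tens (x : ginzburg Q S) (g h : C2) :
    skewPart ρ h (tens ρ x g) = if g = h then x else 0 := by
  classical
  change (SkewMonoidAlgebra.single g x : SkewMonoidAlgebra (ginzburg Q S) C2).coeff h = _
  rw [SkewMonoidAlgebra.coeff_single, Finsupp.single_apply]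

theorem skew_ext {x y : DGAlgebra.skew ρ} (h : ∀ g, skewPart ρ g x = skewPart ρ g y) : x = y :=
  SkewMonoidAlgebra.ext h

theorem skew_eq (z : DGAlgebra.skew ρ) :
    z = tens ρ (skewPart ρ 1 z) 1 + tens ρ (skewPart ρ gen z) gen := by
  refine skew_ext ρ fun g => ?_
  rw [map_add, skewPart_tens, skewPart_tens]
  rcases C2.eq_one_or_gen g with rfl | rfl
  · rw [if_pos rfl, if_neg (by decide), add_zero]
  · rw [if_neg (by decide), if_pos rfl, zero_add]

theorem d_tens (x : ginzburg Q S) (g : C2) :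
    (DGAlgebra.skew ρ).d (tens ρ x g) = tens ρ ((ginzburg Q S).d x) g :=
  DGAction.mapCoeff_single _ _ _

theorem tens_mem {n : ℤ} {x : ginzburg Q S} (hx : x ∈ (ginzburg Q S).gr n) (g : C2) :
    tens ρ x g ∈ (DGAlgebra.skew ρ).gr n :=
  DGAction.single_mem_skewGr hx g

end Tensors

namespace Quiv.Action.Choice

variable {k : Type*} [Field k] {V E : Type*} {Q : Quiv V E} {σ : Q.Action C2} {S : Potential k Q}
variable [Fintype V] [DecidableEq V] [Fintype E] {c : σ.Choice}

theorem orbitElt_mul_orbitElt (p : c.Vertex) :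
    c.orbitElt S p * c.orbitElt S p = c.orbitElt S p := by
  classical
  refine gEntry_ext fun i j => ?_
  rw [gEntry_orbitElt_mul, gEntry_orbitElt]
  by_cases h : c.mem p i <;> simp [h]

/-- This is the orthogonality of e_p and e_q: either the orbits are disjoint, or they are the same
fixed vertex with opposite signs. -/
theorem add_sg_smul_orbitElt_mul {p q : c.Vertex} (h : p ≠ q) :
    c.orbitElt S p * c.orbitElt S q + (c.sg k p * c.sg k q) •
      (c.orbitElt S p * c.orbitElt S q) = 0 := by
  classical
  refine gEntry_ext fun i j => ?_
  rw [map_add, map_smul, gEntry_orbitElt_mul, gEntry_orbitElt, map_zero]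
  by_cases hp : c.mem p i
  · by_cases hq : c.mem q i
    · rw [(eq_of_mem_of_ne h hp hq).2, neg_one_smul, add_neg_cancel]
    · simp [hq]
  · simp [hp]

variable (hS : S.CyclicEquiv (σ.mapPotential gen S))

theorem action_action (x : ginzburg Q S) :
    (σ.ginzburgAction hS).hom gen ((σ.ginzburgAction hS).hom gen x) = x := by
  change ((σ.ginzburgAction hS).hom gen * (σ.ginzburgAction hS).hom gen) x = x
  rw [← map_mul, gen_mul_gen, map_one]
  rfl

theorem idem_eq (ρ : DGAction C2 (ginzburg Q S)) (p : c.Vertex) : idem c ρ p =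
    (2⁻¹ : k) • (tens ρ (c.orbitElt S p) 1 + c.sg k p • tens ρ (c.orbitElt S p) gen) := rfl

/-- The element 1 ⊗ σ acts on e_q from the left by the sign of q, because the orbit idempotent is
invariant. -/
theorem tens_gen_mul_idem (x : ginzburg Q S) (q : c.Vertex) :
    tens (σ.ginzburgAction hS) x gen * idem c (σ.ginzburgAction hS) q =
      c.sg k q • (tens (σ.ginzburgAction hS) x 1 * idem c (σ.ginzburgAction hS) q) := by
  rw [idem_eq, mul_smul_comm, mul_smul_comm, mul_add, mul_add, mul_smul_comm, mul_smul_comm,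
    tens_one_mul_tens, tens_one_mul_tens, tens_mul_tens, tens_mul_tens, action_orbitElt, mul_one,
    gen_mul_gen, smul_comm (c.sg k q), smul_add (c.sg k q), smul_smul (c.sg k q), sg_mul_self,
      one_smul,
    add_comm]

theorem idem_mul_tens_one (p : c.Vertex) (x : ginzburg Q S) :
    idem c (σ.ginzburgAction hS) p * tens (σ.ginzburgAction hS) x 1 =
      (2⁻¹ : k) • (tens (σ.ginzburgAction hS) (c.orbitElt S p * x) 1 +
        c.sg k p • tens (σ.ginzburgAction hS)
          (c.orbitElt S p * (σ.ginzburgAction hS).hom gen x) gen) := by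
  rw [idem_eq, smul_mul_assoc, add_mul, smul_mul_assoc, tens_one_mul_tens, tens_mul_tens, mul_one]

theorem tens_one_mul_idem (q : c.Vertex) (x : ginzburg Q S) :
    tens (σ.ginzburgAction hS) x 1 * idem c (σ.ginzburgAction hS) q =
      (2⁻¹ : k) • (tens (σ.ginzburgAction hS) (x * c.orbitElt S q) 1 +
        c.sg k q • tens (σ.ginzburgAction hS) (x * c.orbitElt S q) gen) := by
  rw [idem_eq, mul_smul_comm, mul_add, mul_smul_comm, tens_one_mul_tens, tens_one_mul_tens]

theorem tens_orbitElt_mul_idem (q : c.Vertex) :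
    tens (σ.ginzburgAction hS) (c.orbitElt S q) 1 * idem c (σ.ginzburgAction hS) q =
      idem c (σ.ginzburgAction hS) q := by
  rw [tens_one_mul_idem, orbitElt_mul_orbitElt, idem_eq]

variable {hS}

theorem IsFoldedElt.tens_mul_idem {p q : c.Vertex} {x : ginzburg Q S} (h : c.IsFoldedElt hS p q x) :
    tens (σ.ginzburgAction hS) x 1 * idem c (σ.ginzburgAction hS) q =
      (2⁻¹ : k) • (tens (σ.ginzburgAction hS) x 1 +
        c.sg k q • tens (σ.ginzburgAction hS) x gen) := by
  rw [tens_one_mul_idem, h.right]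

/-- Moving x to the left of σ replaces it by σ(x), whose eigenvalue converts the sign of p into that
of q. -/
theorem IsFoldedElt.idem_mul_tens {p q : c.Vertex} {x : ginzburg Q S} (h : c.IsFoldedElt hS p q x) :
    idem c (σ.ginzburgAction hS) p * tens (σ.ginzburgAction hS) x 1 =
      tens (σ.ginzburgAction hS) x 1 * idem c (σ.ginzburgAction hS) q := by
  rw [idem_mul_tens_one, h.action, h.left, mul_smul_comm, h.left, h.tens_mul_idem, tens_smul,
    smul_smul, ← mul_assoc, sg_mul_self, one_mul]

/-- The component of (x ⊗ 1) e_q at the neutral element of G is x/2. -/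
theorem IsFoldedElt.eq_zero (hk : (2 : k) ≠ 0) {p q : c.Vertex} {x : ginzburg Q S}
    (h : c.IsFoldedElt hS p q x)
    (h0 : tens (σ.ginzburgAction hS) x 1 * idem c (σ.ginzburgAction hS) q = 0) : x = 0 := by
  rw [h.tens_mul_idem] at h0
  have h1 := congrArg (skewPart (σ.ginzburgAction hS) 1) h0
  rw [map_smul, map_add, map_smul, skewPart_tens, skewPart_tens, if_pos rfl, if_neg (by decide),
    smul_zero, add_zero, map_zero] at h1
  exact (smul_eq_zero.1 h1).resolve_left (inv_ne_zero hk)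

variable (hS) in
/-- The element `x` of the Ginzburg dg algebra of `Q` with `e_p z e_q = (x ⊗ 1) e_q`. -/
def foldPart (p q : c.Vertex) (z : DGAlgebra.skew (σ.ginzburgAction hS)) : ginzburg Q S :=
  let y := c.orbitElt S p * (skewPart (σ.ginzburgAction hS) 1 z +
    c.sg k q • skewPart (σ.ginzburgAction hS) gen z) * c.orbitElt S q
  (2⁻¹ : k) • (y + (c.sg k p * c.sg k q) • (σ.ginzburgAction hS).hom gen y)

theorem sg_mul_sg_mul_self (p q : c.Vertex) :
    c.sg k p * c.sg k q * (c.sg k p * c.sg k q) = 1 := by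
  rw [mul_mul_mul_comm, sg_mul_self, sg_mul_self, one_mul]

theorem isFoldedElt_average (p q : c.Vertex) {y : ginzburg Q S} (hl : c.orbitElt S p * y = y)
    (hr : y * c.orbitElt S q = y) : c.IsFoldedElt hS p q
      ((2⁻¹ : k) • (y + (c.sg k p * c.sg k q) • (σ.ginzburgAction hS).hom gen y)) := by
  have h1 := congrArg ((σ.ginzburgAction hS).hom gen) hl
  have h2 := congrArg ((σ.ginzburgAction hS).hom gen) hr
  rw [map_mul, action_orbitElt] at h1 h2
  refine ⟨?_, ?_, ?_⟩
  · rw [mul_smul_comm, mul_add, mul_smul_comm, hl, h1]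
  · rw [smul_mul_assoc, add_mul, smul_mul_assoc, hr, h2]
  · rw [map_smul, map_add, map_smul, action_action, smul_comm _ (2⁻¹ : k),
    smul_add (c.sg k p * c.sg k q),
      smul_smul (c.sg k p * c.sg k q), sg_mul_sg_mul_self, one_smul, add_comm]

theorem isFoldedElt_foldPart (p q : c.Vertex) (z : DGAlgebra.skew (σ.ginzburgAction hS)) :
    c.IsFoldedElt hS p q (foldPart hS p q z) := by
  refine isFoldedElt_average p q ?_ ?_
  · rw [← mul_assoc, ← mul_assoc, orbitElt_mul_orbitElt]
  · rw [mul_assoc, orbitElt_mul_orbitElt]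

theorem mul_idem (z : DGAlgebra.skew (σ.ginzburgAction hS)) (q : c.Vertex) :
    z * idem c (σ.ginzburgAction hS) q = tens (σ.ginzburgAction hS)
      (skewPart (σ.ginzburgAction hS) 1 z + c.sg k q • skewPart (σ.ginzburgAction hS) gen z) 1 *
        idem c (σ.ginzburgAction hS) q := by
  conv_lhs => rw [skew_eq _ z]
  rw [add_mul, tens_gen_mul_idem, tens_add, tens_smul, add_mul, smul_mul_assoc]

/-- On the right, e_q absorbs the group element, leaving (x ⊗ 1) e_q. On the left, e_p then averages
x over G, the σ thus created being absorbed by e_q again with its sign. -/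
theorem idem_mul_mul_idem (p q : c.Vertex) (z : DGAlgebra.skew (σ.ginzburgAction hS)) :
    idem c (σ.ginzburgAction hS) p * z * idem c (σ.ginzburgAction hS) q =
      tens (σ.ginzburgAction hS) (foldPart hS p q z) 1 * idem c (σ.ginzburgAction hS) q := by
  rw [mul_assoc, mul_idem, foldPart]
  generalize skewPart (σ.ginzburgAction hS) 1 z + c.sg k q •
    skewPart (σ.ginzburgAction hS) gen z = x
  rw [← mul_assoc, idem_mul_tens_one, smul_mul_assoc, add_mul, smul_mul_assoc, tens_gen_mul_idem,
    tens_smul, tens_add, tens_smul, smul_mul_assoc, add_mul, smul_mul_assoc, smul_smul, map_mul,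
    map_mul, action_orbitElt, action_orbitElt, ← tens_one_mul_tens _ _ (c.orbitElt S q),
    ← tens_one_mul_tens _ _ (c.orbitElt S q), mul_assoc _ _ (idem c _ q),
    mul_assoc _ _ (idem c _ q), tens_orbitElt_mul_idem]

theorem foldPart_one (p q : c.Vertex) : foldPart hS p q 1 =
    (2⁻¹ : k) • (c.orbitElt S p * c.orbitElt S q +
      (c.sg k p * c.sg k q) • (c.orbitElt S p * c.orbitElt S q)) := by
  rw [foldPart, ← tens_one_one, skewPart_tens, skewPart_tens, if_pos rfl, if_neg (by decide),
    smul_zero, add_zero, mul_one]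
  simp only [map_mul, action_orbitElt]

theorem idem_mul_idem (hk : (2 : k) ≠ 0) (p q : c.Vertex) :
    idem c (σ.ginzburgAction hS) p * idem c (σ.ginzburgAction hS) q =
      if p = q then idem c (σ.ginzburgAction hS) q else 0 := by
  have h := idem_mul_mul_idem (hS := hS) p q 1
  rw [mul_one] at h
  rw [h, foldPart_one]
  split_ifs with hpq
  · subst hpq
    rw [sg_mul_self, one_smul, orbitElt_mul_orbitElt, ← two_smul k, smul_smul,
      inv_mul_cancel₀ hk, one_smul, tens_orbitElt_mul_idem]
  · rw [add_sg_smul_orbitElt_mul hpq, smul_zero, tens_zero, zero_mul]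

theorem idem_mem (ρ : DGAction C2 (ginzburg Q S)) (p : c.Vertex) :
    idem c ρ p ∈ (DGAlgebra.skew ρ).gr 0 :=
  Submodule.smul_mem _ _ (Submodule.add_mem _ (tens_mem ρ (orbitElt_mem p) 1)
    (Submodule.smul_mem _ _ (tens_mem ρ (orbitElt_mem p) gen)))

theorem d_idem (ρ : DGAction C2 (ginzburg Q S)) (p : c.Vertex) :
    (DGAlgebra.skew ρ).d (idem c ρ p) = 0 := by
  rw [idem_eq, map_smul, map_add, map_smul, d_tens, d_tens, d_orbitElt, tens_zero, tens_zero,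
    smul_zero, add_zero, smul_zero]

theorem idem_mul_eBar (hk : (2 : k) ≠ 0) (p : c.Vertex) :
    idem c (σ.ginzburgAction hS) p * eBar c (σ.ginzburgAction hS) =
      idem c (σ.ginzburgAction hS) p := by
  rw [eBar, Finset.mul_sum, Finset.sum_eq_single p]
  · rw [idem_mul_idem hk, if_pos rfl]
  · intro q _ hq
    rw [idem_mul_idem hk, if_neg hq.symm]
  · simp

theorem eBar_mul_idem (hk : (2 : k) ≠ 0) (p : c.Vertex) :
    eBar c (σ.ginzburgAction hS) * idem c (σ.ginzburgAction hS) p =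
      idem c (σ.ginzburgAction hS) p := by
  rw [eBar, Finset.sum_mul, Finset.sum_eq_single p]
  · rw [idem_mul_idem hk, if_pos rfl]
  · intro q _ hq
    rw [idem_mul_idem hk, if_neg hq]
  · simp

theorem isDGIdempotent_eBar (hk : (2 : k) ≠ 0) :
    (DGAlgebra.skew (σ.ginzburgAction hS)).IsDGIdempotent (eBar c (σ.ginzburgAction hS)) where
  idem := by
    change eBar c _ * eBar c _ = eBar c _
    conv_lhs => rw [eBar, Finset.sum_mul]
    exact Finset.sum_congr rfl fun p _ => idem_mul_eBar hk p
  mem := Submodule.sum_mem _ fun p _ => idem_mem _ p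
  d_eq := by
    rw [eBar, map_sum]
    exact Finset.sum_eq_zero fun p _ => d_idem _ p

/-! ### The identification of the path algebra with the corner -/

section Omega

variable (hS) (hfix : σ.FixesArrows) (hk : (2 : k) ≠ 0)

/-- The map identifying the complete path algebra of the bar quiver of `Q_G` with the corner of
the skew group algebra. -/
def toSkew : completePath k c.quiv.bar gdeg →ₗ[k] DGAlgebra.skew (σ.ginzburgAction hS) where
  toFun f := ∑ p : c.Vertex, ∑ q : c.Vertex,
    tens (σ.ginzburgAction hS) (foldElt hfix hk S p q f) 1 * idem c (σ.ginzburgAction hS) q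
  map_add' f g := by
    simp only [← Finset.sum_add_distrib, ← add_mul, ← tens_add, map_add]
  map_smul' a f := by
    simp only [Finset.smul_sum, ← smul_mul_assoc, ← tens_smul, map_smul, RingHom.id_apply]

theorem toSkew_apply (f : completePath k c.quiv.bar gdeg) : toSkew hS hfix hk f =
    ∑ p : c.Vertex, ∑ q : c.Vertex,
      tens (σ.ginzburgAction hS) (foldElt hfix hk S p q f) 1 *
        idem c (σ.ginzburgAction hS) q := rfl

theorem idem_mul_toSkew (f : completePath k c.quiv.bar gdeg) (p : c.Vertex) :
    idem c (σ.ginzburgAction hS) p * toSkew hS hfix hk f =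
      ∑ q, tens (σ.ginzburgAction hS) (foldElt hfix hk S p q f) 1 *
        idem c (σ.ginzburgAction hS) q := by
  rw [toSkew_apply, Finset.mul_sum, Finset.sum_eq_single p]
  · rw [Finset.mul_sum]
    refine Finset.sum_congr rfl fun q _ => ?_
    rw [← (isFoldedElt_foldElt hS hfix hk p q f).idem_mul_tens, ← mul_assoc, idem_mul_idem hk,
      if_pos rfl]
  · intro p' _ hp
    rw [Finset.mul_sum]
    refine Finset.sum_eq_zero fun q _ => ?_
    rw [← (isFoldedElt_foldElt hS hfix hk p' q f).idem_mul_tens, ← mul_assoc, idem_mul_idem hk,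
      if_neg hp.symm, zero_mul]
  · simp

theorem idem_mul_toSkew_mul_idem (f : completePath k c.quiv.bar gdeg) (p q : c.Vertex) :
    idem c (σ.ginzburgAction hS) p * toSkew hS hfix hk f * idem c (σ.ginzburgAction hS) q =
      tens (σ.ginzburgAction hS) (foldElt hfix hk S p q f) 1 *
        idem c (σ.ginzburgAction hS) q := by
  rw [idem_mul_toSkew, Finset.sum_mul, Finset.sum_eq_single q]
  · rw [mul_assoc, idem_mul_idem hk, if_pos rfl]
  · intro q' _ hq
    rw [mul_assoc, idem_mul_idem hk, if_neg hq, mul_zero]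
  · simp

theorem toSkew_one : toSkew hS hfix hk (c := c) 1 = eBar c (σ.ginzburgAction hS) := by
  rw [toSkew_apply, eBar]
  refine Finset.sum_congr rfl fun p _ => ?_
  rw [Finset.sum_eq_single p]
  · rw [foldElt_one, if_pos rfl, tens_orbitElt_mul_idem]
  · intro q _ hq
    rw [foldElt_one, if_neg hq.symm, tens_zero, zero_mul]
  · simp

/-- The idempotent e_q at the end of an entry of f selects row q of g, and the entries then multiply
in Γ by `foldElt_mul`. -/
theorem toSkew_mul (f g : completePath k c.quiv.bar gdeg) :
    toSkew hS hfix hk (f * g) = toSkew hS hfix hk f * toSkew hS hfix hk g := by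
  rw [toSkew_apply (f := f), Finset.sum_mul, toSkew_apply]
  refine Finset.sum_congr rfl fun p _ => ?_
  rw [Finset.sum_mul]
  simp only [mul_assoc, idem_mul_toSkew, foldElt_mul, tens_sum, Finset.sum_mul, Finset.mul_sum]
  rw [Finset.sum_comm]
  refine Finset.sum_congr rfl fun q _ => Finset.sum_congr rfl fun r _ => ?_
  rw [← mul_assoc, tens_one_mul_tens]

theorem toSkew_injective : Function.Injective (toSkew hS hfix hk (c := c)) := by
  rw [injective_iff_map_eq_zero]
  intro f hf
  refine eq_zero_of_foldElt (S := S) hfix hk fun p q => ?_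
  refine (isFoldedElt_foldElt hS hfix hk p q f).eq_zero hk ?_
  rw [← idem_mul_toSkew_mul_idem, hf, mul_zero, zero_mul]

/-- Every component e_p z e_q is given by an isotypic element, and isotypic elements are folds. -/
theorem exists_toSkew (z : DGAlgebra.skew (σ.ginzburgAction hS)) :
    ∃ f, toSkew hS hfix hk (c :=
      c) f = eBar c (σ.ginzburgAction hS) * z * eBar c (σ.ginzburgAction hS) := by
  obtain ⟨f, hf⟩ := exists_foldElt hS hfix hk (fun p q => foldPart hS p q z)
    fun p q => isFoldedElt_foldPart p q z
  refine ⟨f, ?_⟩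
  rw [toSkew_apply, eBar, Finset.sum_mul, Finset.sum_mul]
  refine Finset.sum_congr rfl fun p _ => ?_
  rw [Finset.mul_sum]
  refine Finset.sum_congr rfl fun q _ => ?_
  rw [hf, idem_mul_mul_idem]

theorem toSkew_mem {n : ℤ} {f : completePath k c.quiv.bar gdeg}
    (hf : f ∈ completePathGr k c.quiv.bar gdeg n) :
    toSkew hS hfix hk f ∈ (DGAlgebra.skew (σ.ginzburgAction hS)).gr n := by
  refine Submodule.sum_mem _ fun p _ => Submodule.sum_mem _ fun q _ => ?_
  have h := SetLike.GradedMul.mul_mem (tens_mem (σ.ginzburgAction hS)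
    (foldElt_mem (S := S) hfix hk hf p q) 1) (idem_mem (σ.ginzburgAction hS) q)
  rwa [add_zero] at h

/-- The skew differential acts on the coefficients of the group elements only, so the claim reduces
entrywise to `d_foldElt`. -/
theorem d_toSkew (f : ginzburg c.quiv (c.potential S)) :
    (DGAlgebra.skew (σ.ginzburgAction hS)).d (toSkew hS hfix hk f) =
      toSkew hS hfix hk ((ginzburg c.quiv (c.potential S)).d f) := by
  refine Eq.trans ?_ (toSkew_apply hS hfix hk _).symm
  refine (congrArg _ (toSkew_apply hS hfix hk _)).trans ?_
  rw [map_sum]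
  refine Finset.sum_congr rfl fun p _ => ?_
  rw [map_sum]
  refine Finset.sum_congr rfl fun q _ => ?_
  rw [(isFoldedElt_foldElt hS hfix hk p q f).tens_mul_idem, map_smul, map_add, map_smul, d_tens,
    d_tens]
  refine Eq.trans ?_ (isFoldedElt_foldElt hS hfix hk p q _).tens_mul_idem.symm
  exact congrArg (fun x => (2⁻¹ : k) • (tens (σ.ginzburgAction hS) x 1 +
    c.sg k q • tens (σ.ginzburgAction hS) x gen)) (d_foldElt hS hfix hk p q f)

end Omega

end Quiv.Action.Choice
-- The elements attached to the arrows of Q_G and the components of ι'(S)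
open Classical in
theorem Folding.fold_word_singleton {k P V X Y : Type*} [Field k] [Fintype V] [Fintype X]
    [Fintype Y] {QX : Quiv P X} {QY : Quiv V Y} (D : Folding k QX QY) (p : P) (i j : V) (x : X)
    (w : List Y) : D.fold p i j (word [x]) w =
      match w with
      | [b] => if QY.t b = i ∧ QY.s b = j then D.M x b else 0
      | _ => 0 := by
  cases w with
  | nil =>
    rw [fold_nil]
    simp [word_apply]
  | cons b w =>
    have hx : shift x (word [x] : Series k X) = word [] := by ext v; simp [word_apply]
    have hne : ∀ β, β ≠ x → shift β (word [x] : Series k X) = 0 := by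
      intro β hβ
      ext v
      simp [word_apply, hβ]
    rw [fold_cons, Finset.sum_eq_single x, hx, fold_word_nil]
    · by_cases hM : D.M x b = 0
      · cases w <;> simp [hM]
      · simp only [and_iff_left (D.M_ne _ _ hM).2]
        cases w with
        | nil => by_cases ht : QY.t b = i <;> by_cases hs : QY.s b = j <;>
            simp only [ht, hs, word_apply, if_true, if_false, true_and, and_false, false_and,
              mul_one,
              Series.zero_apply, mul_zero]
        | cons b' w => by_cases hs : QY.s b = j <;> simp [hs, word_apply]
    · intro β _ hβ
      rw [hne β hβ, map_zero, Series.zero_apply, mul_zero]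
    · simp

namespace Quiv.Action.Choice

variable {k : Type*} [Field k] {V E : Type*} {Q : Quiv V E} {σ : Q.Action C2} {S : Potential k Q}
variable [Fintype V] [DecidableEq V] [Fintype E] {c : σ.Choice}
variable (hS : S.CyclicEquiv (σ.mapPotential gen S)) (hfix : σ.FixesArrows) (hk : (2 : k) ≠ 0)

open Classical in
theorem gEntry_foldPart_tens (p q : c.Vertex) (x : ginzburg Q S) (i j : V)
    (w : List (GArrow V E)) :
    gEntry S i j (foldPart hS p q (tens (σ.ginzburgAction hS) x 1)) w =
      if c.mem p i ∧ c.mem q j then 2⁻¹ * (gEntry S i j x w + c.sg k p * c.sg k q *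
        gEntry S (σ.onV gen i) (σ.onV gen j) x (w.map (σ.onBar gen))) else 0 := by
  rw [foldPart, skewPart_tens, skewPart_tens, if_pos rfl, if_neg (by decide), smul_zero, add_zero,
    map_smul, map_add, map_smul, gEntry_ginzburgAction, gEntry_mul_orbitElt, gEntry_orbitElt_mul,
    gEntry_mul_orbitElt, gEntry_orbitElt_mul, if_congr mem_onV rfl rfl,
    if_congr (mem_onV (p := p)) rfl rfl]
  by_cases hp : c.mem p i
  · by_cases hq : c.mem q j
    · rw [if_pos hq, if_pos hp, if_pos hq, if_pos hp, if_pos ⟨hp, hq⟩]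
      rfl
    · simp [hq]
  · simp [hp]

section Value

theorem gEntry_gPotential_self {P X : Type*} [Fintype P] [DecidableEq P] [Fintype X]
    {R : Quiv P X} (T : Potential k R) (p : P) :
    gEntry T p p (gPotential T) = cyclesAt R.bar p (gEmb T.series) := by
  ext w
  rw [gEntry_gPotential, cyclesAt_apply]
  classical
  exact if_congr (and_iff_right rfl) rfl rfl

theorem gEntry_gPotential_of_ne {P X : Type*} [Fintype P] [DecidableEq P] [Fintype X]
    {R : Quiv P X} (T : Potential k R) {p q : P} (h : p ≠ q) :
    gEntry T p q (gPotential T) = 0 := by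
  ext w
  rw [gEntry_gPotential, if_neg fun h' => h h'.1]
  rfl

theorem foldElt_gPotential_of_ne (T : Potential k c.quiv) {p q : c.Vertex} (h : p ≠ q) :
    foldElt hfix hk S p q (gPotential T) = 0 := by
  refine gEntry_ext fun i j => ?_
  change (c.folding hfix hk).fold p i j (gEntry T p q (gPotential T)) = _
  rw [gEntry_gPotential_of_ne T h, map_zero, map_zero]

theorem mapPotential_gen_apply (w : List E) :
    (σ.mapPotential gen S).series w = S.series (w.map (σ.onE gen)) := by
  rw [mapPotential_apply, gen_inv]

theorem gEmb_avg (w : List (GArrow V E)) : (gEmb (σ.avg S) : Series k (GArrow V E)) w =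
    2⁻¹ * (gEmb S.series w + gEmb S.series (w.map (σ.onBar gen))) := by
  have h := gEmb_onBar σ gen (f := S.series) (f' := (σ.mapPotential gen S).series)
    (fun w => by rw [mapPotential_gen_apply])
    w
  rw [h]
  change gEmbₗ (V := V) ((2⁻¹ : k) • (S.series + (σ.mapPotential gen S).series)) w = _
  rw [map_smul, map_add]
  rfl

open Classical in
/-- The weighted sum of the cyclic parts of the potential. -/
def weighted (σ : Q.Action C2) (S : Potential k Q) : ginzburg Q S :=
  ∑ i : V, (if σ.IsFixed i then (1 : k) else 2) • (gVertex S i * gPotential S * gVertex S i)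

open Classical in
theorem gEntry_weighted (i j : V) (w : List (GArrow V E)) :
    gEntry S i j (weighted σ S) w =
      if i = j ∧ Q.bar.IsPath i w j then
        (if σ.IsFixed i then 1 else 2) * gEmb S.series w else 0 := by
  rw [weighted, map_sum, Series.sum_apply, Finset.sum_eq_single i]
  · rw [map_smul, Series.smul_apply, gEntry_mul_gVertex, gEntry_gVertex_mul, if_pos rfl]
    by_cases hij : j = i
    · subst hij
      rw [if_pos rfl, gEntry_gPotential, mul_ite, mul_zero]
    · rw [if_neg hij, if_neg (fun h => hij h.1.symm : ¬ (i = j ∧ Q.bar.IsPath i w j)),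
        Series.zero_apply, mul_zero]
  · intro l _ hl
    rw [map_smul, Series.smul_apply, gEntry_mul_gVertex, gEntry_gVertex_mul, if_neg hl.symm,
      ite_self, Series.zero_apply, mul_zero]
  · simp

theorem iotaPrime_eq (ρ : DGAction C2 (ginzburg Q S)) :
    iotaPrime c ρ = eBar c ρ * tens ρ (weighted σ S) 1 * eBar c ρ := by
  rw [weighted, tens_sum, Finset.mul_sum, Finset.sum_mul]
  refine Finset.sum_congr rfl fun i _ => ?_
  rw [tens_smul, mul_smul_comm, smul_mul_assoc]
  rfl

theorem idem_mul_iotaPrime_mul_idem (hk : (2 : k) ≠ 0) (p q : c.Vertex) :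
    idem c (σ.ginzburgAction hS) p * iotaPrime c (σ.ginzburgAction hS) *
      idem c (σ.ginzburgAction hS) q = tens (σ.ginzburgAction hS)
        (foldPart hS p q (tens (σ.ginzburgAction hS) (weighted σ S) 1)) 1 *
          idem c (σ.ginzburgAction hS) q := by
  rw [← idem_mul_mul_idem, iotaPrime_eq, mul_assoc, mul_assoc _ (eBar c _), eBar_mul_idem hk,
    ← mul_assoc, ← mul_assoc, idem_mul_eBar hk]

theorem ite_isFixed_eq_size {p : c.Vertex} {i : V} (h : c.mem p i) :
    (open Classical in if σ.IsFixed i then (1 : k) else 2) = c.size k p := by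
  split_ifs with hi
  · exact (size_eq_one h hi).symm
  · exact (size_eq_two h hi).symm

/-- On the orbit of p the weights of ι' equal `size p`. With equal signs, the component is the
G-average, which replaces S by `avg S`; the claim becomes `fold_lift`. -/
theorem foldPart_weighted_self (p : c.Vertex) :
    foldPart hS p p (tens (σ.ginzburgAction hS) (weighted σ S) 1) =
      foldElt hfix hk S p p (gPotential (c.potential S)) := by
  classical
  refine gEntry_ext fun i j => ?_
  change _ = (c.folding hfix hk).fold p i j
    (gEntry (c.potential S) p p (gPotential (c.potential S)))
  rw [gEntry_gPotential_self]
  refine Eq.trans ?_ (fold_lift hfix hk (σ.avg_isCycle S) (σ.avg_onE S) p i j).symm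
  ext w
  rw [gEntry_foldPart_tens, Folding.diag_apply, gEmb_avg, gEntry_weighted, gEntry_weighted,
    sg_mul_self, one_mul]
  have hmem : (c.folding hfix hk).mem p i ↔ c.mem p i := Iff.rfl
  have hpath : Q.bar.IsPath (σ.onV gen i) (w.map (σ.onBar gen)) (σ.onV gen j) ↔
      Q.bar.IsPath i w j := Folding.isPath_onE (D := c.folding hfix hk)
  have hsize : (c.folding hfix hk).size p = c.size k p := rfl
  simp only [hmem, hpath, hsize, (σ.onV gen).injective.eq_iff, isFixed_onV]
  by_cases hi : c.mem p i
  · by_cases hij : i = j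
    · subst hij
      rw [ite_isFixed_eq_size hi]
      by_cases hw : Q.bar.IsPath i w i
      · simp only [hi, hw, and_self, if_true]
        ring
      · simp [hw]
    · simp [hij]
  · simp [hi]

/-- Cycles of Q contribute between distinct p and q only over a common fixed vertex. The signs are
then opposite, and the component is the anti-invariant part of S, which is zero here. -/
theorem foldPart_weighted_of_ne (hfix : σ.FixesArrows) (hk : (2 : k) ≠ 0)
    (h : σ.mapPotential gen S = S) {p q : c.Vertex} (hpq : p ≠ q) :
    foldPart hS p q (tens (σ.ginzburgAction hS) (weighted σ S) 1) = 0 := by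
  classical
  refine gEntry_ext fun i j => ?_
  ext w
  have hpath : Q.bar.IsPath (σ.onV gen i) (w.map (σ.onBar gen)) (σ.onV gen j) ↔
      Q.bar.IsPath i w j := Folding.isPath_onE (D := c.folding hfix hk)
  have hmap : gEmb S.series (w.map (σ.onBar gen)) = gEmb S.series w :=
    gEmb_onBar σ gen (f := S.series) (f' := S.series)
      (fun w => by rw [← mapPotential_gen_apply, h]) w
  rw [gEntry_foldPart_tens, gEntry_weighted, gEntry_weighted, hmap]
  simp only [hpath, (σ.onV gen).injective.eq_iff, isFixed_onV]
  split_ifs with h1 h2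
  · obtain ⟨rfl, -⟩ := h2
    rw [(eq_of_mem_of_ne hpq h1.1 h1.2).2, neg_one_mul, add_neg_cancel, mul_zero, map_zero]
    rfl
  · obtain ⟨rfl, -⟩ := h2
    rw [(eq_of_mem_of_ne hpq h1.1 h1.2).2, neg_one_mul, add_neg_cancel, mul_zero, map_zero]
    rfl
  · rw [mul_zero, add_zero, mul_zero, map_zero]
    rfl
  · rw [map_zero]
    rfl

theorem cyclicIotaPrime_eq : cyclicIotaPrime c (σ.ginzburgAction hS) =
    toSkew hS hfix hk (gPotential (c.potential S)) := by
  rw [cyclicIotaPrime]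
  refine Eq.trans ?_ (toSkew_apply hS hfix hk _).symm
  refine Finset.sum_congr rfl fun p _ => ?_
  rw [Finset.sum_eq_single p]
  · rw [idem_mul_iotaPrime_mul_idem hS hk, foldPart_weighted_self hS hfix hk]
  · intro q _ hq
    rw [foldElt_gPotential_of_ne hfix hk _ hq.symm, tens_zero, zero_mul]
  · simp

theorem cyclicIotaPrime_eq_iotaPrime (hfix : σ.FixesArrows) (hk : (2 : k) ≠ 0)
    (h : σ.mapPotential gen S = S) :
    cyclicIotaPrime c (σ.ginzburgAction hS) = iotaPrime c (σ.ginzburgAction hS) := by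
  have h1 : iotaPrime c (σ.ginzburgAction hS) = eBar c (σ.ginzburgAction hS) *
      iotaPrime c (σ.ginzburgAction hS) * eBar c (σ.ginzburgAction hS) := by
    have he : eBar c (σ.ginzburgAction hS) * eBar c _ = eBar c _ :=
      (isDGIdempotent_eBar (hS := hS) (c := c) hk).idem
    rw [iotaPrime_eq, ← mul_assoc, ← mul_assoc, he, mul_assoc _ (eBar c _) (eBar c _), he]
  rw [h1, cyclicIotaPrime]
  conv_rhs => rw [eBar, Finset.sum_mul, Finset.sum_mul]
  refine Finset.sum_congr rfl fun p _ => ?_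
  rw [Finset.mul_sum, Finset.sum_eq_single p]
  · intro q _ hq
    rw [idem_mul_iotaPrime_mul_idem hS hk, foldPart_weighted_of_ne hS hfix hk h hq.symm, tens_zero,
      zero_mul]
  · simp

end Value

section Arrows

theorem gEntry_gArrow (a : E) (i j : V) : gEntry S i j (gArrow S a) =
    if Q.t a = i ∧ Q.s a = j then word [Sum.inl a] else 0 := by
  change Matrix.single (Q.bar.t (Sum.inl a)) (Q.bar.s (Sum.inl a)) (word [Sum.inl a]) i j = _
  rw [Matrix.single_apply]
  rfl

theorem sg_t_mul_sg_s_of_isFixed {β : c.Arrow} (hs : σ.IsFixed (Q.s β.1.1))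
    (ht : σ.IsFixed (Q.t β.1.1)) : c.sg k (c.quiv.t β) * c.sg k (c.quiv.s β) = 1 := by
  change c.sg k (c.vertex _ _) * c.sg k (c.vertex _ _) = 1
  rw [sg_vertex_of_isFixed hs, sg_vertex_of_isFixed ht]
  exact units_cast_mul_self _

open Classical in
-- The right side is the coefficient of b in the twisted average of α and σ(α). If both ends of α
-- are fixed then σ(α) = α, the sign is 1 and the two halves add up to 1, hence weight 1. Otherwise
-- α and σ(α) differ and each keeps its half.
theorem coef_div_weight (hfix : σ.FixesArrows)
    (hk : (2 : k) ≠ 0) (β : c.Arrow) (b : E) : c.coef k β b / c.weight k β =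
    2⁻¹ * ((if b = β.1.1 then 1 else 0) + c.sg k (c.quiv.t β) * c.sg k (c.quiv.s β) *
      if σ.onE gen b = β.1.1 then 1 else 0) := by
  have hb : σ.onE gen b = β.1.1 ↔ b = σ.onE gen β.1.1 :=
    ⟨fun h => by rw [← h, onE_onE], fun h => by rw [h, onE_onE]⟩
  rw [coef, weight, if_congr hb rfl rfl]
  by_cases hf : σ.IsFixed (Q.s β.1.1) ∧ σ.IsFixed (Q.t β.1.1)
  · rw [if_pos hf, hfix _ hf.1 hf.2, sg_t_mul_sg_s_of_isFixed hf.1 hf.2]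
    split_ifs
    · rw [one_mul, one_add_one_eq_two, inv_mul_cancel₀ hk, div_one]
    · simp
  · rw [if_neg hf]
    have hne : σ.onE gen β.1.1 ≠ β.1.1 := fun h =>
      hf ⟨(σ.s_map gen _).symm.trans (congrArg Q.s h), (σ.t_map gen _).symm.trans (congrArg Q.t h)⟩
    by_cases h1 : b = β.1.1
    · subst h1
      rw [if_pos rfl, if_pos rfl, if_neg hne.symm]
      ring
    · rw [if_neg h1, if_neg h1]
      split_ifs <;> ring

/-- The component of α ⊗ 1 cut out by the ends of β is a twisted average, which by `coef_div_weight`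
is the image of the letter β; this fixes the normalisation of `barM` on arrows. -/
theorem foldPart_gArrow (β : c.Arrow) :
    foldPart hS (c.quiv.t β) (c.quiv.s β) (tens (σ.ginzburgAction hS) (gArrow S β.1.1) 1) =
      foldElt hfix hk S (c.quiv.t β) (c.quiv.s β) (arrowElt c.quiv.bar (Sum.inl β)) := by
  classical
  refine gEntry_ext fun i j => ?_
  have hentry : (arrowElt c.quiv.bar (Sum.inl β) : completePath k c.quiv.bar gdeg).1
      (c.quiv.t β) (c.quiv.s β) = word [Sum.inl β] := Matrix.single_apply_same _ _ _
  rw [gEntry_foldElt, hentry]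
  ext w
  rw [gEntry_foldPart_tens, gEntry_gArrow, gEntry_gArrow, Folding.fold_word_singleton]
  have hl : ∀ (P : Prop) [Decidable P] (l v : List (GArrow V E)),
    (if P then word l else 0 : Series k _) v =
      if P ∧ v = l then 1 else 0 := by
    intro P _ l v
    by_cases h : P
    · simp [h, word_apply]
    · simp [h]
  rw [hl, hl]
  cases w with
  | nil => simp
  | cons b w =>
    cases w with
    | cons b' w => simp
    | nil =>
      rcases b with b | b
      swap
      · have hM : (c.folding hfix hk).M (Sum.inl β) (Sum.inr b) = 0 :=
        by rcases b with b | b <;> rfl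
        simp [hM, onBar]
      have hM : (c.folding hfix hk).M (Sum.inl β) (Sum.inl b) = c.coef k β b / c.weight k β := rfl
      have h1 : ((Q.t β.1.1 = i ∧ Q.s β.1.1 = j) ∧ [Sum.inl b] =
        ([Sum.inl β.1.1] : List (GArrow V E))) ↔
          (Q.t b = i ∧ Q.s b = j) ∧ b = β.1.1 := by
        rw [List.cons.injEq, Sum.inl.injEq]
        constructor
        · rintro ⟨h, rfl, -⟩; exact ⟨h, rfl⟩
        · rintro ⟨h, rfl⟩; exact ⟨h, rfl, rfl⟩
      have h2 : ((Q.t β.1.1 = σ.onV gen i ∧ Q.s β.1.1 = σ.onV gen j) ∧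
          [Sum.inl b].map (σ.onBar gen) = ([Sum.inl β.1.1] : List (GArrow V E))) ↔
          (Q.t b = i ∧ Q.s b = j) ∧ σ.onE gen b = β.1.1 := by
        change (_ ∧ [Sum.inl (σ.onE gen b)] = [Sum.inl β.1.1]) ↔ _
        rw [List.cons.injEq, Sum.inl.injEq]
        constructor
        · rintro ⟨h, h', -⟩
          rw [← h', σ.t_map, σ.s_map, (σ.onV gen).injective.eq_iff,
            (σ.onV gen).injective.eq_iff] at h
          exact ⟨h, h'⟩
        · rintro ⟨⟨rfl, rfl⟩, h'⟩
          exact ⟨by rw [← h', σ.t_map, σ.s_map]; exact ⟨rfl, rfl⟩, h', rfl⟩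
      rw [if_congr h1 rfl rfl, if_congr h2 rfl rfl]
      by_cases hb : Q.t b = i ∧ Q.s b = j
      · obtain ⟨rfl, rfl⟩ := hb
        by_cases h0 : (c.folding hfix hk).M (Sum.inl β) (Sum.inl b) = 0
        · rw [hM, coef_div_weight hfix hk] at h0
          simp only [true_and, and_self, h0, ite_self, hM, coef_div_weight hfix hk]
        · have hmem := (c.folding hfix hk).M_ne _ _ h0
          have hmem' : c.mem (c.quiv.t β) (Q.t b) ∧ c.mem (c.quiv.s β) (Q.s b) := hmem
          rw [if_pos hmem']
          simp only [true_and, and_self, hM, coef_div_weight hfix hk]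
          exact (if_pos (show _ = _ ∧ _ = _ from ⟨rfl, rfl⟩)).symm
      · simp only [hb, false_and, if_false, mul_zero, add_zero, ite_self]
        exact (if_neg hb).symm

theorem foldElt_arrowElt_of_ne (β : c.Arrow) {p q : c.Vertex}
    (h : ¬ (c.quiv.t β = p ∧ c.quiv.s β = q)) :
    foldElt hfix hk S p q (arrowElt c.quiv.bar (Sum.inl β)) = 0 := by
  refine gEntry_ext fun i j => ?_
  have hentry : (arrowElt c.quiv.bar (Sum.inl β) : completePath k c.quiv.bar gdeg).1 p q = 0 := by
    change Matrix.single (c.quiv.t β) (c.quiv.s β) (word [Sum.inl β]) p q = 0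
    rw [Matrix.single_apply, if_neg h]
  rw [gEntry_foldElt, hentry, map_zero, map_zero]

theorem arrowPM_eq (β : c.Arrow) : arrowPM c (σ.ginzburgAction hS) β =
    toSkew hS hfix hk (arrowElt c.quiv.bar (Sum.inl β)) := by
  rw [arrowPM, idem_mul_mul_idem, toSkew_apply, Finset.sum_eq_single (c.quiv.t β),
    Finset.sum_eq_single (c.quiv.s β), foldPart_gArrow hS hfix hk]
  · intro q _ hq
    rw [foldElt_arrowElt_of_ne hfix hk β fun h => hq h.2.symm, tens_zero, zero_mul]
  · simp
  · intro p _ hp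
    refine Finset.sum_eq_zero fun q _ => ?_
    rw [foldElt_arrowElt_of_ne hfix hk β fun h => hp h.1.symm, tens_zero, zero_mul]
  · simp

theorem toSkew_mul_prod (l : List (completePath k c.quiv.bar gdeg))
    (x : completePath k c.quiv.bar gdeg) :
    toSkew hS hfix hk x * (l.map (toSkew hS hfix hk)).prod = toSkew hS hfix hk (x * l.prod) := by
  induction l generalizing x with
  | nil => rw [List.map_nil, List.prod_nil, List.prod_nil, mul_one, mul_one]
  | cons y l ih => rw [List.map_cons, List.prod_cons, List.prod_cons, ← mul_assoc, ← toSkew_mul, ih,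
      mul_assoc]

/-- Nonemptiness matters: the empty product is 1 in the skew group algebra, whereas the unit of the
path algebra goes to ē. -/
theorem prod_map_arrowPM {u : List c.Arrow} (hu : u ≠ []) :
    (u.map (arrowPM c (σ.ginzburgAction hS))).prod = toSkew hS hfix hk
      (u.map fun β => (arrowElt c.quiv.bar (Sum.inl β) : completePath k c.quiv.bar gdeg)).prod := by
  obtain ⟨β, u, rfl⟩ := List.exists_cons_of_ne_nil hu
  rw [List.map_cons, List.prod_cons, List.map_cons, List.prod_cons, ← toSkew_mul_prod,
    arrowPM_eq hS hfix hk,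
    List.map_map]
  congr 3
  exact funext fun β => arrowPM_eq hS hfix hk β

end Arrows

end Quiv.Action.Choice

/-! ### Evaluation of potentials in the corner -/

section PathProducts

variable {k P X : Type*} [CommRing k] [Fintype P] [DecidableEq P] (R : Quiv P X) (deg : X → ℤ)

open Classical in
theorem prod_map_arrowElt (u : List X) (p q : P) :
    (u.map fun a => (arrowElt R a : completePath k R deg)).prod.1 p q =
      if R.IsPath p u q then word u else 0 := by
  induction u generalizing p with
  | nil =>
    change (1 : Matrix P P (Series k X)) p q = _
    rw [Matrix.one_apply]
    by_cases h : p = q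
    · rw [if_pos h, if_pos (show R.IsPath p [] q from h)]
      rfl
    · rw [if_neg h, if_neg (show ¬ R.IsPath p [] q from h)]
  | cons a u ih =>
    rw [List.map_cons, List.prod_cons]
    change (Matrix.single (R.t a) (R.s a) (word [a]) *
      (u.map fun a => (arrowElt R a : completePath k R deg)).prod.1 : Matrix P P _) p q = _
    by_cases h : R.t a = p
    · subst h
      rw [Matrix.single_mul_apply_same, ih]
      by_cases h' : R.IsPath (R.s a) u q
      · rw [if_pos h', if_pos ⟨rfl, h'⟩, word_mul_word]
        rfl
      · rw [if_neg h', if_neg fun h => h' h.2, mul_zero]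
    · rw [Matrix.single_mul_apply_of_ne _ _ _ _ _ (Ne.symm h), if_neg fun h' => h h'.1]

theorem sum_ofFn [Fintype X] {H : List X → k} {v : List X} (hH : ∀ u, u ≠ v → H u = 0) {N : ℕ}
    (hv : v.length < N) : ∑ n ∈ Finset.range N, ∑ u : Fin n → X, H (List.ofFn u) = H v := by
  rw [Finset.sum_eq_single v.length]
  · rw [Finset.sum_eq_single v.get]
    · rw [List.ofFn_get]
    · intro u _ hu
      refine hH _ fun h => hu ?_
      refine List.ofFn_injective ?_
      rw [h, List.ofFn_get]
    · simp
  · intro n _ hn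
    refine Finset.sum_eq_zero fun u _ => hH _ fun h => hn ?_
    rw [← h, List.length_ofFn]
  · intro h
    exact absurd (Finset.mem_range.2 hv) h

end PathProducts
section Entry

variable (k : Type*) [CommRing k] {P X : Type*} [Fintype P] [DecidableEq P] (R : Quiv P X)
  (deg : X → ℤ)

/-- The coefficient of a path, as a linear map. -/
def pathCoeff (p q : P) (l : List X) : completePath k R deg →ₗ[k] k where
  toFun f := f.1 p q l
  map_add' _ _ := rfl
  map_smul' _ _ := rfl

end Entry

theorem Quiv.eq_of_isPath {P X : Type*} (R : Quiv P X) {p q r : P} {u : List X}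
    (h : R.IsPath p u q) (h' : R.IsPath p u r) : q = r := by
  induction u generalizing p with
  | nil => exact Eq.trans (Eq.symm h) h'
  | cons a u ih => exact ih h.2 h'.2

theorem gPotential_injective {k P X : Type*} [CommRing k] [Fintype P] [DecidableEq P] [Fintype X]
    {R : Quiv P X} {T T' : Potential k R}
    (h : (gPotential T : completePath k R.bar gdeg) = (gPotential T' : completePath k R.bar gdeg)) :
    T = T' := by
  -- A coefficient is visible in the algebra only at a cycle, hence the restriction to words where T
  -- is nonzero and the symmetric use below.
  have key : ∀ (T T' : Potential k R),
      (gPotential T : completePath k R.bar gdeg) = (gPotential T' : completePath k R.bar gdeg) →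
      ∀ v, T.series v ≠ 0 → T.series v = T'.series v := by
    intro T T' h v hv
    obtain ⟨-, p, hp⟩ := T.isCycle v hv
    have h1 := congrArg (fun f : completePath k R.bar gdeg => f.1 p p (v.map Sum.inl)) h
    change gEntry T p p (gPotential T) _ = gEntry T' p p (gPotential T') _ at h1
    have hp' : R.bar.IsPath p (v.map Sum.inl) p := (isPath_bar_map R p p v).2 hp
    rwa [gEntry_gPotential, gEntry_gPotential, if_pos ⟨rfl, hp'⟩, if_pos ⟨rfl, hp'⟩, gEmb_map,
      gEmb_map] at h1
  have hs : T.series = T'.series := by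
    ext v
    by_cases h1 : T.series v = 0
    · by_cases h2 : T'.series v = 0
      · rw [h1, h2]
      · exact (key T' T h.symm v h2).symm
    · exact key T T' h v h1
  cases T
  cases T'
  congr

namespace Quiv.Action.Choice

variable {k : Type*} [Field k] {V E : Type*} {Q : Quiv V E} {σ : Q.Action C2} {S : Potential k Q}
variable [Fintype V] [DecidableEq V] [Fintype E] {c : σ.Choice}
variable (hS : S.CyclicEquiv (σ.mapPotential gen S)) (hfix : σ.FixesArrows) (hk : (2 : k) ≠ 0)

/-- Letterwise substitution preserves length; this is the continuity needed to evaluate infinite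
sums. -/
theorem gEntry_foldElt_congr {f f' : completePath k c.quiv.bar gdeg} {p q : c.Vertex}
    {w : List (GArrow V E)} (h : ∀ l, l.length = w.length → f.1 p q l = f'.1 p q l) (i j : V) :
    gEntry S i j (foldElt hfix hk S p q f) w = gEntry S i j (foldElt hfix hk S p q f') w := by
  rw [← sub_eq_zero, ← Series.sub_apply, ← map_sub, ← map_sub]
  by_contra h'
  obtain ⟨u, hu, huw⟩ := Folding.exists_of_fold_ne h'
  exact hu (sub_eq_zero.2 (h u huw.length_eq))

theorem skewCoeff_toSkew_congr {f f' : completePath k c.quiv.bar gdeg} {w : List (GArrow V E)}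
    (h : ∀ p q l, l.length = w.length → f.1 p q l = f'.1 p q l) (g : C2) (i j : V) :
    skewCoeff (σ.ginzburgAction hS) (toSkew hS hfix hk f) g i j w =
      skewCoeff (σ.ginzburgAction hS) (toSkew hS hfix hk f') g i j w := by
  have key : ∀ f : completePath k c.quiv.bar gdeg,
      skewCoeff (σ.ginzburgAction hS) (toSkew hS hfix hk f) g i j w =
        ∑ p : c.Vertex, ∑ q : c.Vertex, 2⁻¹ * ((if (1 : C2) = g then 1 else 0) +
          c.sg k q * if gen = g then 1 else 0) * gEntry S i j (foldElt hfix hk S p q f) w := by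
    intro f
    change gEntry S i j (skewPart _ g (toSkew hS hfix hk f)) w = _
    rw [toSkew_apply, map_sum, map_sum, Series.sum_apply]
    refine Finset.sum_congr rfl fun p _ => ?_
    rw [map_sum, map_sum, Series.sum_apply]
    refine Finset.sum_congr rfl fun q _ => ?_
    rw [(isFoldedElt_foldElt hS hfix hk p q f).tens_mul_idem, map_smul, map_add,
      map_smul (skewPart _ g), skewPart_tens, skewPart_tens, map_smul, map_add, map_smul,
        Series.smul_apply,
      Series.add_apply, Series.smul_apply]
    split_ifs <;> (try simp only [map_zero, Series.zero_apply]) <;> ring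
  rw [key, key]
  refine Finset.sum_congr rfl fun p _ => Finset.sum_congr rfl fun q _ => ?_
  rw [gEntry_foldElt_congr hfix hk (h p q)]

/-- The value of the terms of length less than `N` of a potential. -/
def partialValue (T : Potential k c.quiv) (N : ℕ) : completePath k c.quiv.bar gdeg :=
  ∑ n ∈ Finset.range N, ∑ u : Fin n → c.Arrow, T.series (List.ofFn u) •
    ((List.ofFn u).map fun β =>
      (arrowElt c.quiv.bar (Sum.inl β) : completePath k c.quiv.bar gdeg)).prod

theorem toSkew_partialValue (T : Potential k c.quiv) (N : ℕ) :
    toSkew hS hfix hk (partialValue T N) =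
      ∑ n ∈ Finset.range N, ∑ u : Fin n → c.Arrow, T.series (List.ofFn u) •
        (List.ofFn fun l => arrowPM c (σ.ginzburgAction hS) (u l)).prod := by
  rw [partialValue, map_sum]
  refine Finset.sum_congr rfl fun n _ => ?_
  rw [map_sum]
  refine Finset.sum_congr rfl fun u _ => ?_
  rw [map_smul]
  -- The empty word has coefficient zero in a potential, so the mismatch between 1 and ē does not
  -- matter.
  by_cases hu : List.ofFn u = []
  · have : T.series (List.ofFn u) = 0 := by
      by_contra h
      exact (T.isCycle _ h).1 hu
    rw [this, zero_smul, zero_smul]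
  · rw [← prod_map_arrowPM hS hfix hk hu, List.map_ofFn]
    rfl

theorem partialValue_apply (T : Potential k c.quiv) {N : ℕ}
    {l : List (GArrow c.Vertex c.Arrow)} (hl : l.length < N) (p q : c.Vertex) :
    (partialValue T N).1 p q l = gEntry T p q (gPotential T) l := by
  classical
  have hprod : ∀ u : List c.Arrow, ((u.map fun β => (arrowElt c.quiv.bar (Sum.inl β) :
      completePath k c.quiv.bar gdeg)).prod).1 p q l =
      if c.quiv.IsPath p u q ∧ l = u.map Sum.inl then 1 else 0 := by
    intro u
    have h := congrArg (fun f => f l) (prod_map_arrowElt (k := k) c.quiv.bar gdeg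
      (u.map Sum.inl) p q)
    rw [List.map_map] at h
    refine h.trans ?_
    by_cases hu : c.quiv.IsPath p u q
    · rw [if_pos ((isPath_bar_map c.quiv p q u).2 hu), word_apply]
      simp [hu]
    · rw [if_neg fun h' => hu ((isPath_bar_map c.quiv p q u).1 h')]
      simp [hu]
  have h1 : (partialValue T N).1 p q l = ∑ n ∈ Finset.range N, ∑ u : Fin n → c.Arrow,
      T.series (List.ofFn u) *
        if c.quiv.IsPath p (List.ofFn u) q ∧ l = (List.ofFn u).map Sum.inl then 1 else 0 := by
    change pathCoeff k c.quiv.bar gdeg p q l (partialValue T N) = _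
    rw [partialValue, map_sum]
    refine Finset.sum_congr rfl fun n _ => ?_
    rw [map_sum]
    refine Finset.sum_congr rfl fun u _ => ?_
    rw [map_smul, smul_eq_mul]
    exact congrArg _ (hprod _)
  rw [h1, gEntry_gPotential]
  by_cases hv : ∃ v : List c.Arrow, l = v.map Sum.inl
  · obtain ⟨v, rfl⟩ := hv
    rw [List.length_map] at hl
    rw [sum_ofFn (H := fun u => T.series u * if c.quiv.IsPath p u q ∧
      v.map Sum.inl = (u.map Sum.inl : List (GArrow c.Vertex c.Arrow)) then 1 else 0) (v := v) _ hl]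
    · rw [gEmb_map, if_congr (and_iff_left rfl) rfl rfl,
        if_congr (and_congr Iff.rfl (isPath_bar_map c.quiv p q v)) rfl rfl]
      by_cases hT : T.series v = 0
      · simp [hT]
      · obtain ⟨hne, r, hr⟩ := T.isCycle v hT
        by_cases hp : c.quiv.IsPath p v q
        · have hpq : p = q := by
            obtain ⟨b, v, rfl⟩ := List.exists_cons_of_ne_nil hne
            have hpr : p = r := hp.1.symm.trans hr.1
            subst hpr
            exact c.quiv.eq_of_isPath hr hp
          rw [if_pos hp, if_pos ⟨hpq, hp⟩, mul_one]
        · rw [if_neg hp, if_neg fun h => hp h.2, mul_zero]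
    · intro u hu
      rw [if_neg, mul_zero]
      rintro ⟨-, h⟩
      exact hu (List.map_injective_iff.2 Sum.inl_injective h).symm
  · have h0 : (gEmb T.series : Series k (GArrow c.Vertex c.Arrow)) l = 0 := by
      by_contra h
      obtain ⟨v, hv', -⟩ := exists_of_gEmb_ne h
      exact hv ⟨v, hv'⟩
    rw [h0, ite_self]
    refine Finset.sum_eq_zero fun n _ => Finset.sum_eq_zero fun u _ => ?_
    rw [if_neg fun h => hv ⟨_, h.2⟩, mul_zero]

/-- The partial sums are images of truncations of T, and coefficients at words of length less than N
see only that truncation. Existence and uniqueness of S_G thereby become a computation of ι'(S) and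
the injectivity of `toSkew`. -/
theorem isValue_iff (T : Potential k c.quiv) (x : DGAlgebra.skew (σ.ginzburgAction hS)) :
    IsValue c (σ.ginzburgAction hS) T x ↔ x = toSkew hS hfix hk (gPotential T) := by
  have key : ∀ (N : ℕ) (g : C2) (i j : V) (w : List (GArrow V E)), w.length < N →
      skewCoeff (σ.ginzburgAction hS) (∑ n ∈ Finset.range N, ∑ u : Fin n → c.Arrow,
        T.series (List.ofFn u) • (List.ofFn fun l =>
          arrowPM c (σ.ginzburgAction hS) (u l)).prod) g i j w =
      skewCoeff (σ.ginzburgAction hS) (toSkew hS hfix hk (gPotential T)) g i j w := by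
    intro N g i j w hw
    rw [← toSkew_partialValue hS hfix hk]
    exact skewCoeff_toSkew_congr hS hfix hk
      (fun p q l hl => partialValue_apply T (hl.trans_lt hw) p q) g i j
  constructor
  · intro h
    refine skew_ext _ fun g => gEntry_ext fun i j => Series.ext fun w => ?_
    exact (h (w.length + 1) g i j w (Nat.lt_succ_self _)).trans (key _ g i j w (Nat.lt_succ_self _))
  · rintro rfl N g i j w hw
    exact (key N g i j w hw).symm

end Quiv.Action.Choice

/-! ### Assembly of the dg isomorphism -/

/-- A bijective homomorphism of dg algebras is an isomorphism. -/
def DGIso.symmOfBijective {k : Type*} [CommRing k] {A B : DGAlgebra k} (φ : A →ₐ[k] B)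
    (hφ : Function.Bijective φ) (hgr : ∀ n x, x ∈ A.gr n → φ x ∈ B.gr n)
    (hd : ∀ x, φ (A.d x) = B.d (φ x)) : DGIso B A where
  __ := (AlgEquiv.ofBijective φ hφ).symm
  map_gr n y hy := by
    -- A degree-preserving map commutes with the homogeneous projections, so by injectivity the
    -- preimage of a homogeneous element equals its own projection.
    have hproj : ∀ x : A, φ (A.proj n x) = B.proj n (φ x) := by
      intro x
      induction x using A.induction with
      | h0 => simp
      | hadd x y hx hy => simp [hx, hy]
      | h m x hx =>
        by_cases hnm : n = m
        · subst hnm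
          rw [A.proj_same _ _ hx, B.proj_same _ _ (hgr _ _ hx)]
        · rw [A.proj_of_ne _ _ _ hnm hx, B.proj_of_ne _ _ _ hnm (hgr _ _ hx), map_zero]
    obtain ⟨x, rfl⟩ := hφ.2 y
    change (AlgEquiv.ofBijective φ hφ).symm (AlgEquiv.ofBijective φ hφ x) ∈ A.gr n
    rw [AlgEquiv.symm_apply_apply]
    have hx := hproj x
    rw [B.proj_same n _ hy] at hx
    rw [← hφ.1 hx]
    exact A.proj_mem n x
  map_d y := by
    obtain ⟨x, rfl⟩ := hφ.2 y
    change (AlgEquiv.ofBijective φ hφ).symm (B.d (φ x)) =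
      A.d ((AlgEquiv.ofBijective φ hφ).symm (AlgEquiv.ofBijective φ hφ x))
    rw [AlgEquiv.symm_apply_apply, ← hd]
    exact (AlgEquiv.ofBijective φ hφ).symm_apply_apply _

namespace Quiv.Action.Choice

variable {k : Type*} [Field k] {V E : Type*} {Q : Quiv V E} {σ : Q.Action C2} {S : Potential k Q}
variable [Fintype V] [DecidableEq V] [Fintype E] {c : σ.Choice}
variable (hS : S.CyclicEquiv (σ.mapPotential gen S)) (hfix : σ.FixesArrows) (hk : (2 : k) ≠ 0)

theorem eBar_mul_toSkew (f : completePath k c.quiv.bar gdeg) :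
    eBar c (σ.ginzburgAction hS) * toSkew hS hfix hk f = toSkew hS hfix hk f ∧
      toSkew hS hfix hk f * eBar c (σ.ginzburgAction hS) = toSkew hS hfix hk f := by
  rw [← toSkew_one hS hfix hk, ← toSkew_mul, ← toSkew_mul, one_mul, mul_one]
  exact ⟨rfl, rfl⟩

/-- The isomorphism of algebras from the complete Ginzburg dg algebra of `Q_G` to the corner of the
skew group algebra. -/
def toCorner : ginzburg c.quiv (c.potential S) →ₐ[k]
    (DGAlgebra.skew (σ.ginzburgAction hS)).corner (eBar c (σ.ginzburgAction hS))
      (isDGIdempotent_eBar hk) :=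
  AlgHom.ofLinearMap
    { toFun := fun f => (isDGIdempotent_eBar hk).toCorner (toSkew hS hfix hk f)
        (eBar_mul_toSkew hS hfix hk f)
      map_add' := fun f g => Subtype.ext (map_add (toSkew hS hfix hk) f g)
      map_smul' := fun a f => Subtype.ext (map_smul (toSkew hS hfix hk) a f) }
    (Subtype.ext (toSkew_one hS hfix hk))
    (fun f g => Subtype.ext (toSkew_mul hS hfix hk f g))

theorem toCorner_bijective : Function.Bijective (toCorner hS hfix hk (c := c)) := by
  constructor
  · intro f g h
    exact toSkew_injective hS hfix hk (congrArg Subtype.val h)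
  · intro x
    obtain ⟨f, hf⟩ := exists_toSkew hS hfix hk (c := c) x.1
    refine ⟨f, Subtype.ext (hf.trans ?_)⟩
    have hx := (isDGIdempotent_eBar (hS := hS) (c := c) hk).corner_mem x
    rw [hx.1, hx.2]

/-- The isomorphism between the corner of the skew group dg algebra and the complete Ginzburg dg
algebra of `Q_G`. -/
def cornerIso : DGIso ((DGAlgebra.skew (σ.ginzburgAction hS)).corner
    (eBar c (σ.ginzburgAction hS)) (isDGIdempotent_eBar hk)) (ginzburg c.quiv (c.potential S)) :=
  DGIso.symmOfBijective (toCorner hS hfix hk) (toCorner_bijective hS hfix hk)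
    (fun _ _ hf => toSkew_mem hS hfix hk hf)
    (fun f => Subtype.ext (d_toSkew hS hfix hk f).symm)

end Quiv.Action.Choice
end QP

theorem mainTheorem2 {k : Type*} [Field k] (hk : (2 : k) ≠ 0)
    {V E : Type*} [Fintype V] [DecidableEq V] [Fintype E]
    (Q : QP.Quiv V E) (S : QP.Potential k Q) (σ : Q.Action QP.C2)
    (hS : S.CyclicEquiv (σ.mapPotential QP.gen S)) :
    ∃ ρ : QP.DGAction QP.C2 (QP.ginzburg Q S), σ.Induces ρ ∧
      (σ.FixesArrows → ∀ c : σ.Choice,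
        ∃ S_G : QP.Potential k c.quiv,
          QP.IsValue c ρ S_G (QP.cyclicIotaPrime c ρ) ∧
          (∀ T : QP.Potential k c.quiv,
            QP.IsValue c ρ T (QP.cyclicIotaPrime c ρ) → T = S_G) ∧
          (σ.mapPotential QP.gen S = S →
            QP.cyclicIotaPrime c ρ = QP.iotaPrime c ρ) ∧
          ∃ he : (QP.DGAlgebra.skew ρ).IsDGIdempotent (QP.eBar c ρ),
            Nonempty (QP.DGIso
              ((QP.DGAlgebra.skew ρ).corner (QP.eBar c ρ) he)
              (QP.ginzburg c.quiv S_G))) := by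
  refine ⟨σ.ginzburgAction hS, σ.induces_ginzburgAction hS, fun hfix c => ⟨c.potential S, ?_, ?_,
    QP.Quiv.Action.Choice.cyclicIotaPrime_eq_iotaPrime hS hfix hk,
    QP.Quiv.Action.Choice.isDGIdempotent_eBar hk,
    ⟨QP.Quiv.Action.Choice.cornerIso hS hfix hk⟩⟩⟩
  · rw [QP.Quiv.Action.Choice.isValue_iff hS hfix hk]
    exact QP.Quiv.Action.Choice.cyclicIotaPrime_eq hS hfix hk
  · intro T hT
    rw [QP.Quiv.Action.Choice.isValue_iff hS hfix hk] at hT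
    refine QP.gPotential_injective (QP.Quiv.Action.Choice.toSkew_injective hS hfix hk ?_)
    exact hT.symm.trans (QP.Quiv.Action.Choice.cyclicIotaPrime_eq hS hfix hk)
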